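/- A \emph{linear group} is an infinite set $D$ with a total order $\le$ and a group operation $+$ with identity $0$ (not assumed commutative). A \emph{streaming register transducer} over $D$ consists of finite sets $\Sigma,\Gamma$ of input and output labels, a finite set $Q$ of states with an initial state $q_0$, a number $k\in\mathbb N$ of registers, an initial assignment $R_0\in D^k$, and a set $\Delta$ of transitions $(q,\sigma,l,m,u,\gamma,q')$ with $q,q'\in Q$, $\sigma\in\Sigma$, $l\in\{>,=,<\}^k$, $m\in\{\mathsf{old},\mathsf{new},\mathsf{add}\}^k$, $u\in\{1,\dots,k\}$, $\gamma\in\Gamma$. Such a transition enables a step from configuration $(q,R)$ to $(q',R')$ that reads $(\sigma,d)\in\Sigma\times D$ and writes $(\gamma,R'[u])$, if for every $i$ the relation $d\;l[i]\;R[i]$ holds and $R'[i]$ is $R[i]$, $d$ or $R[i]+d$ according as $m[i]$ is $\mathsf{old}$, $\mathsf{new}$ or $\mathsf{add}$. The transducer is \emph{add-free} if $\mathsf{add}$ does not occur in $\Delta$, \emph{uninitialized} if $R_0=(0,\dots,0)$, and \emph{functional} if for every finite word $s$ over $\Sigma\times D$ there is at most one word $t$ over $\Gamma\times D$, $|t|=|s|$,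 such that some run from $(q_0,R_0)$ reads $s$ and writes $t$. An add-free uninitialized transducer is given to an algorithm by listing $\Sigma$, $\Gamma$, $Q$, $k$, $q_0$ and $\Delta$. \textbf{Theorem.} For every linear group $D$, the problem whether a given add-free uninitialized streaming register transducer over $D$ is functional, and the complementary problem whether it is not functional, are both in $\mathsf{NEXPTIME}=\bigcup_{p}\mathsf{NTIME}(2^{p(n)})$, where $p$ ranges over the polynomials and $n$ is the length of the description of the transducer. Moreover, for the linear groups whose order is invariant under left and right translations, these two problems do not depend on $D$: there are two languages in $\mathsf{NEXPTIME}$ that are the functionality problem and the non-functionality problem for all such $D$ at once. -/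

import Mathlib

universe u

/-! ### Streaming register transducers -/

/-- The three possible register updates: keep the old value, store the input data value,
add the input data value. -/
inductive RegUpdate
  | old
  | new
  | add

/-- The value of a register with current value `r` after the update, when the input data value
is `d`. -/
def RegUpdate.apply {D : Type*} [Add D] : RegUpdate → D → D → D
  | old, r, _ => r
  | new, _, d => d
  | add, r, d => r + d

/-- A transition `(q, σ, l, m, u, γ, q')` of a transducer with input labels `A`, output labels `B`,
states `Q` and `k` registers. In the guard, `gt`, `eq`, `lt` stand for `>`, `=`, `<`. -/
structure SRTTransition (A B Q : Type*) (k : ℕ) where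
  source : Q
  inLabel : A
  guard : Fin k → Ordering
  update : Fin k → RegUpdate
  outReg : Fin k
  outLabel : B
  target : Q

/-- A streaming register transducer with input labels `A`, output labels `B`, data domain `D`,
states `Q` and `k` registers. -/
structure SRT (A B D Q : Type*) (k : ℕ) where
  start : Q
  initReg : Fin k → D
  trans : Set (SRTTransition A B Q k)

namespace SRT

variable {A B D Q : Type*} {k : ℕ}

/-- One transition step: from the configuration `(q, R)` the transducer reads the input letter
`x = (σ, d)`, writes the output letter `y = (γ, d')` and moves to the configuration `(q', R')`. -/
def Step [LinearOrder D] [Add D] (S : SRT A B D Q k)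
    (c : Q × (Fin k → D)) (x : A × D) (y : B × D) (c' : Q × (Fin k → D)) : Prop :=
  ∃ t ∈ S.trans,
    t.source = c.1 ∧ t.inLabel = x.1 ∧
    (∀ i, (t.guard i).Compares x.2 (c.2 i)) ∧
    (∀ i, c'.2 i = (t.update i).apply (c.2 i) x.2) ∧
    y = (t.outLabel, c'.2 t.outReg) ∧
    t.target = c'.1

/-- `S.Run c V c'`: there is a finite sequence of transition steps from the configuration `c` to
the configuration `c'` whose input-output pairs form the word `V`. -/
inductive Run [LinearOrder D] [Add D] (S : SRT A B D Q k) :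
    Q × (Fin k → D) → List ((A × D) × (B × D)) → Q × (Fin k → D) → Prop
  | nil (c : Q × (Fin k → D)) : Run S c [] c
  | cons {c c₁ c' : Q × (Fin k → D)} {x : A × D} {y : B × D} {V : List ((A × D) × (B × D))} :
      S.Step c x y c₁ → Run S c₁ V c' → Run S c ((x, y) :: V) c'

/-- The transformation defined by `S`: all transformation instances `s ⊗ t` of runs of `S` that
start in the initial configuration. -/
def transformation [LinearOrder D] [Add D] (S : SRT A B D Q k) :
    Set (List ((A × D) × (B × D))) :=
  {V | ∃ c, S.Run (S.start, S.initReg) V c}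

/-- For every finite input data word `s`, there is at most one data word `t` (of the same length)
such that `s ⊗ t` belongs to the transformation defined by `S`. -/
def Functional [LinearOrder D] [Add D] (S : SRT A B D Q k) : Prop :=
  ∀ s : List (A × D),
    {t : List (B × D) | s.length = t.length ∧ s.zip t ∈ S.transformation}.Subsingleton

/-- No transition uses the update `add`. -/
def AddFree (S : SRT A B D Q k) : Prop :=
  ∀ t ∈ S.trans, ∀ i, t.update i ≠ RegUpdate.add

/-- All registers are initially zero. -/
def Uninitialized [Zero D] (S : SRT A B D Q k) : Prop :=
  ∀ i, S.initReg i = 0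

end SRT

/-! ### Codes of transducers -/

/-- The alphabet in which transducers are written down. -/
inductive SRTSymbol
  | tick
  | sep
  | cmp (o : Ordering)
  | upd (m : RegUpdate)

/-- A natural number in unary notation, followed by a separator. -/
def unaryCode (n : ℕ) : List SRTSymbol :=
  List.replicate n SRTSymbol.tick ++ [SRTSymbol.sep]

/-- The code of a transition: its seven components one after the other. -/
def SRTTransition.code {a b n k : ℕ} (t : SRTTransition (Fin a) (Fin b) (Fin n) k) :
    List SRTSymbol :=
  unaryCode t.source ++ unaryCode t.inLabel ++
    (List.ofFn fun i => SRTSymbol.cmp (t.guard i)) ++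
    (List.ofFn fun i => SRTSymbol.upd (t.update i)) ++
    unaryCode t.outReg ++ unaryCode t.outLabel ++ unaryCode t.target

/-- `w` is a code of `S`: it lists the numbers of input labels, output labels, states and
registers, the initial state, and then all transitions, in any order. (The data domain and the
initial register values are not written; this is used for all-zero registers only. All numbers
written are bounded by the sizes of the explicitly given finite sets, so `w` is as long as a usual
description of `S`, up to a polynomial.) -/
def SRT.IsCode {D : Type*} {a b n k : ℕ} (S : SRT (Fin a) (Fin b) D (Fin n) k)
    (w : List SRTSymbol) : Prop :=
  ∃ l : List (SRTTransition (Fin a) (Fin b) (Fin n) k), (∀ t, t ∈ l ↔ t ∈ S.trans) ∧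
    w = unaryCode a ++ unaryCode b ++ unaryCode n ++ unaryCode k ++ unaryCode S.start ++
      l.flatMap SRTTransition.code

/-- The functionality problem of add-free uninitialized transducers over `D`, as a language. -/
def functionalityProblemAU (D : Type u) [LinearOrder D] [AddGroup D] : Set (List SRTSymbol) :=
  {w | ∃ (a b n k : ℕ) (S : SRT (Fin a) (Fin b) D (Fin n) k),
    S.AddFree ∧ S.Uninitialized ∧ S.IsCode w ∧ S.Functional}

/-- The non-functionality problem of add-free uninitialized transducers over `D`, as a
language. -/
def nonfunctionalityProblemAU (D : Type u) [LinearOrder D] [AddGroup D] : Set (List SRTSymbol) :=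
  {w | ∃ (a b n k : ℕ) (S : SRT (Fin a) (Fin b) D (Fin n) k),
    S.AddFree ∧ S.Uninitialized ∧ S.IsCode w ∧ ¬ S.Functional}

/-! ### Nondeterministic Turing machines and the class NEXPTIME -/

/-- A nondeterministic multi-stack Turing machine with input alphabet `A`: Mathlib's model
`Turing.TM2` (two stacks make up one two-way tape) with everything finite, and with a finite list
of alternative statements, instead of a single statement, at every label. -/
structure NTM (A : Type) where
  /-- the stacks -/
  K : Type
  [decEqK : DecidableEq K]
  [finK : Finite K]
  /-- the alphabets of the stacks -/
  Γ : K → Type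
  [finΓ : ∀ i, Finite (Γ i)]
  /-- the labels of the finite control -/
  Λ : Type
  [finΛ : Finite Λ]
  /-- the states of the internal memory -/
  σ : Type
  [finσ : Finite σ]
  /-- the stack that holds the input, and how a letter of the input is written on it -/
  input : K
  inputLetter : A → Γ input
  main : Λ
  initState : σ
  /-- the alternatives at a label -/
  program : Λ → List (Turing.TM2.Stmt Γ Λ σ)
  /-- the internal states in which a halted machine accepts -/
  accept : Set σ

namespace NTM

variable {A : Type} (M : NTM A)

instance : DecidableEq M.K := M.decEqK

/-- The configurations of the machine. -/
abbrev Cfg : Type := Turing.TM2.Cfg M.Γ M.Λ M.σ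

/-- The initial configuration: the input stack holds the input word with its first letter on top,
the other stacks are empty. -/
def init (w : List A) : M.Cfg where
  l := some M.main
  var := M.initState
  stk := Function.update (fun _ => []) M.input (w.map M.inputLetter)

/-- One step: execute one of the alternatives at the current label. -/
def Step (c c' : M.Cfg) : Prop :=
  ∃ l, c.l = some l ∧ ∃ q ∈ M.program l, c' = Turing.TM2.stepAux q c.var c.stk

/-- Some computation leads from `c` to `c'` in exactly `n` steps. -/
def ReachesIn : ℕ → M.Cfg → M.Cfg → Prop
  | 0, c, c' => c = c'
  | n + 1, c, c' => ∃ c₁, M.Step c c₁ ∧ ReachesIn n c₁ c'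

/-- Some computation of exactly `n` steps on the input `w` halts in an accepting state. -/
def AcceptsIn (w : List A) (n : ℕ) : Prop :=
  ∃ c, M.ReachesIn n (M.init w) c ∧ c.l = none ∧ c.var ∈ M.accept

end NTM

/-- The languages accepted by a nondeterministic machine in time `T`: the machine has an accepting
computation on a word exactly if the word belongs to the language, and then it has an accepting
computation of at most `T n` steps, where `n` is the length of the word. -/
def NTIME {A : Type} (T : ℕ → ℕ) : Set (Set (List A)) :=
  {L | ∃ M : NTM A, ∀ w : List A,
    (w ∈ L ↔ ∃ m, M.AcceptsIn w m) ∧ (w ∈ L → ∃ m ≤ T w.length, M.AcceptsIn w m)}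

/-- Nondeterministic time `2 ^ p(n)` for some polynomial `p`. -/
def NEXPTIME {A : Type} : Set (Set (List A)) :=
  {L | ∃ p : Polynomial ℕ, L ∈ NTIME fun n => 2 ^ p.eval n}

/-!
A transducer is not functional exactly if two copies of it that read the same input reach a
configuration in which their outputs have been different (`not_functional_iff`). In an add-free
uninitialized transducer all register values are zero or input values, and they are only compared.
So the existence of such a pair of runs depends only on the finite suborders of the data domain
together with zero, that is, on the numbers of data values below and above zero
(`TransducerData.flagged_iff`). If both are infinite, then the rational numbers may serve as data
values instead. If only `m` data values are below zero, then these become `0`, …, `m - 1`, zero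
becomes `m`, and the rational numbers above `m` are the others. If there are only finitely many data
values above zero, the order is reversed (`exists_model`). In an infinite bi-ordered group, negation
shows that both numbers are infinite, so that only one model occurs (`problemAU_subset`).

Over a dense model, a transition that is possible in one configuration is possible in every similar
configuration, that is, in every one with the same states and with register values of the same order
type (`exists_samePos`, `PairConf.Similar.next`). Every order type is realized by natural numbers
that are bounded linearly in the number of registers and still leave gaps for one further value
(`exists_sameType_room`). There are only exponentially many such configurations, and a family of
them that is closed under transitions up to similarity certifies functionality
(`TransducerData.ClosedFamily`), while a derivation of a configuration with different outputs
certifies non-functionality (`TransducerData.Derivation`). The number of data values on a finite side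
of zero is a constant of the problem, so it does not matter that the values on this side have no
gaps and have to be represented exactly.

Membership in `NEXPTIME` is obtained from a criterion of descriptive complexity
(`mem_NEXPTIME_of_foPred`): it is enough to guess a number `N` of exponential size and finitely many
binary functions on `{0, …, N}` for which a fixed first-order sentence about these functions, addition
and the letters of the input holds. The parsing of a code and the conditions on the certificates are
of this form (`foPred_isCertified`). The criterion itself is proved by a nondeterministic program for
stack machines, which guesses the graphs of the functions as a table of bits and evaluates the sentence by
exhaustive search over the values of the quantified variables (`runs_eval`); the programs are
compiled to machines in the sense of `NTM` (`acceptsIn_toNTM`).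
-/

/-! ### Structured stack programs -/

/-- An elementary operation on finitely many stacks `K` over the alphabet `G` and a Boolean flag. -/
inductive StackOp (K G : Type)
  /-- remove the top of a stack -/
  | drop (k : K)
  /-- push the top of the first stack, if there is one, on the second stack -/
  | dup (k k' : K)
  /-- push a fixed letter -/
  | push (k : K) (x : G)
  /-- update the flag as a function of its value and the top of a stack -/
  | setFlag (k : K) (g : Bool → Option G → Bool)

/-- The states on which stack programs act: the flag and the contents of the stacks. -/
abbrev StackState (K G : Type) := Bool × (K → List G)

/-- Structured nondeterministic stack programs. A test looks at the flag and at the top of one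
stack. -/
inductive StackProg (K G : Type)
  /-- execute one of the listed operations -/
  | op (l : List (StackOp K G))
  | seq (p q : StackProg K G)
  | ite (k : K) (g : Bool → Option G → Bool) (p q : StackProg K G)
  | loop (k : K) (g : Bool → Option G → Bool) (p : StackProg K G)

namespace StackProg

variable {K G : Type} [DecidableEq K]

/-- The effect of an elementary operation. -/
def _root_.StackOp.apply : StackOp K G → StackState K G → StackState K G
  | .drop k, s => (s.1, Function.update s.2 k (s.2 k).tail)
  | .dup k k', s => (s.1, Function.update s.2 k' ((s.2 k).head?.toList ++ s.2 k'))
  | .push k x, s => (s.1, Function.update s.2 k (x :: s.2 k))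
  | .setFlag k g, s => (g s.1 (s.2 k).head?, s.2)

/-- `Exec p s t s'`: some execution of `p` started in `s` ends in `s'` after `t` steps. -/
inductive Exec : StackProg K G → StackState K G → ℕ → StackState K G → Prop
  | op {l : List (StackOp K G)} {o} (h : o ∈ l) (s) : Exec (.op l) s 1 (o.apply s)
  | seq {p q s a s₁ b s₂} (h₁ : Exec p s a s₁) (h₂ : Exec q s₁ b s₂) : Exec (.seq p q) s (a + b) s₂
  | ite_true {k g p q s a s₁} (hc : g s.1 (s.2 k).head? = true) (h : Exec p s a s₁) :
      Exec (.ite k g p q) s (1 + a) s₁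
  | ite_false {k g p q s a s₁} (hc : g s.1 (s.2 k).head? = false) (h : Exec q s a s₁) :
      Exec (.ite k g p q) s (1 + a) s₁
  | loop_true {k g p s a s₁ b s₂} (hc : g s.1 (s.2 k).head? = true) (h : Exec p s a s₁)
      (h' : Exec (.loop k g p) s₁ b s₂) : Exec (.loop k g p) s (1 + a + b) s₂
  | loop_false {k g p s} (hc : g s.1 (s.2 k).head? = false) : Exec (.loop k g p) s 1 s

/-- Every choice in the program has at most one alternative. -/
def Deterministic : StackProg K G → Prop
  | .op l => l.length ≤ 1
  | .seq p q => p.Deterministic ∧ q.Deterministic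
  | .ite _ _ p q => p.Deterministic ∧ q.Deterministic
  | .loop _ _ p => p.Deterministic

/-- A deterministic program has at most one result. -/
theorem Exec.unique {p : StackProg K G} (hp : p.Deterministic) {s a s₁ b s₂}
    (h₁ : Exec p s a s₁) (h₂ : Exec p s b s₂) : s₁ = s₂ := by
  induction h₁ generalizing b s₂ with
  | @op l o ho s =>
    cases h₂ with
    | @op _ o' ho' _ =>
      have : o = o' := by
        match l, hp, ho, ho' with
        | [], _, ho, _ => simp at ho
        | [x], _, ho, ho' => simp at ho ho'; rw [ho, ho']
        | _ :: _ :: _, hp, _, _ => simp [Deterministic] at hp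
      rw [this]
  | seq _ _ ih₁ ih₂ =>
    cases h₂ with
    | seq h₁' h₂' =>
      obtain rfl := ih₁ hp.1 h₁'
      exact ih₂ hp.2 h₂'
  | ite_true hc _ ih =>
    cases h₂ with
    | ite_true _ h => exact ih hp.1 h
    | ite_false hc' _ => simp [hc] at hc'
  | ite_false hc _ ih =>
    cases h₂ with
    | ite_true hc' _ => simp [hc] at hc'
    | ite_false _ h => exact ih hp.2 h
  | loop_true hc _ _ ih ih' =>
    cases h₂ with
    | loop_true _ h h' =>
      obtain rfl := ih hp h
      exact ih' hp h'
    | loop_false hc' => simp [hc] at hc'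
  | loop_false hc =>
    cases h₂ with
    | loop_true hc' _ => simp [hc] at hc'
    | loop_false => rfl

/-! ### Compilation of stack programs to Turing machines -/

/-- The labels of the machine code of a program. -/
def Lab : StackProg K G → Type
  | .op _ => Unit
  | .seq p q => p.Lab ⊕ q.Lab
  | .ite _ _ p q => Option (p.Lab ⊕ q.Lab)
  | .loop _ _ p => Option p.Lab

omit [DecidableEq K] in
theorem finite_lab : ∀ p : StackProg K G, Finite p.Lab
  | .op _ => inferInstanceAs (Finite Unit)
  | .seq p q => by
    have := finite_lab p
    have := finite_lab q
    exact inferInstanceAs (Finite (p.Lab ⊕ q.Lab))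
  | .ite _ _ p q => by
    have := finite_lab p
    have := finite_lab q
    exact inferInstanceAs (Finite (Option (p.Lab ⊕ q.Lab)))
  | .loop _ _ p => by
    have := finite_lab p
    exact inferInstanceAs (Finite (Option p.Lab))

/-- The label at which the machine code of a program is entered. -/
def entry : (p : StackProg K G) → p.Lab
  | .op _ => ()
  | .seq p _ => Sum.inl p.entry
  | .ite _ _ _ _ => none
  | .loop _ _ _ => none

/-- Statements of the target machines: besides the flag, the internal memory has a scratch cell
that is empty between any two steps. -/
abbrev MStmt (K G Λ : Type) := Turing.TM2.Stmt (fun _ : K => G) Λ (Bool × Option G)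

/-- Configurations of the target machines. -/
abbrev MCfg (K G Λ : Type) := Turing.TM2.Cfg (fun _ : K => G) Λ (Bool × Option G)

/-- The statement that executes an elementary operation and then jumps to `l`. -/
def _root_.StackOp.stmt [Inhabited G] {Λ : Type} (l : Λ) : StackOp K G → MStmt K G Λ
  | .drop k => .pop k (fun v _ => v) (.goto fun _ => l)
  | .dup k k' => .peek k (fun v o => (v.1, o)) (.branch (fun v => v.2.isSome)
      (.push k' (fun v => v.2.getD default) (.load (fun v => (v.1, none)) (.goto fun _ => l)))
      (.goto fun _ => l))
  | .push k x => .push k (fun _ => x) (.goto fun _ => l)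
  | .setFlag k g => .peek k (fun v o => (g v.1 o, none)) (.goto fun _ => l)

/-- The statement that performs a test and jumps to `l₁` or to `l₂`. -/
def testStmt {Λ : Type} (k : K) (g : Bool → Option G → Bool) (l₁ l₂ : Λ) : MStmt K G Λ :=
  .peek k (fun v o => (v.1, o)) (.branch (fun v => g v.1 v.2)
    (.load (fun v => (v.1, none)) (.goto fun _ => l₁))
    (.load (fun v => (v.1, none)) (.goto fun _ => l₂)))

/-- The machine code of a program whose labels are embedded by `emb` into the labels of a machine,
and which is left at the label `exit`. -/
def code [Inhabited G] {Λ : Type} :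
    (p : StackProg K G) → (p.Lab → Λ) → Λ → p.Lab → List (MStmt K G Λ)
  | .op l, _, exit, _ => l.map fun o => o.stmt exit
  | .seq p q, emb, _, Sum.inl x => p.code (fun y => emb (Sum.inl y)) (emb (Sum.inr q.entry)) x
  | .seq _ q, emb, exit, Sum.inr x => q.code (fun y => emb (Sum.inr y)) exit x
  | .ite k g p q, emb, _, none =>
      [testStmt k g (emb (some (Sum.inl p.entry))) (emb (some (Sum.inr q.entry)))]
  | .ite _ _ p _, emb, exit, some (Sum.inl x) =>
      p.code (fun y => emb (some (Sum.inl y))) exit x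
  | .ite _ _ _ q, emb, exit, some (Sum.inr x) =>
      q.code (fun y => emb (some (Sum.inr y))) exit x
  | .loop k g p, emb, exit, none => [testStmt k g (emb (some p.entry)) exit]
  | .loop _ _ p, emb, _, some x => p.code (fun y => emb (some y)) (emb none) x

section Simulation

variable {Λ : Type} (M : Λ → List (MStmt K G Λ))

/-- The configuration of the target machine at the label `l` that represents the state `s`. -/
def cfg (l : Λ) (s : StackState K G) : MCfg K G Λ := ⟨some l, (s.1, none), s.2⟩

/-- One step of the machine with program `M`. -/
def MStep (c c' : MCfg K G Λ) : Prop :=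
  ∃ l, c.l = some l ∧ ∃ q ∈ M l, c' = Turing.TM2.stepAux q c.var c.stk

/-- The machine with program `M` gets from `c` to `c'` in exactly `n` steps. -/
def MReaches : ℕ → MCfg K G Λ → MCfg K G Λ → Prop
  | 0, c, c' => c = c'
  | n + 1, c, c' => ∃ c₁, MStep M c c₁ ∧ MReaches n c₁ c'

variable {M}

theorem MReaches.trans {m n : ℕ} {c c₁ c₂ : MCfg K G Λ} (h₁ : MReaches M m c c₁)
    (h₂ : MReaches M n c₁ c₂) : MReaches M (m + n) c c₂ := by
  induction m generalizing c with
  | zero => cases h₁; simpa using h₂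
  | succ m ih =>
    obtain ⟨c', hs, h⟩ := h₁
    rw [Nat.add_right_comm]
    exact ⟨c', hs, ih h⟩

theorem MReaches.one {c c' : MCfg K G Λ} (h : MStep M c c') : MReaches M 1 c c' := ⟨c', h, rfl⟩

variable [Inhabited G]

theorem stepAux_stmt (o : StackOp K G) (l : Λ) (s : StackState K G) :
    Turing.TM2.stepAux (o.stmt l) (s.1, none) s.2 = cfg l (o.apply s) := by
  cases o with
  | dup k k' =>
    cases h : (s.2 k).head? <;> simp [StackOp.stmt, StackOp.apply, cfg, h]
  | _ => simp [StackOp.stmt, StackOp.apply, cfg]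

omit [Inhabited G] in
theorem stepAux_testStmt (k : K) (g : Bool → Option G → Bool) (l₁ l₂ : Λ) (s : StackState K G) :
    Turing.TM2.stepAux (testStmt k g l₁ l₂) (s.1, none) s.2 =
      cfg (if g s.1 (s.2 k).head? = true then l₁ else l₂) s := by
  cases h : g s.1 (s.2 k).head? <;> simp [testStmt, cfg, h]

omit [Inhabited G] in
theorem mStep_test {k : K} {g : Bool → Option G → Bool} {l l₁ l₂ : Λ}
    (h : M l = [testStmt k g l₁ l₂]) (s : StackState K G) (c : MCfg K G Λ) :
    MStep M (cfg l s) c ↔ c = cfg (if g s.1 (s.2 k).head? = true then l₁ else l₂) s := by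
  rw [← stepAux_testStmt]
  simp [MStep, cfg, h]

/-- An execution of a program is simulated by its machine code, step by step. -/
theorem reaches_of_exec {p : StackProg K G} {s t s'} (h : Exec p s t s') :
    ∀ (emb : p.Lab → Λ) (exit : Λ), (∀ l, M (emb l) = p.code emb exit l) →
      MReaches M t (cfg (emb p.entry) s) (cfg exit s') := by
  induction h with
  | @op l o ho s =>
    intro emb exit hM
    refine .one ⟨_, rfl, o.stmt exit, ?_, (stepAux_stmt o exit s).symm⟩
    rw [hM]
    exact List.mem_map_of_mem ho
  | seq _ _ ih₁ ih₂ =>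
    intro emb exit hM
    exact (ih₁ _ _ fun l => hM (Sum.inl l)).trans (ih₂ (fun l => emb (Sum.inr l)) _
      fun l => hM (Sum.inr l))
  | ite_true hc _ ih =>
    intro emb exit hM
    refine (MReaches.one ((mStep_test (hM none) _ _).2 rfl)).trans ?_
    rw [if_pos hc]
    exact ih (fun l => emb (some (Sum.inl l))) _ fun l => hM (some (Sum.inl l))
  | ite_false hc _ ih =>
    intro emb exit hM
    refine (MReaches.one ((mStep_test (hM none) _ _).2 rfl)).trans ?_
    rw [if_neg (by simp [hc])]
    exact ih (fun l => emb (some (Sum.inr l))) _ fun l => hM (some (Sum.inr l))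
  | loop_true hc _ _ ih ih' =>
    intro emb exit hM
    refine ((MReaches.one ((mStep_test (hM none) _ _).2 rfl)).trans ?_).trans (ih' emb exit hM)
    rw [if_pos hc]
    exact ih (fun l => emb (some l)) _ fun l => hM (some l)
  | loop_false hc =>
    intro emb exit hM
    refine (MReaches.one ((mStep_test (hM none) _ _).2 ?_))
    rw [if_neg (by simp [hc])]

/-- A halting computation that enters the machine code of a program leaves it again, after an
execution of the program. -/
theorem exec_of_reaches (p : StackProg K G) :
    ∀ (emb : p.Lab → Λ) (exit : Λ), (∀ l, M (emb l) = p.code emb exit l) →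
      ∀ (n : ℕ) (s : StackState K G) (c : MCfg K G Λ), MReaches M n (cfg (emb p.entry) s) c →
        c.l = none → ∃ a b s', a + b = n ∧ Exec p s a s' ∧ MReaches M b (cfg exit s') c := by
  induction p with
  | op l =>
    intro emb exit hM n s c h hc
    cases n with
    | zero => cases h; simp [cfg] at hc
    | succ n =>
      obtain ⟨c₁, ⟨l', hl', q, hq, rfl⟩, h⟩ := h
      simp only [cfg, Option.some.injEq] at hl'
      subst hl'
      rw [hM] at hq
      obtain ⟨o, ho, rfl⟩ := List.mem_map.1 hq
      exact ⟨1, n, _, by omega, .op ho s, by simpa only [cfg, stepAux_stmt] using h⟩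
  | seq p q ihp ihq =>
    intro emb exit hM n s c h hc
    obtain ⟨a, b, s₁, hab, h₁, h⟩ := ihp _ _ (fun l => hM (Sum.inl l)) n s c h hc
    obtain ⟨a', b', s₂, hab', h₂, h⟩ :=
      ihq (fun l => emb (Sum.inr l)) _ (fun l => hM (Sum.inr l)) b s₁ c h hc
    exact ⟨a + a', b', s₂, by omega, .seq h₁ h₂, h⟩
  | ite k g p q ihp ihq =>
    intro emb exit hM n s c h hc
    cases n with
    | zero => cases h; simp [cfg] at hc
    | succ n =>
      obtain ⟨c₁, hs, h⟩ := h
      obtain rfl := (mStep_test (hM none) _ _).1 hs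
      cases hg : g s.1 (s.2 k).head? with
      | true =>
        rw [if_pos hg] at h
        obtain ⟨a, b, s₁, hab, h₁, h⟩ :=
          ihp (fun l => emb (some (Sum.inl l))) _ (fun l => hM (some (Sum.inl l))) n s c h hc
        exact ⟨1 + a, b, s₁, by omega, .ite_true hg h₁, h⟩
      | false =>
        rw [if_neg (by simp [hg])] at h
        obtain ⟨a, b, s₁, hab, h₁, h⟩ :=
          ihq (fun l => emb (some (Sum.inr l))) _ (fun l => hM (some (Sum.inr l))) n s c h hc
        exact ⟨1 + a, b, s₁, by omega, .ite_false hg h₁, h⟩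
  | loop k g p ihp =>
    intro emb exit hM n
    induction n using Nat.strong_induction_on with
    | _ n ih =>
      intro s c h hc
      cases n with
      | zero => cases h; simp [cfg] at hc
      | succ n =>
        obtain ⟨c₁, hs, h⟩ := h
        obtain rfl := (mStep_test (hM none) _ _).1 hs
        cases hg : g s.1 (s.2 k).head? with
        | true =>
          rw [if_pos hg] at h
          obtain ⟨a, b, s₁, hab, h₁, h⟩ :=
            ihp (fun l => emb (some l)) _ (fun l => hM (some l)) n s c h hc
          obtain ⟨a', b', s₂, hab', h₂, h⟩ := ih b (by omega) s₁ c h hc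
          exact ⟨1 + a + a', b', s₂, by omega, .loop_true hg h₁ h₂, h⟩
        | false =>
          rw [if_neg (by simp [hg])] at h
          exact ⟨1, n, s, by omega, .loop_false hg, h⟩

end Simulation

/-- The machine that writes its input on the stack `inp`, executes the program `p`, started with
the flag set, and accepts if the flag is set in the end. -/
def toNTM [Finite K] [Finite G] [Inhabited G] {A : Type} (inp : K) (enc : A → G)
    (p : StackProg K G) : NTM A :=
  have := p.finite_lab
  { K := K
    Γ := fun _ => G
    Λ := Option p.Lab
    σ := Bool × Option G
    input := inp
    inputLetter := enc
    main := some p.entry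
    initState := (true, none)
    program := fun l => l.elim [.halt] fun x => p.code some none x
    accept := {v | v.1 = true} }

/-- The accepting computations correspond to the executions that end with the flag set; one more step
is used to halt. -/
theorem acceptsIn_toNTM [Finite K] [Finite G] [Inhabited G] {A : Type} (inp : K) (enc : A → G)
    (p : StackProg K G) (w : List A) (n : ℕ) :
    (p.toNTM inp enc).AcceptsIn w n ↔ ∃ t s', t + 1 = n ∧
      Exec p (true, Function.update (fun _ => []) inp (w.map enc)) t s' ∧ s'.1 = true := by
  set P : Option p.Lab → List (MStmt K G (Option p.Lab)) :=
    fun l => l.elim [.halt] fun x => p.code some none x with hP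
  have key : ∀ n c c', (p.toNTM inp enc).ReachesIn n c c' ↔ MReaches P n c c' := by
    intro n
    induction n with
    | zero => exact fun c c' => Iff.rfl
    | succ n ih =>
      intro c c'
      exact exists_congr fun c₁ => and_congr Iff.rfl (ih c₁ c')
  have hinit : (p.toNTM inp enc).init w =
      cfg (some p.entry) (true, Function.update (fun _ => []) inp (w.map enc)) := rfl
  have hM : ∀ l, P (some l) = p.code some none l := fun l => rfl
  constructor
  · rintro ⟨c, h, hc, hacc⟩
    rw [key, hinit] at h
    obtain ⟨a, b, s', rfl, hex, h⟩ := exec_of_reaches p some none hM n _ c h hc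
    cases b with
    | zero => cases h; cases hc
    | succ b =>
      obtain ⟨c₁, ⟨l, hl, q, hq, rfl⟩, h⟩ := h
      simp only [cfg, Option.some.injEq] at hl
      subst hl
      simp only [hP, Option.elim_none, List.mem_singleton] at hq
      subst hq
      cases b with
      | zero => cases h; exact ⟨a, s', rfl, hex, hacc⟩
      | succ b =>
        obtain ⟨c₁, ⟨l, hl, _⟩, _⟩ := h
        cases hl
  · rintro ⟨t, s', rfl, hex, hs'⟩
    refine ⟨⟨none, (s'.1, none), s'.2⟩, ?_, rfl, hs'⟩
    rw [key, hinit]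
    exact (reaches_of_exec hex some none hM).trans
      (.one ⟨none, rfl, .halt, by simp [hP], rfl⟩)

end StackProg

/-! ### Executions with a time bound -/

namespace StackProg

section Runs

variable {K G : Type} [DecidableEq K]

/-- Some execution of `p` leads from `s` to `s'` in at most `B` steps. -/
def Runs (p : StackProg K G) (s : StackState K G) (B : ℕ) (s' : StackState K G) : Prop :=
  ∃ t ≤ B, Exec p s t s'

theorem Runs.mono {p : StackProg K G} {s B B' s'} (h : Runs p s B s') (hB : B ≤ B') :
    Runs p s B' s' := by
  obtain ⟨t, ht, h⟩ := h
  exact ⟨t, ht.trans hB, h⟩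

theorem Runs.congr {p : StackProg K G} {s B s' r r'} (h : Runs p s B s') (hs : s = r)
    (hs' : s' = r') : Runs p r B r' := by
  subst hs hs'
  exact h

theorem Runs.seq {p q : StackProg K G} {s B s₁ B' s₂} (h : Runs p s B s₁) (h' : Runs q s₁ B' s₂) :
    Runs (.seq p q) s (B + B') s₂ := by
  obtain ⟨t, ht, h⟩ := h
  obtain ⟨t', ht', h'⟩ := h'
  exact ⟨t + t', by omega, .seq h h'⟩

theorem Runs.op (o : StackOp K G) (s) : Runs (.op [o]) s 1 (o.apply s) :=
  ⟨1, le_rfl, .op (by simp) s⟩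

theorem Runs.ite_true {k g} {p q : StackProg K G} {s B s₁} (hc : g s.1 (s.2 k).head? = true)
    (h : Runs p s B s₁) : Runs (.ite k g p q) s (B + 1) s₁ := by
  obtain ⟨t, ht, h⟩ := h
  exact ⟨1 + t, by omega, .ite_true hc h⟩

theorem Runs.ite_false {k g} {p q : StackProg K G} {s B s₁} (hc : g s.1 (s.2 k).head? = false)
    (h : Runs q s B s₁) : Runs (.ite k g p q) s (B + 1) s₁ := by
  obtain ⟨t, ht, h⟩ := h
  exact ⟨1 + t, by omega, .ite_false hc h⟩

theorem Runs.loop_false {k g} {p : StackProg K G} {s} (hc : g s.1 (s.2 k).head? = false) :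
    Runs (.loop k g p) s 1 s :=
  ⟨1, le_rfl, .loop_false hc⟩

theorem Runs.loop_true {k g} {p : StackProg K G} {s B s₁ B' s₂} (hc : g s.1 (s.2 k).head? = true)
    (h : Runs p s B s₁) (h' : Runs (.loop k g p) s₁ B' s₂) :
    Runs (.loop k g p) s (B + 1 + B') s₂ := by
  obtain ⟨t, ht, h⟩ := h
  obtain ⟨t', ht', h'⟩ := h'
  exact ⟨1 + t + t', by omega, .loop_true hc h h'⟩

/-- A loop whose successive states are `s 0`, …, `s n`. -/
theorem Runs.loop {k g} {p : StackProg K G} (s : ℕ → StackState K G) (n B : ℕ)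
    (hc : ∀ i < n, g (s i).1 ((s i).2 k).head? = true) (hn : g (s n).1 ((s n).2 k).head? = false)
    (h : ∀ i < n, Runs p (s i) B (s (i + 1))) : Runs (.loop k g p) (s 0) (n * (B + 1) + 1) (s n) := by
  induction n generalizing s with
  | zero => exact (Runs.loop_false hn).mono (by omega)
  | succ n ih =>
    have := ih (fun i => s (i + 1)) (fun i hi => hc _ (by omega)) hn (fun i hi => h _ (by omega))
    exact (Runs.loop_true (hc 0 (by omega)) (h 0 (by omega)) this).mono (by ring_nf; omega)

end Runs

/-! ### Tapes -/

/-- The tapes of the evaluator: one for every variable, four auxiliary counters, the tape that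
holds the guessed table, and the input tape. -/
inductive Tape (V : ℕ)
  | var (i : Fin V)
  | a | b | c | u | tab | inp
  deriving DecidableEq

instance (V : ℕ) : Finite (Tape V) := by
  refine Finite.of_injective (β := Fin V ⊕ Fin 6) (fun t => match t with
    | .var i => .inl i | .a => .inr 0 | .b => .inr 1 | .c => .inr 2 | .u => .inr 3
    | .tab => .inr 4 | .inp => .inr 5) ?_
  intro s t h
  cases s <;> cases t <;> simp_all

variable {V : ℕ} {G : Type}

/-- The state in which each tape `t` has the contents `C t` and its head at the position `p t`.
The stack `(t, false)` holds the part to the left of the head, the stack `(t, true)` the rest; the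
scanned letter is on top of the latter. -/
def tapes (f : Bool) (C : Tape V → List G) (p : Tape V → ℕ) : StackState (Tape V × Bool) G :=
  (f, fun k => if k.2 then (C k.1).drop (p k.1) else ((C k.1).take (p k.1)).reverse)

/-- Move the head of a tape to the right, unless it is at the end. -/
def moveR (t : Tape V) : StackProg (Tape V × Bool) G :=
  .seq (.op [.dup (t, true) (t, false)]) (.op [.drop (t, true)])

/-- Move the head of a tape to the left, unless it is at the beginning. -/
def moveL (t : Tape V) : StackProg (Tape V × Bool) G :=
  .seq (.op [.dup (t, false) (t, true)]) (.op [.drop (t, false)])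

variable {f : Bool} {C : Tape V → List G} {p : Tape V → ℕ}

theorem head_right (t : Tape V) : ((tapes f C p).2 (t, true)).head? = (C t)[p t]? := by
  simp [tapes]

theorem isSome_head_right (t : Tape V) :
    ((tapes f C p).2 (t, true)).head?.isSome = decide (p t < (C t).length) := by
  rw [head_right]
  by_cases h : p t < (C t).length <;> simp [h]

theorem isSome_head_left {t : Tape V} (ht : p t ≤ (C t).length) :
    ((tapes f C p).2 (t, false)).head?.isSome = decide (0 < p t) := by
  simp only [tapes]
  rcases Nat.eq_zero_or_pos (p t) with h | h
  · simp [h]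
  · have h2 : ((C t).take (p t)) ≠ [] := by
      intro h'
      have := congrArg List.length h'
      simp at this
      rcases this with h | h
      · omega
      · simp [h] at ht; omega
    simp [h, List.getLast?_eq_some_getLast h2]

theorem runs_moveR {t : Tape V} (ht : p t ≤ (C t).length) :
    Runs (moveR t) (tapes f C p) 2
      (tapes f C (Function.update p t (min (p t + 1) (C t).length))) := by
  have h := (Runs.op (.dup (t, true) (t, false)) (tapes f C p)).seq (Runs.op (.drop (t, true)) _)
  refine h.congr rfl (Prod.ext rfl (funext fun ⟨t', b⟩ => ?_))
  by_cases htt : t' = t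
  · subst htt
    cases b
    · rcases ht.lt_or_eq with h | h
      · simp [StackOp.apply, tapes, Nat.min_eq_left (show p t' + 1 ≤ _ from h)]
        rw [show (C t').take (p t' + 1) = (C t').take (p t') ++ [(C t')[p t']] by simp]
        simp only [List.reverse_append, List.getElem?_eq_getElem h]
        rfl
      · simp [StackOp.apply, tapes, h]
    · rcases ht.lt_or_eq with h | h
      · simp [StackOp.apply, tapes, Nat.min_eq_left (show p t' + 1 ≤ _ from h)]
      · simp [StackOp.apply, tapes, h]
  · simp [StackOp.apply, tapes, htt, Function.update]

theorem runs_moveL {t : Tape V} (ht : p t ≤ (C t).length) :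
    Runs (moveL t) (tapes f C p) 2 (tapes f C (Function.update p t (p t - 1))) := by
  have h := (Runs.op (.dup (t, false) (t, true)) (tapes f C p)).seq (Runs.op (.drop (t, false)) _)
  refine h.congr rfl (Prod.ext rfl (funext fun ⟨t', b⟩ => ?_))
  by_cases htt : t' = t
  · subst htt
    rcases hp : p t' with _ | n
    · cases b <;> simp [StackOp.apply, tapes, hp]
    · have hn : n < (C t').length := by omega
      cases b
      · simp [StackOp.apply, tapes, hp]
        rw [show (C t').take (n + 1) = (C t').take n ++ [(C t')[n]] by simp]
        exact List.dropLast_concat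
      · simp [StackOp.apply, tapes, hp]
        rw [show (C t').take (n + 1) = (C t').take n ++ [(C t')[n]] by simp]
        simp only [List.getLast?_concat, Option.toList_some, List.singleton_append,
          List.getElem_cons_drop]
  · simp [StackOp.apply, tapes, htt, Function.update]

/-- Move the head of a tape to the beginning. -/
def rewind (t : Tape V) : StackProg (Tape V × Bool) G :=
  .loop (t, false) (fun _ o => o.isSome) (moveL t)

/-- Move the head of a tape to the end. -/
def forward (t : Tape V) : StackProg (Tape V × Bool) G :=
  .loop (t, true) (fun _ o => o.isSome) (moveR t)

theorem runs_rewind {t : Tape V} (ht : p t ≤ (C t).length) :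
    Runs (rewind t) (tapes f C p) (3 * p t + 1) (tapes f C (Function.update p t 0)) := by
  have h := Runs.loop (k := (t, false)) (g := fun _ o => o.isSome) (p := moveL t)
    (fun i => tapes f C (Function.update p t (p t - i))) (p t) 2 ?_ ?_ ?_
  · simp only [Nat.sub_zero, Function.update_eq_self, Nat.sub_self] at h
    exact h.mono (by omega)
  · intro i hi
    rw [isSome_head_left (by simp; omega)]
    simp [hi]
  · rw [isSome_head_left (by simp)]
    simp
  · intro i hi
    have := runs_moveL (f := f) (C := C) (p := Function.update p t (p t - i)) (t := t)
      (by simp; omega)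
    simpa [Nat.sub_sub] using this

theorem runs_forward {t : Tape V} (ht : p t ≤ (C t).length) :
    Runs (forward t) (tapes f C p) (3 * (C t).length + 1)
      (tapes f C (Function.update p t (C t).length)) := by
  have h := Runs.loop (k := (t, true)) (g := fun _ o => o.isSome) (p := moveR t)
    (fun i => tapes f C (Function.update p t (p t + i))) ((C t).length - p t) 2 ?_ ?_ ?_
  · simp only [Nat.add_zero, Function.update_eq_self, Nat.add_sub_cancel' ht] at h
    exact h.mono (by omega)
  · intro i hi
    rw [isSome_head_right]
    simp; omega
  · rw [isSome_head_right]
    simp; omega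
  · intro i hi
    have := runs_moveR (f := f) (C := C) (p := Function.update p t (p t + i)) (t := t)
      (by simp; omega)
    simp only [Function.update_self, Function.update_idem] at this
    rwa [Nat.min_eq_left (by omega)] at this

/-- Add the position of the tape `x` to the position of the tape `d`, by means of the tape `u`
with its head at the beginning. -/
def addTo (x d : Tape V) : StackProg (Tape V × Bool) G :=
  .seq (.loop (x, false) (fun _ o => o.isSome) (.seq (moveL x) (.seq (moveR .u) (moveR d))))
    (.loop (.u, false) (fun _ o => o.isSome) (.seq (moveL .u) (moveR x)))

/-- The position of `x` is restored, and the position of `d` cannot grow beyond the end of the tape. -/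
theorem runs_addTo {x d : Tape V} {N : ℕ} (hxd : x ≠ d) (hx : x ≠ .u) (hd : d ≠ .u)
    (hCx : (C x).length = N) (hCd : (C d).length = N) (hCu : (C .u).length = N) (hpx : p x ≤ N)
    (hpd : p d ≤ N) (hpu : p .u = 0) :
    Runs (addTo x d) (tapes f C p) (12 * N + 2)
      (tapes f C (Function.update p d (min (p d + p x) N))) := by
  let P : ℕ → ℕ → ℕ → Tape V → ℕ := fun i j l t =>
    if t = x then i else if t = .u then j else if t = d then l else p t
  have h1 := Runs.loop (k := (x, false)) (g := fun _ o => o.isSome)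
    (p := .seq (moveL x) (.seq (moveR .u) (moveR d)))
    (fun i => tapes f C (P (p x - i) i (min (p d + i) N))) (p x) 6 ?_ ?_ ?_
  · have h2 := Runs.loop (k := (.u, false)) (g := fun _ o => o.isSome)
      (p := .seq (moveL .u) (moveR x))
      (fun i => tapes f C (P i (p x - i) (min (p d + p x) N))) (p x) 4 ?_ ?_ ?_
    · simp only [Nat.sub_self, Nat.sub_zero] at h1 h2
      have h := (h1.seq h2).mono (B' := 12 * N + 2) (by omega)
      refine h.congr (congrArg _ (funext fun t => ?_)) (congrArg _ (funext fun t => ?_))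
      · simp only [P]
        split_ifs <;> simp_all
      · simp only [P, Function.update_apply]
        split_ifs <;> simp_all
    · intro i hi
      rw [isSome_head_left (by simp [P, Ne.symm hx]; omega)]
      simp [P, Ne.symm hx, hi]
    · rw [isSome_head_left (by simp [P, Ne.symm hx])]
      simp [P, Ne.symm hx]
    · intro i hi
      refine (((runs_moveL (by simp [P, Ne.symm hx]; omega)).seq (runs_moveR ?_)).mono
        (by omega : _ ≤ 4)).congr rfl ?_
      · simp [P, Function.update, hx]; omega
      · refine congrArg _ (funext fun t => ?_)
        simp only [P, Function.update_apply]
        split_ifs <;> first | omega | simp_all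
  · intro i hi
    rw [isSome_head_left (by simp [P]; omega)]
    simp [P, hi]
  · rw [isSome_head_left (by simp [P])]
    simp [P]
  · intro i hi
    refine (((runs_moveL (by simp [P]; omega)).seq ((runs_moveR ?_).seq (runs_moveR ?_))).mono
      (by omega : _ ≤ 6)).congr rfl ?_
    · simp [P, Function.update, Ne.symm hx]; omega
    · simp [P, Function.update, Ne.symm hxd, hd, hCd]
    · refine congrArg _ (funext fun t => ?_)
      simp only [P, Function.update_apply]
      split_ifs <;> first | omega | simp_all

/-- Subtract the position of the tape `x` from the position of the tape `d`, and rewind `x`. -/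
def subFrom (x d : Tape V) : StackProg (Tape V × Bool) G :=
  .loop (x, false) (fun _ o => o.isSome) (.seq (moveL x) (moveL d))

theorem runs_subFrom {x d : Tape V} (hxd : x ≠ d) (hpx : p x ≤ (C x).length)
    (hpd : p d ≤ (C d).length) :
    Runs (subFrom x d) (tapes f C p) (5 * p x + 1)
      (tapes f C (Function.update (Function.update p d (p d - p x)) x 0)) := by
  have h := Runs.loop (k := (x, false)) (g := fun _ o => o.isSome)
    (p := .seq (moveL x) (moveL d))
    (fun i => tapes f C (Function.update (Function.update p d (p d - i)) x (p x - i)))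
    (p x) 4 ?_ ?_ ?_
  · simp only [Nat.sub_zero, Function.update_eq_self, Nat.sub_self] at h
    exact h.mono (by omega)
  · intro i hi
    rw [isSome_head_left (by simp; omega)]
    simp [hi]
  · rw [isSome_head_left (by simp)]
    simp
  · intro i hi
    refine (((runs_moveL (by simp; omega)).seq (runs_moveL ?_)).mono
        (by omega : _ ≤ 4)).congr rfl ?_
    · simp [Ne.symm hxd]; omega
    · refine congrArg _ (funext fun t => ?_)
      simp only [Function.update_apply]
      split_ifs <;> first | omega | simp_all

end StackProg

/-! ### First-order formulas over an initial segment of the natural numbers -/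

/-- First-order formulas with the free variables `0`, …, `n - 1` about a word over `A` and `r`
ternary relations. The quantifiers range over `{0, …, N}` for a number `N`. -/
inductive Fml (A : Type) (r : ℕ) : ℕ → Type
  /-- the atom `z ≤ x + y` -/
  | le {n : ℕ} (x y z : Fin n) : Fml A r n
  /-- the letter at the position `x`, or `none` past the end of the word, satisfies `P` -/
  | letter {n : ℕ} (P : Option A → Bool) (x : Fin n) : Fml A r n
  | rel {n : ℕ} (s : Fin r) (x y z : Fin n) : Fml A r n
  | not {n : ℕ} (φ : Fml A r n) : Fml A r n
  | and {n : ℕ} (φ ψ : Fml A r n) : Fml A r n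
  /-- existential quantification over the last variable -/
  | ex {n : ℕ} (φ : Fml A r (n + 1)) : Fml A r n

namespace Fml

variable {A : Type} {r : ℕ}

/-- Satisfaction. -/
def Sat (w : List A) (N : ℕ) (X : Fin r → ℕ → ℕ → ℕ → Prop) :
    {n : ℕ} → Fml A r n → (Fin n → ℕ) → Prop
  | _, le x y z, v => v z ≤ v x + v y
  | _, letter P x, v => P w[v x]? = true
  | _, rel s x y z, v => X s (v x) (v y) (v z)
  | _, not φ, v => ¬ Sat w N X φ v
  | _, and φ ψ, v => Sat w N X φ v ∧ Sat w N X ψ v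
  | _, ex φ, v => ∃ m ≤ N, Sat w N X φ (Fin.snoc v m)

/-- The quantifier depth. -/
def depth : {n : ℕ} → Fml A r n → ℕ
  | _, not φ => φ.depth
  | _, and φ ψ => max φ.depth ψ.depth
  | _, ex φ => φ.depth + 1
  | _, _ => 0

end Fml

namespace StackProg

/-! ### Evaluation of formulas by stack programs -/

/-- The letters on the tapes of the evaluator: variable tapes use the first component, which holds
a letter of the input word or a blank, the table uses the second component. -/
abbrev Cell (A : Type) (r : ℕ) := Option A × (Fin r → Bool)

variable {A : Type} {r V : ℕ}

/-- The operation that updates the flag by a function of the flag and a scanned letter. -/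
def flagOp {K G : Type} (k : K) (g : Bool → Option G → Bool) : StackProg K G :=
  .op [.setFlag k g]

/-- Set the flag if not all three counters are zero. -/
def nonzero : StackProg (Tape V × Bool) (Cell A r) :=
  .seq (flagOp (.a, false) fun _ o => o.isSome) (.seq (flagOp (.b, false) fun f o => f || o.isSome)
    (flagOp (.c, false) fun f o => f || o.isSome))

/-- Decrease the number with the digits `a`, `b`, `c` in base `N + 1` by one, where `N` is the length
of the tapes. -/
def decrement : StackProg (Tape V × Bool) (Cell A r) :=
  .ite (.c, false) (fun _ o => o.isSome) (moveL .c)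
    (.seq (forward .c) (.ite (.b, false) (fun _ o => o.isSome) (moveL .b)
      (.seq (forward .b) (moveL .a))))

/-- Advance the head of the table to the entry with index given by the digits `a`, `b`, `c`, and
set the counters to zero. -/
def seek : StackProg (Tape V × Bool) (Cell A r) :=
  .seq nonzero (.loop (.a, false) (fun f _ => f) (.seq decrement (.seq (moveR .tab) nonzero)))

/-- The tape of a variable. -/
def varTape {n : ℕ} (h : n ≤ V) (x : Fin n) : Tape V := .var (Fin.castLE h x)

/-- The program that stores the truth value of a formula in the flag. The values of the variables are
the positions of the heads on their tapes, and all other heads are at the beginning, before and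
after the execution. -/
def eval : {n : ℕ} → (φ : Fml A r n) → n + φ.depth ≤ V → StackProg (Tape V × Bool) (Cell A r)
  | _, .le x y z, h =>
    have h := Nat.le_of_add_right_le h
    .seq (addTo (varTape h z) .b) (.seq (addTo (varTape h x) .a) (.seq (addTo (varTape h y) .a)
      (.seq (subFrom .a .b) (.seq (flagOp (.b, false) fun _ o => o.isNone) (rewind .b)))))
  | _, .letter P x, h =>
    have h := Nat.le_of_add_right_le h
    flagOp (varTape h x, true) fun _ o => P (o.bind Prod.fst)
  | _, .rel s x y z, h =>
    have h := Nat.le_of_add_right_le h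
    .seq (addTo (varTape h x) .a) (.seq (addTo (varTape h y) .b) (.seq (addTo (varTape h z) .c)
      (.seq seek (.seq (flagOp (.tab, true) fun _ o => o.any fun e => e.2 s) (rewind .tab)))))
  | _, .not φ, h => .seq (eval φ h) (flagOp (.a, false) fun f _ => !f)
  | _, .and φ ψ, h =>
    .seq (eval φ (by simp only [Fml.depth] at h; omega))
      (.ite (.a, false) (fun f _ => f) (eval ψ (by simp only [Fml.depth] at h; omega))
        (flagOp (.a, false) fun f _ => f))
  | n, .ex φ, h =>
    have hn : n < V := by simp only [Fml.depth] at h; omega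
    have hφ : n + 1 + φ.depth ≤ V := by simp only [Fml.depth] at h; omega
    .seq (eval φ hφ)
      (.seq (.loop (.var ⟨n, hn⟩, true) (fun f o => !f && o.isSome)
        (.seq (moveR (.var ⟨n, hn⟩)) (eval φ hφ))) (rewind (.var ⟨n, hn⟩)))

/-- A bound for the running time of the evaluation. -/
def cost (N : ℕ) : {n : ℕ} → Fml A r n → ℕ
  | _, .le _ _ _ => 50 * (N + 1)
  | _, .letter _ _ => 1
  | _, .rel _ _ _ _ => 100 * (N + 2) ^ 4
  | _, .not φ => cost N φ + 1
  | _, .and φ ψ => cost N φ + cost N ψ + 2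
  | _, .ex φ => (N + 1) * (cost N φ + 3) + 3 * N + 4

/-- For a fixed formula, the running time of the evaluation is polynomial in `N`. -/
theorem exists_cost_le {n : ℕ} (φ : Fml A r n) : ∃ c, ∀ N, cost N φ ≤ (N + 2) ^ c := by
  have two : ∀ N : ℕ, ∀ e, 2 ^ e ≤ (N + 2) ^ e := fun N e => Nat.pow_le_pow_left (by omega) e
  have pos : ∀ N : ℕ, ∀ e, 1 ≤ (N + 2) ^ e := fun N e => Nat.one_le_pow _ _ (by omega)
  induction φ with
  | le x y z =>
    refine ⟨7, fun N => ?_⟩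
    have := two N 6
    rw [pow_succ, cost]
    nlinarith
  | letter P x => exact ⟨0, fun N => by simp [cost]⟩
  | rel s x y z =>
    refine ⟨11, fun N => ?_⟩
    have := two N 7
    rw [cost, show 11 = 7 + 4 from rfl, pow_add]
    exact Nat.mul_le_mul_right _ (le_trans (by norm_num) this)
  | not φ ih =>
    obtain ⟨c, hc⟩ := ih
    refine ⟨c + 1, fun N => ?_⟩
    have := hc N
    have := pos N c
    rw [cost, pow_succ]
    nlinarith
  | and φ ψ ih ih' =>
    obtain ⟨c, hc⟩ := ih
    obtain ⟨c', hc'⟩ := ih'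
    refine ⟨c + c' + 2, fun N => ?_⟩
    have h1 : (N + 2) ^ c ≤ (N + 2) ^ (c + c') := Nat.pow_le_pow_right (by omega) (by omega)
    have h2 : (N + 2) ^ c' ≤ (N + 2) ^ (c + c') := Nat.pow_le_pow_right (by omega) (by omega)
    have := hc N
    have := hc' N
    have := pos N (c + c')
    have := two N 2
    rw [cost, pow_add _ _ 2]
    nlinarith
  | ex φ ih =>
    obtain ⟨c, hc⟩ := ih
    refine ⟨c + 5, fun N => ?_⟩
    have h1 := hc N
    have h2 := pos N c
    have h3 := two N 4
    have h4 : (N + 1) * (cost N φ + 3) ≤ (N + 2) * (4 * (N + 2) ^ c) :=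
      Nat.mul_le_mul (by omega) (by omega)
    have h5 : 3 * N + 4 ≤ 3 * (N + 2) * (N + 2) ^ c := by nlinarith
    have h6 : (N + 2) ^ (c + 5) = (N + 2) * (N + 2) ^ c * (N + 2) ^ 4 := by ring
    have h7 : (N + 2) * (N + 2) ^ c * 16 ≤ (N + 2) * (N + 2) ^ c * (N + 2) ^ 4 :=
      Nat.mul_le_mul_left _ h3
    rw [cost, h6]
    nlinarith

section Correctness

variable {f : Bool} {C : Tape V → List (Cell A r)} {p : Tape V → ℕ} {N : ℕ}

/-- The positions `p`, except for those of the three counters and of the table. -/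
def digits (p : Tape V → ℕ) (x y z q : ℕ) : Tape V → ℕ
  | .a => x
  | .b => y
  | .c => z
  | .tab => q
  | t => p t

theorem runs_flagOp (t : Tape V) (b : Bool) (g : Bool → Option (Cell A r) → Bool) :
    Runs (flagOp (t, b) g) (tapes f C p) 1
      (tapes (g f ((tapes f C p).2 (t, b)).head?) C p) :=
  Runs.op (.setFlag (t, b) g) _

theorem runs_nonzero {x y z q : ℕ} (ha : x ≤ (C .a).length) (hb : y ≤ (C .b).length)
    (hc : z ≤ (C .c).length) :
    Runs nonzero (tapes f C (digits p x y z q)) 3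
      (tapes (decide (0 < x) || decide (0 < y) || decide (0 < z)) C (digits p x y z q)) := by
  refine ((runs_flagOp _ _ _).seq ((runs_flagOp _ _ _).seq (runs_flagOp _ _ _))).congr rfl ?_
  rw [isSome_head_left (by exact ha), isSome_head_left (by exact hb),
    isSome_head_left (by exact hc)]
  rfl

theorem runs_decrement {x y z q : ℕ} (ha : (C .a).length = N) (hb : (C .b).length = N)
    (hc : (C .c).length = N) (hx : x ≤ N) (hy : y ≤ N) (hz : z ≤ N)
    (h0 : 0 < (x * (N + 1) + y) * (N + 1) + z) :
    ∃ x' ≤ N, ∃ y' ≤ N, ∃ z' ≤ N,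
      (x' * (N + 1) + y') * (N + 1) + z' + 1 = (x * (N + 1) + y) * (N + 1) + z ∧
      Runs decrement (tapes f C (digits p x y z q)) (6 * N + 6)
        (tapes f C (digits p x' y' z' q)) := by
  have hL : ∀ {t : Tape V} {p : Tape V → ℕ}, p t ≤ (C t).length → 0 < p t →
      ((tapes f C p).2 (t, false)).head?.isSome = true :=
    fun h h' => by rw [isSome_head_left h]; simpa
  have hL' : ∀ {t : Tape V} {p : Tape V → ℕ}, p t ≤ (C t).length → p t = 0 →
      ((tapes f C p).2 (t, false)).head?.isSome = false :=
    fun h h' => by rw [isSome_head_left h]; simpa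
  rcases Nat.eq_zero_or_pos z with rfl | hz0
  · rcases Nat.eq_zero_or_pos y with rfl | hy0
    · rcases Nat.eq_zero_or_pos x with rfl | hx0
      · simp at h0
      · refine ⟨x - 1, by omega, N, le_rfl, N, le_rfl, ?_, ?_⟩
        · obtain ⟨x, rfl⟩ := Nat.exists_eq_add_one.2 hx0
          simp
          ring
        · refine ((Runs.ite_false (hL' (by simp [digits]) rfl) ((runs_forward (by simp [digits])).seq
            (Runs.ite_false (hL' ?_ ?_) ((runs_forward ?_).seq (runs_moveL ?_))))).mono
              (B' := 6 * N + 6) ?_).congr rfl (congrArg _ (funext fun t => ?_))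
          · simp [digits, Function.update]
          · simp [digits, Function.update]
          · simp [digits, Function.update]
          · simp [digits, Function.update, ha, hx]
          · omega
          · cases t <;> simp [digits, Function.update, hb, hc]
    · refine ⟨x, hx, y - 1, by omega, N, le_rfl, ?_, ?_⟩
      · obtain ⟨y, rfl⟩ := Nat.exists_eq_add_one.2 hy0
        simp
        ring
      · refine ((Runs.ite_false (hL' (by simp [digits]) rfl) ((runs_forward (by simp [digits])).seq
          (Runs.ite_true (hL ?_ ?_) (runs_moveL ?_)))).mono
            (B' := 6 * N + 6) ?_).congr rfl (congrArg _ (funext fun t => ?_))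
        · simp [digits, Function.update, hb, hy]
        · simpa [digits, Function.update]
        · simp [digits, Function.update, hb, hy]
        · omega
        · cases t <;> simp [digits, Function.update, hc]
  · refine ⟨x, hx, y, hy, z - 1, by omega, by omega, ?_⟩
    refine ((Runs.ite_true (hL ?_ hz0) (runs_moveL ?_)).mono (B' := 6 * N + 6) ?_).congr rfl
      (congrArg _ (funext fun t => ?_))
    · simp [digits, hc, hz]
    · simp [digits, hc, hz]
    · omega
    · cases t <;> simp [digits, Function.update]

/-- The head of the table moves once for each time that the counters can be decreased. -/
theorem runs_seek {x y z : ℕ} (ha : (C .a).length = N) (hb : (C .b).length = N)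
    (hc : (C .c).length = N) (hx : x ≤ N) (hy : y ≤ N) (hz : z ≤ N) :
    Runs seek (tapes f C (digits p x y z 0))
      (((x * (N + 1) + y) * (N + 1) + z) * (6 * N + 12) + 4)
      (tapes false C (digits p 0 0 0 (min ((x * (N + 1) + y) * (N + 1) + z) (C .tab).length))) := by
  have key : ∀ (x y z : ℕ), (decide (0 < x) || decide (0 < y) || decide (0 < z)) =
      decide (0 < (x * (N + 1) + y) * (N + 1) + z) := by
    intro x y z
    rw [Bool.eq_iff_iff]
    simp
  have loop : ∀ (m x y z q : ℕ), x ≤ N → y ≤ N → z ≤ N → q ≤ (C .tab).length →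
      (x * (N + 1) + y) * (N + 1) + z = m →
      Runs (.loop (.a, false) (fun f _ => f) (.seq decrement (.seq (moveR .tab) nonzero)))
        (tapes (decide (0 < m)) C (digits p x y z q)) (m * (6 * N + 12) + 1)
        (tapes false C (digits p 0 0 0 (min (q + m) (C .tab).length))) := by
    intro m
    induction m with
    | zero =>
      intro x y z q hx hy hz hq hm
      obtain rfl : x = 0 := by simp at hm; omega
      obtain rfl : y = 0 := by simp at hm; omega
      obtain rfl : z = 0 := by omega
      refine ((Runs.loop_false ?_).mono (by omega)).congr rfl ?_
      · simp [tapes]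
      · simp [hq]
    | succ m ih =>
      intro x y z q hx hy hz hq hm
      obtain ⟨x', hx', y', hy', z', hz', hm', hdec⟩ := runs_decrement (f := decide (0 < m + 1))
        (p := p) (q := q) ha hb hc hx hy hz (by omega)
      have h := ih x' y' z' (min (q + 1) (C .tab).length) hx' hy' hz' (by omega) (by omega)
      have hmove : Runs (moveR .tab) (tapes (decide (0 < m + 1)) C (digits p x' y' z' q)) 2
          (tapes (decide (0 < m + 1)) C (digits p x' y' z' (min (q + 1) (C .tab).length))) := by
        refine (runs_moveR (by exact hq)).congr rfl (congrArg _ (funext fun t => ?_))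
        cases t <;> simp [digits, Function.update]
      have hnz := runs_nonzero (f := decide (0 < m + 1)) (C := C) (p := p) (x := x') (y := y')
        (z := z') (q := min (q + 1) (C .tab).length) (by omega) (by omega) (by omega)
      rw [key, show (x' * (N + 1) + y') * (N + 1) + z' = m by omega] at hnz
      refine ((Runs.loop_true (by simp [tapes]) (hdec.seq (hmove.seq hnz)) h).mono ?_).congr rfl ?_
      · ring_nf; omega
      · congr 2; omega
  have hnz := runs_nonzero (f := f) (C := C) (p := p) (x := x) (y := y) (z := z) (q := 0)
    (by omega) (by omega) (by omega)
  rw [key] at hnz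
  refine ((hnz.seq (loop _ x y z 0 hx hy hz (by omega) rfl)).mono (by omega)).congr rfl ?_
  simp

/-- The positions of the heads when the first `n` variables have the values `v`. -/
def posOf {n : ℕ} (v : Fin n → ℕ) : Tape V → ℕ
  | .var j => if h : j.val < n then v ⟨j, h⟩ else 0
  | _ => 0

theorem posOf_varTape {n : ℕ} (h : n ≤ V) (v : Fin n → ℕ) (x : Fin n) :
    posOf v (varTape h x) = v x := by
  simp [posOf, varTape]

theorem update_posOf {n : ℕ} (hn : n < V) (v : Fin n → ℕ) (m m' : ℕ) :
    Function.update (posOf (Fin.snoc v m : Fin (n + 1) → ℕ)) (.var ⟨n, hn⟩) m' =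
      posOf (V := V) (Fin.snoc v m' : Fin (n + 1) → ℕ) := by
  funext t
  cases t with
  | var j =>
    by_cases hj : j = ⟨n, hn⟩
    · subst hj
      simp [posOf, Fin.snoc]
    · have : j.val ≠ n := fun h => hj (Fin.ext h)
      simp only [ne_eq, Tape.var.injEq, hj, not_false_eq_true, Function.update_of_ne, posOf,
        Fin.snoc]
      split_ifs <;> first | rfl | omega
  | _ => simp [posOf]

theorem posOf_snoc_zero {n : ℕ} (v : Fin n → ℕ) :
    posOf (Fin.snoc v 0 : Fin (n + 1) → ℕ) = posOf (V := V) v := by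
  funext t
  cases t with
  | var j =>
    simp only [posOf, Fin.snoc]
    split_ifs <;> first | rfl | omega
  | _ => rfl

/-- The relations stored in a table: the entry for `(x, y, z)` has the index with these digits in base
`N + 1`. -/
def tableRel (N : ℕ) (X : List (Cell A r)) (s : Fin r) (x y z : ℕ) : Prop :=
  X[(x * (N + 1) + y) * (N + 1) + z]?.any (fun e => e.2 s) = true

theorem posOf_eq_digits {n : ℕ} (v : Fin n → ℕ) :
    posOf (V := V) v = digits (posOf v) 0 0 0 0 := by
  funext t
  cases t <;> rfl

theorem update_digits_a (p : Tape V → ℕ) (x y z q m : ℕ) :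
    Function.update (digits p x y z q) .a m = digits p m y z q := by
  funext t
  cases t <;> simp [digits, Function.update]

theorem update_digits_b (p : Tape V → ℕ) (x y z q m : ℕ) :
    Function.update (digits p x y z q) .b m = digits p x m z q := by
  funext t
  cases t <;> simp [digits, Function.update]

theorem update_digits_c (p : Tape V → ℕ) (x y z q m : ℕ) :
    Function.update (digits p x y z q) .c m = digits p x y m q := by
  funext t
  cases t <;> simp [digits, Function.update]

theorem update_digits_tab (p : Tape V → ℕ) (x y z q m : ℕ) :
    Function.update (digits p x y z q) .tab m = digits p x y z m := by
  funext t
  cases t <;> simp [digits, Function.update]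

section Atoms

variable (hlen : ∀ t, t ≠ .tab → t ≠ .inp → (C t).length = N) {n : ℕ} {v : Fin n → ℕ}
  (hv : ∀ i, v i ≤ N)

include hlen hv

theorem runs_addTo_counter (h : n ≤ V) (i : Fin n) (d : Tape V) (hd : d = .a ∨ d = .b ∨ d = .c)
    {x y z q : ℕ} (hdN : digits (posOf v) x y z q d ≤ N) :
    Runs (addTo (varTape h i) d) (tapes f C (digits (posOf v) x y z q)) (12 * N + 2)
      (tapes f C (Function.update (digits (posOf v) x y z q) d
        (min (digits (posOf v) x y z q d + v i) N))) := by
  have hi : digits (posOf v) x y z q (varTape h i) = v i := posOf_varTape h v i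
  have := runs_addTo (f := f) (C := C) (p := digits (posOf v) x y z q) (x := varTape h i) (d := d)
    (N := N) (by rintro rfl; simp [varTape] at hd) (by simp [varTape]) (by rintro rfl; simp at hd)
    (hlen _ (by simp [varTape]) (by simp [varTape]))
    (by rcases hd with rfl | rfl | rfl <;> exact hlen _ (by simp) (by simp))
    (hlen _ (by simp) (by simp)) (by rw [hi]; exact hv i) hdN rfl
  rwa [hi] at this

theorem runs_addTo_a (h : n ≤ V) (i : Fin n) {x y z q : ℕ} (hx : x ≤ N) :
    Runs (addTo (varTape h i) .a) (tapes f C (digits (posOf v) x y z q)) (12 * N + 2)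
      (tapes f C (digits (posOf v) (min (x + v i) N) y z q)) := by
  have := runs_addTo_counter (f := f) hlen hv h i .a (by simp) (x := x) (y := y) (z := z) (q := q) hx
  rwa [update_digits_a] at this

theorem runs_addTo_b (h : n ≤ V) (i : Fin n) {x y z q : ℕ} (hy : y ≤ N) :
    Runs (addTo (varTape h i) .b) (tapes f C (digits (posOf v) x y z q)) (12 * N + 2)
      (tapes f C (digits (posOf v) x (min (y + v i) N) z q)) := by
  have := runs_addTo_counter (f := f) hlen hv h i .b (by simp) (x := x) (y := y) (z := z) (q := q) hy
  rwa [update_digits_b] at this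

theorem runs_addTo_c (h : n ≤ V) (i : Fin n) {x y z q : ℕ} (hz : z ≤ N) :
    Runs (addTo (varTape h i) .c) (tapes f C (digits (posOf v) x y z q)) (12 * N + 2)
      (tapes f C (digits (posOf v) x y (min (z + v i) N) q)) := by
  have := runs_addTo_counter (f := f) hlen hv h i .c (by simp) (x := x) (y := y) (z := z) (q := q) hz
  rwa [update_digits_c] at this

theorem runs_eval_le (x y z : Fin n) (h' : n + (Fml.le x y z : Fml A r n).depth ≤ V) :
    Runs (eval (.le x y z) h') (tapes f C (posOf v)) (50 * (N + 1))
      (tapes (decide (v z ≤ v x + v y)) C (posOf v)) := by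
  have h := Nat.le_of_add_right_le h'
  have hx := hv x
  have hy := hv y
  have hz := hv z
  have ha : (C .a).length = N := hlen _ (by simp) (by simp)
  have hb : (C .b).length = N := hlen _ (by simp) (by simp)
  have h1 := runs_addTo_b (f := f) hlen hv h z (x := 0) (y := 0) (z := 0) (q := 0) (by omega)
  rw [Nat.zero_add, min_eq_left hz] at h1
  have h2 := runs_addTo_a (f := f) hlen hv h x (x := 0) (y := v z) (z := 0) (q := 0) (by omega)
  rw [Nat.zero_add, min_eq_left hx] at h2
  have h3 := runs_addTo_a (f := f) hlen hv h y (x := v x) (y := v z) (z := 0) (q := 0) hx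
  have h4 := runs_subFrom (f := f) (C := C)
    (p := digits (posOf v) (min (v x + v y) N) (v z) 0 0) (x := .a) (d := .b) (by simp)
    (by simp [digits, ha]) (by simp [digits, hb, hz])
  rw [update_digits_b, update_digits_a] at h4
  simp only [digits] at h4
  set q := v z - min (v x + v y) N with hq
  have h5 := runs_flagOp (f := f) (C := C) (p := digits (posOf v) 0 q 0 0) .b false
    fun _ o => o.isNone
  rw [← Option.not_isSome, isSome_head_left (by simp [digits, hb]; omega)] at h5
  have h6 := runs_rewind (f := !decide (0 < q)) (C := C) (p := digits (posOf v) 0 q 0 0) (t := .b)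
    (by simp [digits, hb]; omega)
  rw [update_digits_b, ← posOf_eq_digits] at h6
  simp only [digits] at h6
  rw [← posOf_eq_digits] at h1
  refine ((h1.seq (h2.seq (h3.seq (h4.seq (h5.seq h6))))).mono (by omega)).congr rfl ?_
  congr 1
  rw [Bool.eq_iff_iff]
  simp
  omega

theorem runs_eval_rel (s : Fin r) (x y z : Fin n)
    (h' : n + (Fml.rel s x y z : Fml A r n).depth ≤ V)
    [Decidable (tableRel N (C .tab) s (v x) (v y) (v z))] :
    Runs (eval (.rel s x y z) h') (tapes f C (posOf v)) (100 * (N + 2) ^ 4)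
      (tapes (decide (tableRel N (C .tab) s (v x) (v y) (v z))) C (posOf v)) := by
  have h := Nat.le_of_add_right_le h'
  have hx := hv x
  have hy := hv y
  have hz := hv z
  have h1 := runs_addTo_a (f := f) hlen hv h x (x := 0) (y := 0) (z := 0) (q := 0) (by omega)
  rw [Nat.zero_add, min_eq_left hx] at h1
  have h2 := runs_addTo_b (f := f) hlen hv h y (x := v x) (y := 0) (z := 0) (q := 0) (by omega)
  rw [Nat.zero_add, min_eq_left hy] at h2
  have h3 := runs_addTo_c (f := f) hlen hv h z (x := v x) (y := v y) (z := 0) (q := 0) (by omega)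
  rw [Nat.zero_add, min_eq_left hz] at h3
  have h4 := runs_seek (f := f) (p := posOf v) (hlen .a (by simp) (by simp))
    (hlen .b (by simp) (by simp)) (hlen .c (by simp) (by simp)) hx hy hz
  set i := (v x * (N + 1) + v y) * (N + 1) + v z with hi
  have h5 := runs_flagOp (f := false) (C := C)
    (p := digits (posOf v) 0 0 0 (min i (C .tab).length)) .tab true fun _ o => o.any fun e => e.2 s
  rw [head_right] at h5
  have h6 := runs_rewind
    (f := (C .tab)[min i (C .tab).length]?.any fun e => e.2 s)
    (C := C) (p := digits (posOf v) 0 0 0 (min i (C .tab).length)) (t := .tab) (by simp [digits])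
  rw [update_digits_tab, ← posOf_eq_digits] at h6
  simp only [digits] at h5 h6
  rw [← posOf_eq_digits] at h1
  refine ((h1.seq (h2.seq (h3.seq (h4.seq (h5.seq h6))))).mono ?_).congr rfl ?_
  · have h7 : i ≤ (N * (N + 1) + N) * (N + 1) + N := by rw [hi]; gcongr
    have h8 : i * (6 * N + 12) ≤ ((N * (N + 1) + N) * (N + 1) + N) * (6 * N + 12) :=
      Nat.mul_le_mul_right _ h7
    have h9 : min i (C .tab).length ≤ i := min_le_left _ _
    nlinarith [sq_nonneg N, pow_nonneg (Nat.zero_le N) 3, pow_nonneg (Nat.zero_le N) 4]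
  · congr 1
    rw [Bool.eq_iff_iff]
    simp only [decide_eq_true_eq, tableRel, ← hi]
    rcases le_total i (C .tab).length with hle | hle
    · rw [min_eq_left hle]
    · rw [min_eq_right hle, List.getElem?_eq_none hle, List.getElem?_eq_none le_rfl]

end Atoms

open Classical in
/-- The evaluation is correct if the variable tapes hold the input word, padded with blanks to the length
`N`. -/
theorem runs_eval {w : List A} {T : List (Cell A r)}
    (hT : ∀ i : ℕ, T[i]?.bind Prod.fst = w[i]?) (hN : T.length = N)
    (hC : ∀ t, t ≠ .tab → t ≠ .inp → C t = T) {n : ℕ} (φ : Fml A r n) (h : n + φ.depth ≤ V)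
    (v : Fin n → ℕ) (hv : ∀ i, v i ≤ N) (f : Bool) :
    Runs (eval φ h) (tapes f C (posOf v)) (cost N φ)
      (tapes (decide (φ.Sat w N (tableRel N (C .tab)) v)) C (posOf v)) := by
  have hlen : ∀ t, t ≠ .tab → t ≠ .inp → (C t).length = N := fun t h h' => by rw [hC t h h', hN]
  induction φ generalizing f with
  | @le n x y z => exact (runs_eval_le hlen hv x y z h).congr rfl (by
      congr 1
      rw [Bool.eq_iff_iff, decide_eq_true_iff, decide_eq_true_iff]
      exact Iff.rfl)
  | @letter n P x =>
    refine (runs_flagOp _ _ _).congr rfl ?_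
    rw [head_right, posOf_varTape, hC _ (by simp [varTape]) (by simp [varTape]), hT]
    congr 1
    rw [Bool.eq_iff_iff, decide_eq_true_iff]
    exact Iff.rfl
  | @rel n s x y z => exact runs_eval_rel hlen hv s x y z h
  | not φ ih =>
    refine ((ih h v hv f).seq (runs_flagOp _ _ _)).congr rfl ?_
    congr 1
    rw [← decide_not, Bool.eq_iff_iff, decide_eq_true_iff, decide_eq_true_iff]
    exact Iff.rfl
  | and φ ψ ih ih' =>
    have h1 := ih (by simp only [Fml.depth] at h; omega) v hv f
    have h2 := ih' (by simp only [Fml.depth] at h; omega) v hv true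
    by_cases hs : φ.Sat w N (tableRel N (C .tab)) v
    · rw [decide_eq_true hs] at h1
      refine ((h1.seq (Runs.ite_true (by rfl) h2)).mono (by simp only [cost]; omega)).congr rfl ?_
      simp [Fml.Sat, hs]
    · rw [decide_eq_false hs] at h1
      refine ((h1.seq (Runs.ite_false (by rfl) (runs_flagOp _ _ _))).mono
        (by simp only [cost]; omega)).congr rfl ?_
      simp [Fml.Sat, hs, tapes]
  | @ex n φ ih =>
    have hn : n < V := by simp only [Fml.depth] at h; omega
    have hφ : n + 1 + φ.depth ≤ V := by simp only [Fml.depth] at h; omega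
    set S : ℕ → Prop := fun m => φ.Sat w N (tableRel N (C .tab)) (Fin.snoc v m) with hS
    have hsnoc : ∀ m ≤ N, ∀ i, (Fin.snoc v m : Fin (n + 1) → ℕ) i ≤ N := by
      intro m hm i
      refine Fin.lastCases ?_ (fun i => ?_) i
      · simpa using hm
      · simpa using hv i
    have body : ∀ m ≤ N, ∀ f, Runs (eval φ hφ) (tapes f C (posOf (Fin.snoc v m : Fin (n + 1) → ℕ)))
        (cost N φ) (tapes (decide (S m)) C (posOf (Fin.snoc v m : Fin (n + 1) → ℕ))) :=
      fun m hm f => ih hφ _ (hsnoc m hm) f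
    have hlenn : (C (.var ⟨n, hn⟩)).length = N := hlen _ (by simp) (by simp)
    have hpos : ∀ m, posOf (Fin.snoc v m : Fin (n + 1) → ℕ) (.var ⟨n, hn⟩) = m := by
      intro m
      simp [posOf, Fin.snoc]
    have step : ∀ m < N, ∀ f, Runs (.seq (moveR (.var ⟨n, hn⟩)) (eval φ hφ))
        (tapes f C (posOf (Fin.snoc v m : Fin (n + 1) → ℕ))) (2 + cost N φ)
        (tapes (decide (S (m + 1))) C (posOf (Fin.snoc v (m + 1) : Fin (n + 1) → ℕ))) := by
      intro m hm f
      have := runs_moveR (f := f) (C := C) (p := posOf (Fin.snoc v m : Fin (n + 1) → ℕ))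
        (t := .var ⟨n, hn⟩) (by rw [hpos, hlenn]; omega)
      rw [hpos, hlenn, min_eq_left (by omega), update_posOf] at this
      exact this.seq (body (m + 1) (by omega) f)
    -- the loop, started at the value `m`, ends at the least value from `m` on that satisfies `φ`
    have loop : ∀ d m, m + d = N → ∃ m' ≤ N, Runs (.loop (.var ⟨n, hn⟩, true)
        (fun f o => !f && o.isSome) (.seq (moveR (.var ⟨n, hn⟩)) (eval φ hφ)))
        (tapes (decide (S m)) C (posOf (Fin.snoc v m : Fin (n + 1) → ℕ)))
        (d * (cost N φ + 3) + 1)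
        (tapes (decide (∃ l, m ≤ l ∧ l ≤ N ∧ S l)) C
          (posOf (Fin.snoc v m' : Fin (n + 1) → ℕ))) := by
      intro d
      induction d with
      | zero =>
        intro m hm
        refine ⟨m, by omega, ((Runs.loop_false ?_).mono (by omega)).congr rfl ?_⟩
        · rw [isSome_head_right, hpos, hlenn]
          simp; omega
        · congr 1
          simp only [decide_eq_decide]
          constructor
          · exact fun h => ⟨m, le_rfl, by omega, h⟩
          · rintro ⟨l, h1, h2, h⟩
            obtain rfl : l = m := by omega
            exact h
      | succ d ihd =>
        intro m hm
        by_cases hSm : S m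
        · refine ⟨m, by omega, ((Runs.loop_false ?_).mono (by omega)).congr rfl ?_⟩
          · simp [tapes, hSm]
          · congr 1
            simp only [decide_eq_decide]
            exact ⟨fun h => ⟨m, le_rfl, by omega, h⟩, fun _ => hSm⟩
        · obtain ⟨m', hm', hl⟩ := ihd (m + 1) (by omega)
          refine ⟨m', hm', ((Runs.loop_true ?_ (step m (by omega) _) hl).mono ?_).congr rfl ?_⟩
          · rw [isSome_head_right, hpos, hlenn]
            simp [tapes, hSm]; omega
          · ring_nf; omega
          · congr 1
            simp only [decide_eq_decide]
            constructor
            · rintro ⟨l, h1, h2, h⟩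
              exact ⟨l, by omega, h2, h⟩
            · rintro ⟨l, h1, h2, h⟩
              refine ⟨l, ?_, h2, h⟩
              rcases h1.lt_or_eq with h1 | rfl
              · exact h1
              · exact absurd h hSm
    obtain ⟨m', hm', hl⟩ := loop N 0 (by omega)
    have hrew := runs_rewind (f := decide (∃ l, 0 ≤ l ∧ l ≤ N ∧ S l)) (C := C)
      (p := posOf (Fin.snoc v m' : Fin (n + 1) → ℕ)) (t := .var ⟨n, hn⟩)
      (by rw [hpos, hlenn]; exact hm')
    rw [hpos, update_posOf] at hrew
    refine (((body 0 (by omega) f).seq (hl.seq hrew)).mono ?_).congr ?_ ?_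
    · simp only [cost]
      ring_nf; omega
    · rw [posOf_snoc_zero]
    · rw [posOf_snoc_zero]
      congr 1
      rw [Bool.eq_iff_iff]
      simp only [decide_eq_true_iff, hS, Nat.zero_le, true_and]
      exact Iff.rfl

end Correctness

end StackProg

/-- Only the relations on `{0, …, N}` matter. -/
theorem Fml.sat_congr {A : Type} {r : ℕ} {w : List A} {N : ℕ} {X Y : Fin r → ℕ → ℕ → ℕ → Prop}
    (h : ∀ s, ∀ x ≤ N, ∀ y ≤ N, ∀ z ≤ N, X s x y z ↔ Y s x y z) {n : ℕ} (φ : Fml A r n)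
    (v : Fin n → ℕ) (hv : ∀ i, v i ≤ N) : φ.Sat w N X v ↔ φ.Sat w N Y v := by
  induction φ with
  | le => exact Iff.rfl
  | letter => exact Iff.rfl
  | rel s x y z => exact h s _ (hv x) _ (hv y) _ (hv z)
  | not φ ih => exact not_congr (ih v hv)
  | and φ ψ ih ih' => exact and_congr (ih v hv) (ih' v hv)
  | ex φ ih =>
    refine exists_congr fun m => and_congr_right fun hm => ih _ fun i => ?_
    refine Fin.lastCases ?_ (fun i => ?_) i
    · simpa using hm
    · simpa using hv i

namespace StackProg

/-! ### Guessing a table and evaluating a formula -/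

section Invariant

variable {K G : Type} [DecidableEq K]

theorem Exec.loop_invariant {k g} {p : StackProg K G} {I : StackState K G → Prop}
    (hI : ∀ s t s', I s → Exec p s t s' → I s') {s t s'} (h : Exec (.loop k g p) s t s')
    (hs : I s) : I s' ∧ g s'.1 (s'.2 k).head? = false := by
  generalize hq : StackProg.loop k g p = q at h
  induction h with
  | loop_true hc h h' ih ih' =>
    cases hq
    exact ih' (hI _ _ _ hs h) rfl
  | loop_false hc =>
    cases hq
    exact ⟨hs, hc⟩
  | _ => cases hq

end Invariant

variable {A : Type} {r V : ℕ}

/-- The contents of the tapes: `T` on all variable tapes and counters, the table `X`, and `W` on the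
input tape. -/
def contents (T X W : List (Cell A r)) : Tape V → List (Cell A r)
  | .tab => X
  | .inp => W
  | _ => T

/-- The tapes that serve as counters. -/
def counters (V : ℕ) : List (Tape V) := (List.finRange V).map .var ++ [.a, .b, .c, .u]

/-- Execute an operation for each of the given tapes. -/
def forTapes (o : Tape V → StackOp (Tape V × Bool) (Cell A r)) :
    List (Tape V) → StackProg (Tape V × Bool) (Cell A r)
  | [] => flagOp (.a, false) fun f _ => f
  | t :: l => .seq (.op [o t]) (forTapes o l)

/-- Choose a value of the flag. -/
def chooseFlag : StackProg (Tape V × Bool) (Cell A r) :=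
  .op [.setFlag (.a, false) fun _ _ => true, .setFlag (.a, false) fun _ _ => false]

/-- The blank cell. -/
def blank : Cell A r := (none, fun _ => false)

/-- Push any number of blanks on the counters. -/
def guessBlanks : StackProg (Tape V × Bool) (Cell A r) :=
  .seq chooseFlag (.loop (.a, false) (fun f _ => f)
    (.seq (forTapes (fun t => .push (t, true) blank) (counters V)) chooseFlag))

/-- Push any word on the table. -/
noncomputable def guessTable [Finite A] : StackProg (Tape V × Bool) (Cell A r) :=
  have := Fintype.ofFinite (Cell A r)
  .seq chooseFlag (.loop (.a, false) (fun f _ => f)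
    (.seq (.op ((Finset.univ : Finset (Cell A r)).toList.map fun x => .push (.tab, true) x))
      chooseFlag))

/-- Copy the input word to the counters, in front of what they hold already. -/
def spreadInput : StackProg (Tape V × Bool) (Cell A r) :=
  .seq (forward .inp) (.loop (.inp, false) (fun _ o => o.isSome)
    (.seq (forTapes (fun t => .dup (.inp, false) (t, true)) (counters V)) (moveL .inp)))

/-- The program that guesses a table and evaluates the sentence `φ`. -/
noncomputable def guessAndEval [Finite A] (φ : Fml A r 0) :
    StackProg (Tape φ.depth × Bool) (Cell A r) :=
  .seq guessBlanks (.seq guessTable (.seq spreadInput (eval φ (by omega))))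

theorem deterministic_forTapes (o : Tape V → StackOp (Tape V × Bool) (Cell A r))
    (l : List (Tape V)) : (forTapes o l).Deterministic := by
  induction l with
  | nil => exact le_rfl
  | cons t l ih => exact ⟨le_rfl, ih⟩

theorem deterministic_moveL (t : Tape V) :
    (moveL t : StackProg (Tape V × Bool) (Cell A r)).Deterministic := ⟨le_rfl, le_rfl⟩

theorem deterministic_moveR (t : Tape V) :
    (moveR t : StackProg (Tape V × Bool) (Cell A r)).Deterministic := ⟨le_rfl, le_rfl⟩

theorem deterministic_addTo (s t : Tape V) :
    (addTo s t : StackProg (Tape V × Bool) (Cell A r)).Deterministic :=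
  ⟨⟨deterministic_moveL _, deterministic_moveR _, deterministic_moveR _⟩,
    deterministic_moveL _, deterministic_moveR _⟩

theorem deterministic_eval {n : ℕ} (φ : Fml A r n) (h : n + φ.depth ≤ V) :
    (eval φ h).Deterministic := by
  induction φ with
  | le x y z =>
    exact ⟨deterministic_addTo _ _, deterministic_addTo _ _, deterministic_addTo _ _,
      ⟨deterministic_moveL _, deterministic_moveL _⟩, le_rfl, deterministic_moveL _⟩
  | letter P x => exact le_rfl
  | rel s x y z =>
    have hnz : (nonzero : StackProg (Tape V × Bool) (Cell A r)).Deterministic :=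
      ⟨le_rfl, le_rfl, le_rfl⟩
    exact ⟨deterministic_addTo _ _, deterministic_addTo _ _, deterministic_addTo _ _,
      ⟨hnz, ⟨deterministic_moveL _, deterministic_moveR _, deterministic_moveL _,
        deterministic_moveR _, deterministic_moveL _⟩, deterministic_moveR _, hnz⟩,
      le_rfl, deterministic_moveL _⟩
  | not φ ih => exact ⟨ih _, le_rfl⟩
  | and φ ψ ih ih' => exact ⟨ih _, ih' _, le_rfl⟩
  | ex φ ih => exact ⟨ih _, ⟨deterministic_moveR _, ih _⟩, deterministic_moveL _⟩

theorem mem_counters (t : Tape V) : t ∈ counters V ↔ t ≠ .tab ∧ t ≠ .inp := by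
  cases t <;> simp [counters]

theorem nodup_counters : (counters V).Nodup := by
  have h : ((List.finRange V).map (Tape.var (V := V))).Nodup :=
    (List.nodup_finRange V).map fun i j h => by simpa using h
  simp [counters, List.nodup_append, h]

/-- If the operation for a tape adds the letter `x` to it, then `x` is added to all counters. -/
theorem runs_forTapes {o : Tape V → StackOp (Tape V × Bool) (Cell A r)} {f : Bool}
    {T X W : List (Cell A r)} {p : Tape V → ℕ} {x : Cell A r}
    (ho : ∀ C : Tape V → List (Cell A r), C .inp = W → ∀ t, t ≠ .tab → t ≠ .inp →
      (o t).apply (tapes f C p) = tapes f (Function.update C t (x :: C t)) p) :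
    Runs (forTapes o (counters V)) (tapes f (contents T X W) p) (V + 5)
      (tapes f (contents (x :: T) X W) p) := by
  have key : ∀ l : List (Tape V), l.Nodup → (∀ t ∈ l, t ≠ .tab ∧ t ≠ .inp) →
      ∀ C : Tape V → List (Cell A r), C .inp = W →
      Runs (forTapes o l) (tapes f C p) (l.length + 1)
        (tapes f (fun t => if t ∈ l then x :: C t else C t) p) := by
    intro l
    induction l with
    | nil =>
      intro _ _ C _
      refine (Runs.op _ _).congr rfl ?_
      simp [StackOp.apply, tapes]
    | cons t l ih =>
      intro hl hlt C hC
      have ht := hlt t (by simp)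
      have h1 := Runs.op (o t) (tapes f C p)
      rw [ho C hC t ht.1 ht.2] at h1
      have h2 := ih (List.nodup_cons.1 hl).2 (fun t' h' => hlt t' (by simp [h']))
        (Function.update C t (x :: C t)) (by rw [Function.update_of_ne ht.2.symm, hC])
      refine ((h1.seq h2).mono (by simp; omega)).congr rfl ?_
      congr 1
      funext t'
      by_cases htt : t' = t
      · subst htt
        simp [(List.nodup_cons.1 hl).1]
      · simp [htt]
  refine ((key _ nodup_counters (fun t ht => (mem_counters t).1 ht) (contents T X W) rfl).mono
    ?_).congr rfl ?_
  · simp [counters]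
  · congr 1
    funext t
    simp only [mem_counters]
    cases t <;> simp [contents]

theorem runs_pushBlanks (f : Bool) (T X W : List (Cell A r)) (x : Cell A r) :
    Runs (forTapes (fun t => .push (t, true) x) (counters V))
      (tapes f (contents T X W) fun _ => 0) (V + 5)
      (tapes f (contents (x :: T) X W) fun _ => 0) := by
  refine runs_forTapes (W := W) fun C _ t _ _ => Prod.ext rfl (funext fun ⟨t', b⟩ => ?_)
  by_cases htt : t' = t
  · subst htt
    cases b <;> simp [StackOp.apply, tapes, Function.update]
  · simp [StackOp.apply, tapes, htt, Function.update]

theorem exec_chooseFlag (f b : Bool) (C : Tape V → List (Cell A r)) (p : Tape V → ℕ) :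
    Exec chooseFlag (tapes f C p) 1 (tapes b C p) := by
  cases b
  · exact .op (o := .setFlag (.a, false) fun _ _ => false) (by simp) _
  · exact .op (o := .setFlag (.a, false) fun _ _ => true) (by simp) _

theorem exec_chooseFlag_inv {f : Bool} {C : Tape V → List (Cell A r)} {p : Tape V → ℕ} {t s'}
    (h : Exec chooseFlag (tapes f C p) t s') : ∃ b, s' = tapes b C p := by
  cases h with
  | @op _ o h =>
    simp only [List.mem_cons, List.not_mem_nil, or_false] at h
    rcases h with rfl | rfl <;> exact ⟨_, rfl⟩

theorem runs_guessBlanks (f : Bool) (X W : List (Cell A r)) (n : ℕ) :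
    Runs (guessBlanks (V := V)) (tapes f (contents [] X W) fun _ => 0) ((n + 1) * (V + 7) + 2)
      (tapes false (contents (List.replicate n blank) X W) fun _ => 0) := by
  have key : ∀ n m, Runs (.loop (.a, false) (fun f _ => f)
      (.seq (forTapes (fun t => .push (t, true) blank) (counters V)) chooseFlag))
      (tapes (decide (0 < n)) (contents (List.replicate m blank) X W) fun _ => 0)
      (n * (V + 7) + 1)
      (tapes false (contents (List.replicate (m + n) (blank : Cell A r)) X W) fun _ => 0) := by
    intro n
    induction n with
    | zero =>
      intro m
      refine ((Runs.loop_false ?_).mono (by omega)).congr rfl rfl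
      simp [tapes]
    | succ n ih =>
      intro m
      have h1 := runs_pushBlanks (V := V) (decide (0 < n + 1)) (List.replicate m blank) X W blank
      rw [← List.replicate_succ] at h1
      have h2 : Runs (chooseFlag (V := V)) (tapes (decide (0 < n + 1))
        (contents (List.replicate (m + 1) (blank : Cell A r)) X W) fun _ => 0) 1 _ :=
        ⟨1, le_rfl, exec_chooseFlag _ (decide (0 < n)) _ _⟩
      refine ((Runs.loop_true ?_ (h1.seq h2) (ih (m + 1))).mono ?_).congr rfl ?_
      · simp [tapes]
      · ring_nf; omega
      · rw [show m + 1 + n = m + (n + 1) by omega]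
  have h2 : Runs (chooseFlag (V := V)) (tapes f (contents [] X W) fun _ => 0) 1 _ :=
    ⟨1, le_rfl, exec_chooseFlag _ (decide (0 < n)) _ _⟩
  refine ((h2.seq (key n 0)).mono ?_).congr rfl ?_
  · ring_nf; omega
  · rw [Nat.zero_add]

theorem exec_guessBlanks_inv {f : Bool} {X W : List (Cell A r)} {t s'}
    (h : Exec (guessBlanks (V := V)) (tapes f (contents [] X W) fun _ => 0) t s') :
    ∃ n, s' = tapes false (contents (List.replicate n blank) X W) fun _ => 0 := by
  cases h with
  | seq h1 h2 =>
    obtain ⟨b, rfl⟩ := exec_chooseFlag_inv h1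
    have inv := Exec.loop_invariant
      (I := fun s => ∃ n b, s = tapes b (contents (List.replicate n blank) X W) fun _ => 0)
      ?_ h2 ⟨0, b, rfl⟩
    · obtain ⟨⟨n, b, rfl⟩, hb⟩ := inv
      obtain rfl : b = false := hb
      exact ⟨n, rfl⟩
    · rintro s t s' ⟨n, b, rfl⟩ h
      cases h with
      | seq h1 h2 =>
        obtain ⟨_, _, h3⟩ := runs_pushBlanks (V := V) b (List.replicate n blank) X W blank
        obtain rfl := h1.unique (deterministic_forTapes _ _) h3
        obtain ⟨b', rfl⟩ := exec_chooseFlag_inv h2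
        exact ⟨n + 1, b', rfl⟩

variable [Finite A]

omit [Finite A] in
theorem push_tab (f : Bool) (T X W : List (Cell A r)) (x : Cell A r) :
    (StackOp.push ((.tab : Tape V), true) x).apply (tapes f (contents T X W) fun _ => 0) =
      tapes f (contents T (x :: X) W) fun _ => 0 := by
  refine Prod.ext rfl (funext fun ⟨t', b⟩ => ?_)
  by_cases htt : t' = .tab
  · subst htt
    cases b <;> simp [StackOp.apply, tapes, Function.update, contents]
  · cases t' <;> simp_all [StackOp.apply, tapes, Function.update, contents]

theorem runs_guessTable (f : Bool) (T X W : List (Cell A r)) :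
    Runs (guessTable (V := V)) (tapes f (contents T [] W) fun _ => 0) ((X.length + 1) * 3 + 2)
      (tapes false (contents T X W) fun _ => 0) := by
  let := Fintype.ofFinite (Cell A r)
  have key : ∀ X Y : List (Cell A r), Runs (.loop (.a, false) (fun f _ => f)
      (.seq (.op ((Finset.univ : Finset (Cell A r)).toList.map fun x => .push (.tab, true) x))
        chooseFlag))
      (tapes (decide (0 < X.length)) (contents (V := V) T Y W) fun _ => 0) (X.length * 3 + 1)
      (tapes false (contents T (X.reverse ++ Y) W) fun _ => 0) := by
    intro X
    induction X with
    | nil =>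
      intro Y
      refine ((Runs.loop_false ?_).mono (by omega)).congr rfl rfl
      simp [tapes]
    | cons x X ih =>
      intro Y
      have h1 : Runs (.op ((Finset.univ : Finset (Cell A r)).toList.map fun x =>
          StackOp.push ((.tab : Tape V), true) x))
          (tapes (decide (0 < (x :: X).length)) (contents T Y W) fun _ => 0) 1
          (tapes (decide (0 < (x :: X).length)) (contents T (x :: Y) W) fun _ => 0) :=
        ⟨1, le_rfl, by rw [← push_tab]; exact .op (List.mem_map_of_mem (by simp)) _⟩
      have h2 : Runs (chooseFlag (V := V)) (tapes (decide (0 < (x :: X).length))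
        (contents T (x :: Y) W) fun _ => 0) 1 _ :=
        ⟨1, le_rfl, exec_chooseFlag _ (decide (0 < X.length)) _ _⟩
      refine ((Runs.loop_true ?_ (h1.seq h2) (ih (x :: Y))).mono ?_).congr rfl ?_
      · simp [tapes]
      · simp; omega
      · simp
  have h2 : Runs (chooseFlag (V := V)) (tapes f (contents T [] W) fun _ => 0) 1 _ :=
    ⟨1, le_rfl, exec_chooseFlag _ (decide (0 < X.reverse.length)) _ _⟩
  refine ((h2.seq (key X.reverse [])).mono ?_).congr rfl ?_
  · simp; omega
  · simp

theorem exec_guessTable_inv {f : Bool} {T W : List (Cell A r)} {t s'}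
    (h : Exec (guessTable (V := V)) (tapes f (contents T [] W) fun _ => 0) t s') :
    ∃ X, s' = tapes false (contents T X W) fun _ => 0 := by
  cases h with
  | seq h1 h2 =>
    obtain ⟨b, rfl⟩ := exec_chooseFlag_inv h1
    have inv := Exec.loop_invariant
      (I := fun s => ∃ X b, s = tapes b (contents T X W) fun _ => 0) ?_ h2 ⟨[], b, rfl⟩
    · obtain ⟨⟨X, b, rfl⟩, hb⟩ := inv
      obtain rfl : b = false := hb
      exact ⟨X, rfl⟩
    · rintro s t s' ⟨X, b, rfl⟩ h
      cases h with
      | seq h1 h2 =>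
        cases h1 with
        | @op _ o h =>
          obtain ⟨x, _, rfl⟩ := List.mem_map.1 h
          rw [push_tab] at h2
          obtain ⟨b', rfl⟩ := exec_chooseFlag_inv h2
          exact ⟨x :: X, b', rfl⟩

omit [Finite A] in
theorem runs_spreadInput (f : Bool) (T X W : List (Cell A r)) :
    Runs (spreadInput (V := V)) (tapes f (contents T X W) fun _ => 0)
      ((W.length + 1) * (V + 11) + 2) (tapes f (contents (W ++ T) X W) fun _ => 0) := by
  have h1 := runs_forward (f := f) (C := contents (V := V) T X W) (p := fun _ => 0) (t := .inp)
    (by simp)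
  let P : ℕ → Tape V → ℕ := fun i => Function.update (fun _ => 0) .inp i
  have h2 := Runs.loop (k := ((.inp : Tape V), false)) (g := fun _ o => o.isSome)
    (p := .seq (forTapes (fun t => .dup (.inp, false) (t, true)) (counters V)) (moveL .inp))
    (fun i => tapes f (contents (W.drop (W.length - i) ++ T) X W) (P (W.length - i)))
    W.length (V + 7) ?_ ?_ ?_
  · simp only [Nat.sub_zero, Nat.sub_self, List.drop_length, List.drop_zero, List.nil_append] at h2
    refine ((h1.seq h2).mono ?_).congr rfl ?_
    · simp only [contents]
      ring_nf; omega
    · congr 1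
      exact Function.update_eq_self _ _
  · intro i hi
    rw [isSome_head_left (by simp [P, contents])]
    simp [P, hi]
  · rw [isSome_head_left (by simp [P])]
    simp [P]
  · intro i hi
    have hi' : W.length - (i + 1) < W.length := by omega
    have h3 := runs_forTapes (o := fun t : Tape V => StackOp.dup (.inp, false) (t, true)) (f := f)
      (T := W.drop (W.length - i) ++ T) (X := X) (W := W) (p := P (W.length - i))
      (x := W[W.length - (i + 1)]) ?_
    · have h4 := runs_moveL (f := f) (t := .inp) (p := P (W.length - i))
        (C := contents (W[W.length - (i + 1)] :: (W.drop (W.length - i) ++ T)) X W)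
        (by simp [P, contents])
      refine (h3.seq h4).congr rfl ?_
      rw [← List.cons_append, show W.length - i = W.length - (i + 1) + 1 by omega,
        List.getElem_cons_drop]
      simp [P]
    · intro C hC t ht ht'
      refine Prod.ext rfl (funext fun ⟨t', b⟩ => ?_)
      have hhead : (W.take (W.length - i)).getLast? = some W[W.length - (i + 1)] := by
        rw [show W.length - i = W.length - (i + 1) + 1 by omega,
          show W.take (W.length - (i + 1) + 1) =
            W.take (W.length - (i + 1)) ++ [W[W.length - (i + 1)]] by simp]
        exact List.getLast?_concat
      by_cases htt : t' = t
      · subst htt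
        cases b <;> simp [StackOp.apply, tapes, Function.update, P, ht', hC, hhead]
      · simp [StackOp.apply, tapes, htt, Function.update]

end StackProg

/-- A language is in `NEXPTIME` if its words are those for which, for some `N` not smaller than the
length of the word, a fixed first-order sentence holds in `{0, …, N}` for some choice of the
relations, where `N` may be chosen exponential. -/
theorem mem_NEXPTIME_of_sat {A : Type} [Finite A] {r : ℕ} (φ : Fml A r 0) (L : Set (List A))
    (q : Polynomial ℕ)
    (h₁ : ∀ w ∈ L, ∃ N ≤ 2 ^ q.eval w.length, w.length ≤ N ∧ ∃ X, φ.Sat w N X Fin.elim0)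
    (h₂ : ∀ w N X, w.length ≤ N → φ.Sat w N X Fin.elim0 → w ∈ L) : L ∈ NEXPTIME := by
  classical
  open StackProg in
  have : Inhabited (Cell A r) := ⟨blank⟩
  let enc : A → Cell A r := fun x => (some x, fun _ => false)
  let V := φ.depth
  let T : List A → ℕ → List (Cell A r) := fun w n => w.map enc ++ List.replicate n blank
  have hinit : ∀ w : List A, (true, Function.update (fun _ => []) ((.inp : Tape V), true)
      (w.map enc)) = tapes true (contents [] [] (w.map enc)) fun _ => 0 := by
    intro w
    refine Prod.ext rfl (funext fun ⟨t, b⟩ => ?_)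
    cases t <;> cases b <;> simp [tapes, contents]
  have hT : ∀ w n, ∀ i : ℕ, (T w n)[i]?.bind Prod.fst = w[i]? := by
    intro w n i
    simp only [T, List.getElem?_append]
    split_ifs with h
    · have h : i < w.length := by simpa using h
      simp [enc, h]
    · have h : w.length ≤ i := by simpa using h
      rw [List.getElem?_eq_none (l := w) h, List.getElem?_replicate]
      split_ifs <;> rfl
  have hlen : ∀ w n, (T w n).length = w.length + n := fun w n => by simp [T]
  have heval : ∀ w n X, Runs (eval φ (V := V) (by omega))
      (tapes false (contents (T w n) X (w.map enc)) fun _ => 0) (cost (w.length + n) φ)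
      (tapes (decide (φ.Sat w (w.length + n) (tableRel (w.length + n) X) Fin.elim0))
        (contents (T w n) X (w.map enc)) fun _ => 0) := by
    intro w n X
    have hp : posOf (V := V) (Fin.elim0 : Fin 0 → ℕ) = fun _ => 0 := by
      funext t
      cases t <;> simp [posOf]
    have := runs_eval (V := V) (C := contents (T w n) X (w.map enc)) (hT w n) (hlen w n)
      (fun t ht ht' => by cases t <;> simp_all [contents]) φ (by omega) Fin.elim0
      (fun i => i.elim0) false
    rw [hp] at this
    exact this
  obtain ⟨c, hc⟩ := exists_cost_le φ
  -- a word in the language is accepted in time: guess `N` and the table of the relations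
  have htime : ∀ w : List A, w ∈ L → ∃ m ≤ 2 ^ ((q + 2) * Polynomial.C (c + V + 15)).eval w.length,
      ((guessAndEval φ).toNTM (.inp, true) enc).AcceptsIn w m := by
    intro w hw
    obtain ⟨N, hN, hwN, R, hR⟩ := h₁ w hw
    obtain ⟨n, rfl⟩ := Nat.exists_eq_add_of_le hwN
    set N := w.length + n with hNdef
    let X : List (Cell A r) := (List.range ((N + 1) ^ 3)).map fun i =>
      (none, fun s => decide (R s (i / (N + 1) / (N + 1)) (i / (N + 1) % (N + 1)) (i % (N + 1))))
    have hX : ∀ s, ∀ x ≤ N, ∀ y ≤ N, ∀ z ≤ N, R s x y z ↔ tableRel N X s x y z := by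
      intro s x hx y hy z hz
      have hlt : (x * (N + 1) + y) * (N + 1) + z < (N + 1) ^ 3 := by
        have h1 : x * (N + 1) + y ≤ N * (N + 1) + N := by gcongr
        have h2 : (x * (N + 1) + y) * (N + 1) ≤ (N * (N + 1) + N) * (N + 1) :=
          Nat.mul_le_mul_right _ h1
        have h3 : (N + 1) ^ 3 = (N * (N + 1) + N) * (N + 1) + N + 1 := by ring
        omega
      have hz1 : ((x * (N + 1) + y) * (N + 1) + z) / (N + 1) = x * (N + 1) + y := by
        rw [Nat.mul_comm, Nat.mul_add_div (by omega), Nat.div_eq_of_lt (by omega), Nat.add_zero]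
      have hy1 : (x * (N + 1) + y) / (N + 1) = x := by
        rw [Nat.mul_comm, Nat.mul_add_div (by omega), Nat.div_eq_of_lt (by omega), Nat.add_zero]
      have hz2 : ((x * (N + 1) + y) * (N + 1) + z) % (N + 1) = z := by
        rw [Nat.mul_comm, Nat.mul_add_mod, Nat.mod_eq_of_lt (by omega)]
      have hy2 : (x * (N + 1) + y) % (N + 1) = y := by
        rw [Nat.mul_comm, Nat.mul_add_mod, Nat.mod_eq_of_lt (by omega)]
      simp [tableRel, X, hlt, hz1, hy1, hz2, hy2]
    have hsat : φ.Sat w N (tableRel N X) Fin.elim0 :=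
      (Fml.sat_congr hX φ _ fun i => i.elim0).1 hR
    have hall := (runs_guessBlanks (V := V) true [] (w.map enc) n).seq
      ((runs_guessTable (V := V) false (List.replicate n blank) X (w.map enc)).seq
        ((runs_spreadInput (V := V) false (List.replicate n blank) X (w.map enc)).seq
          (heval w n X)))
    obtain ⟨t, ht, hex⟩ := hall
    refine ⟨t + 1, ?_, ?_⟩
    · have hXlen : X.length = (N + 1) ^ 3 := by simp [X]
      rw [hXlen, List.length_map, ← hNdef] at ht
      have hcN := hc N
      -- every summand of the running time is at most a power of `N + 2 ≤ 2 ^ (q + 2)`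
      set M := N + 2 with hM
      have h2M : ∀ e, 2 ^ e ≤ M ^ e := fun e => Nat.pow_le_pow_left (by omega) e
      have hle : ∀ e, e ≤ c + V + 12 → M ^ e ≤ M ^ (c + V + 12) :=
        fun e he => Nat.pow_le_pow_right (by omega) he
      have b1 : (n + 1) * (V + 7) ≤ M ^ (c + V + 12) := by
        refine le_trans (Nat.mul_le_mul (show n + 1 ≤ M by omega)
          ((Nat.lt_two_pow_self.le).trans (h2M (V + 7)))) ?_
        rw [← pow_succ']
        exact hle _ (by omega)
      have b2 : (N + 1) ^ 3 * 3 ≤ M ^ (c + V + 12) := by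
        refine le_trans (Nat.mul_le_mul (Nat.pow_le_pow_left (show N + 1 ≤ M by omega) 3)
          ((show 3 ≤ 2 ^ 2 by norm_num).trans (h2M 2))) ?_
        rw [← pow_add]
        exact hle _ (by omega)
      have b3 : (w.length + 1) * (V + 11) ≤ M ^ (c + V + 12) := by
        refine le_trans (Nat.mul_le_mul (show w.length + 1 ≤ M by omega)
          ((Nat.lt_two_pow_self.le).trans (h2M (V + 11)))) ?_
        rw [← pow_succ']
        exact hle _ (by omega)
      have b4 : M ^ c ≤ M ^ (c + V + 12) := hle _ (by omega)
      have b5 : 2 ^ 4 ≤ M ^ (c + V + 12) := (h2M 4).trans (hle _ (by omega))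
      have b6 : M ^ (c + V + 12) * 2 ^ 3 ≤ M ^ (c + V + 15) := by
        rw [show c + V + 15 = c + V + 12 + 3 by omega, pow_add M (c + V + 12)]
        exact Nat.mul_le_mul_left _ (h2M 3)
      have b7 : M ≤ 2 ^ (q.eval w.length + 2) := by
        rw [pow_add]
        have : 1 ≤ 2 ^ q.eval w.length := Nat.one_le_two_pow
        omega
      have b8 : M ^ (c + V + 15) ≤ 2 ^ ((q + 2) * Polynomial.C (c + V + 15)).eval w.length := by
        refine (Nat.pow_le_pow_left b7 _).trans (le_of_eq ?_)
        rw [← pow_mul]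
        simp
      omega
    · rw [acceptsIn_toNTM, hinit]
      exact ⟨t, _, rfl, hex, decide_eq_true hsat⟩
  refine ⟨(q + 2) * Polynomial.C (c + V + 15), (guessAndEval φ).toNTM (.inp, true) enc,
    fun w => ⟨⟨fun hw => (htime w hw).imp fun _ h => h.2, ?_⟩, htime w⟩⟩
  -- conversely, after the guesses the execution is determined, and evaluates `φ` for the guessed table
  rintro ⟨m, hm⟩
  rw [acceptsIn_toNTM, hinit] at hm
  obtain ⟨t, s', rfl, hex, hs'⟩ := hm
  cases hex with
  | seq ha hb =>
    obtain ⟨n, rfl⟩ := exec_guessBlanks_inv ha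
    cases hb with
    | seq ha hb =>
      obtain ⟨X, rfl⟩ := exec_guessTable_inv ha
      obtain ⟨_, _, h3⟩ := ((runs_spreadInput (V := V) false (List.replicate n blank) X
        (w.map enc)).seq (heval w n X))
      have hd : (StackProg.seq spreadInput (eval φ (V := V) (by omega))).Deterministic :=
        ⟨⟨deterministic_moveR _, deterministic_forTapes _ _, deterministic_moveL _⟩,
          deterministic_eval _ _⟩
      obtain rfl := hb.unique hd h3
      exact h₂ w _ _ (by omega) (of_decide_eq_true hs')

/-! ### Definable predicates -/

/-- A structure for formulas: a word, the number `N` and the relations. -/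
structure FOStr (A : Type) (r : ℕ) where
  w : List A
  N : ℕ
  X : Fin r → ℕ → ℕ → ℕ → Prop

namespace FOStr

variable {A : Type} {r : ℕ}

/-- All positions of the word, and the position after its end, belong to `{0, …, N}`. -/
def Fits (S : FOStr A r) : Prop := S.w.length ≤ S.N

/-- The relations are graphs of binary functions on `{0, …, N}`. -/
def IsFunctional (S : FOStr A r) : Prop :=
  S.Fits ∧ ∀ s, ∀ x ≤ S.N, ∀ y ≤ S.N, ∃ z ≤ S.N, S.X s x y z ∧ ∀ z' ≤ S.N, S.X s x y z' → z' = z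

open Classical in
/-- The binary function with graph `X s`. -/
noncomputable def f (S : FOStr A r) (s : Fin r) (x y : ℕ) : ℕ :=
  if h : ∃ z ≤ S.N, S.X s x y z then h.choose else 0

theorem f_le (S : FOStr A r) (s : Fin r) (x y : ℕ) : S.f s x y ≤ S.N := by
  rw [f]
  split_ifs with h
  · exact h.choose_spec.1
  · exact Nat.zero_le _

theorem IsFunctional.f_eq_iff {S : FOStr A r} (hS : S.IsFunctional) (s : Fin r) {x y z : ℕ}
    (hx : x ≤ S.N) (hy : y ≤ S.N) (hz : z ≤ S.N) : S.f s x y = z ↔ S.X s x y z := by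
  obtain ⟨z₀, hz₀, h, hu⟩ := hS.2 s x hx y hy
  have hex : ∃ z ≤ S.N, S.X s x y z := ⟨z₀, hz₀, h⟩
  have hf : S.f s x y = hex.choose := by rw [f, dif_pos hex]
  have h1 := hex.choose_spec
  rw [hf, hu _ h1.1 h1.2]
  constructor
  · rintro rfl; exact h
  · exact fun h => (hu _ hz h).symm

end FOStr

namespace Fml

variable {A : Type} {r : ℕ}

/-- Substitution of variables for variables. -/
def rename : {n m : ℕ} → (Fin n → Fin m) → Fml A r n → Fml A r m
  | _, _, τ, le x y z => le (τ x) (τ y) (τ z)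
  | _, _, τ, letter P x => letter P (τ x)
  | _, _, τ, rel s x y z => rel s (τ x) (τ y) (τ z)
  | _, _, τ, not φ => not (φ.rename τ)
  | _, _, τ, and φ ψ => and (φ.rename τ) (ψ.rename τ)
  | _, m, τ, ex φ => ex (φ.rename (Fin.lastCases (Fin.last m) fun i => (τ i).castSucc))

theorem sat_rename {w : List A} {N : ℕ} {X : Fin r → ℕ → ℕ → ℕ → Prop} {n m : ℕ}
    (τ : Fin n → Fin m) (φ : Fml A r n) (v : Fin m → ℕ) :
    (φ.rename τ).Sat w N X v ↔ φ.Sat w N X (v ∘ τ) := by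
  induction φ generalizing m with
  | le => exact Iff.rfl
  | letter => exact Iff.rfl
  | rel => exact Iff.rfl
  | not φ ih => exact not_congr (ih τ v)
  | and φ ψ ih ih' => exact and_congr (ih τ v) (ih' τ v)
  | ex φ ih =>
    refine exists_congr fun l => and_congr_right fun _ => ?_
    rw [ih]
    refine iff_of_eq (congrArg _ (funext fun i => ?_))
    refine Fin.lastCases ?_ (fun i => ?_) i <;> simp

end Fml

variable {A : Type} {r : ℕ}

/-- A predicate of structures in the class `𝒞` and of `n` elements of `{0, …, N}` is definable by a
first-order formula. -/
def FOPred (𝒞 : FOStr A r → Prop) {n : ℕ} (P : FOStr A r → (Fin n → ℕ) → Prop) : Prop :=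
  ∃ φ : Fml A r n, ∀ S, 𝒞 S → ∀ v : Fin n → ℕ, (∀ i, v i ≤ S.N) →
    (φ.Sat S.w S.N S.X v ↔ P S v)

/-- A function of `n` elements of `{0, …, N}` into `{0, …, N}` has a definable graph. -/
def FOFun (𝒞 : FOStr A r → Prop) {n : ℕ} (g : FOStr A r → (Fin n → ℕ) → ℕ) : Prop :=
  (∀ S, 𝒞 S → ∀ v : Fin n → ℕ, (∀ i, v i ≤ S.N) → g S v ≤ S.N) ∧
    FOPred 𝒞 fun S (v : Fin (n + 1) → ℕ) => g S (Fin.init v) = v (Fin.last n)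

section Definability

variable {𝒞 : FOStr A r → Prop} {n : ℕ}

theorem forall_snoc_le {N : ℕ} {v : Fin n → ℕ} (hv : ∀ i, v i ≤ N) {m : ℕ} (hm : m ≤ N) :
    ∀ i, (Fin.snoc v m : Fin (n + 1) → ℕ) i ≤ N := by
  refine Fin.lastCases ?_ (fun i => ?_)
  · simpa using hm
  · simpa using hv i

theorem FOPred.congr {P Q : FOStr A r → (Fin n → ℕ) → Prop} (hP : FOPred 𝒞 P)
    (h : ∀ S, 𝒞 S → ∀ v : Fin n → ℕ, (∀ i, v i ≤ S.N) → (P S v ↔ Q S v)) : FOPred 𝒞 Q := by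
  obtain ⟨φ, hφ⟩ := hP
  exact ⟨φ, fun S hS v hv => (hφ S hS v hv).trans (h S hS v hv)⟩

theorem FOPred.not {P : FOStr A r → (Fin n → ℕ) → Prop} (hP : FOPred 𝒞 P) :
    FOPred 𝒞 fun S v => ¬ P S v := by
  obtain ⟨φ, hφ⟩ := hP
  exact ⟨.not φ, fun S hS v hv => not_congr (hφ S hS v hv)⟩

theorem FOPred.and {P Q : FOStr A r → (Fin n → ℕ) → Prop} (hP : FOPred 𝒞 P) (hQ : FOPred 𝒞 Q) :
    FOPred 𝒞 fun S v => P S v ∧ Q S v := by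
  obtain ⟨φ, hφ⟩ := hP
  obtain ⟨ψ, hψ⟩ := hQ
  exact ⟨.and φ ψ, fun S hS v hv => and_congr (hφ S hS v hv) (hψ S hS v hv)⟩

theorem FOPred.or {P Q : FOStr A r → (Fin n → ℕ) → Prop} (hP : FOPred 𝒞 P) (hQ : FOPred 𝒞 Q) :
    FOPred 𝒞 fun S v => P S v ∨ Q S v :=
  (hP.not.and hQ.not).not.congr fun S _ v _ => by tauto

theorem FOPred.imp {P Q : FOStr A r → (Fin n → ℕ) → Prop} (hP : FOPred 𝒞 P) (hQ : FOPred 𝒞 Q) :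
    FOPred 𝒞 fun S v => P S v → Q S v :=
  (hP.and hQ.not).not.congr fun S _ v _ => by tauto

theorem FOPred.iff {P Q : FOStr A r → (Fin n → ℕ) → Prop} (hP : FOPred 𝒞 P) (hQ : FOPred 𝒞 Q) :
    FOPred 𝒞 fun S v => P S v ↔ Q S v :=
  ((hP.imp hQ).and (hQ.imp hP)).congr fun S _ v _ => by tauto

theorem FOPred.ex {P : FOStr A r → (Fin n → ℕ) → ℕ → Prop}
    (hP : FOPred 𝒞 fun S (v : Fin (n + 1) → ℕ) => P S (Fin.init v) (v (Fin.last n))) :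
    FOPred 𝒞 fun S v => ∃ m ≤ S.N, P S v m := by
  obtain ⟨φ, hφ⟩ := hP
  refine ⟨.ex φ, fun S hS v hv => exists_congr fun m => and_congr_right fun hm => ?_⟩
  simpa using hφ S hS _ (forall_snoc_le hv hm)

theorem FOPred.all {P : FOStr A r → (Fin n → ℕ) → ℕ → Prop}
    (hP : FOPred 𝒞 fun S (v : Fin (n + 1) → ℕ) => P S (Fin.init v) (v (Fin.last n))) :
    FOPred 𝒞 fun S v => ∀ m ≤ S.N, P S v m :=
  (FOPred.ex (P := fun S v m => ¬ P S v m) hP.not).not.congr fun S _ v _ => by simp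

theorem FOPred.true : FOPred 𝒞 fun _ (_ : Fin n → ℕ) => True :=
  ⟨.ex (.le (Fin.last n) (Fin.last n) (Fin.last n)), fun S _ v _ => by
    simp only [Fml.Sat, iff_true]
    exact ⟨0, Nat.zero_le _, by simp⟩⟩

theorem FOPred.prop (p : Prop) : FOPred 𝒞 fun _ (_ : Fin n → ℕ) => p := by
  by_cases hp : p
  · exact FOPred.true.congr fun _ _ _ _ => by simp [hp]
  · exact FOPred.true.not.congr fun _ _ _ _ => by simp [hp]

theorem FOPred.forall_finite {ι : Type} [Finite ι] {P : ι → FOStr A r → (Fin n → ℕ) → Prop}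
    (hP : ∀ i, FOPred 𝒞 (P i)) : FOPred 𝒞 fun S v => ∀ i, P i S v := by
  have := Fintype.ofFinite ι
  have key : ∀ l : List ι, FOPred 𝒞 fun S v => ∀ i ∈ l, P i S v := by
    intro l
    induction l with
    | nil => exact FOPred.true.congr fun _ _ _ _ => by simp
    | cons i l ih => exact ((hP i).and ih).congr fun _ _ _ _ => by simp
  exact (key Finset.univ.toList).congr fun _ _ _ _ => by simp

theorem FOPred.rename {m : ℕ} {P : FOStr A r → (Fin n → ℕ) → Prop} (hP : FOPred 𝒞 P)
    (τ : Fin n → Fin m) : FOPred 𝒞 fun S v => P S (v ∘ τ) := by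
  obtain ⟨φ, hφ⟩ := hP
  exact ⟨φ.rename τ, fun S hS v hv =>
    (Fml.sat_rename τ φ v).trans (hφ S hS _ fun i => hv _)⟩

theorem FOFun.weaken {g : FOStr A r → (Fin n → ℕ) → ℕ} (hg : FOFun 𝒞 g) :
    FOFun 𝒞 fun S (v : Fin (n + 1) → ℕ) => g S (Fin.init v) := by
  refine ⟨fun S hS v hv => hg.1 S hS _ fun i => hv _, ?_⟩
  refine (hg.2.rename (Fin.lastCases (Fin.last (n + 1)) fun i => i.castSucc.castSucc)).congr
    fun S hS v hv => iff_of_eq (congrArg₂ _ (congrArg _ (funext fun i => ?_)) ?_)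
  · simp [Fin.init]
  · simp

/-- Substitution of a function with a definable graph for a variable. -/
theorem FOPred.ex_eq {g : FOStr A r → (Fin n → ℕ) → ℕ} {P : FOStr A r → (Fin n → ℕ) → ℕ → Prop}
    (hg : FOFun 𝒞 g)
    (hP : FOPred 𝒞 fun S (v : Fin (n + 1) → ℕ) => P S (Fin.init v) (v (Fin.last n))) :
    FOPred 𝒞 fun S v => P S v (g S v) := by
  refine (FOPred.ex (P := fun S v m => g S v = m ∧ P S v m) (hg.2.and hP)).congr
    fun S hS v hv => ⟨?_, fun h => ⟨_, hg.1 S hS v hv, rfl, h⟩⟩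
  rintro ⟨m, _, rfl, h⟩
  exact h

/-- The atomic formula `z ≤ x + y`. -/
theorem FOPred.le_add_var (x y z : Fin n) :
    FOPred 𝒞 fun _ (v : Fin n → ℕ) => v z ≤ v x + v y :=
  ⟨.le x y z, fun _ _ _ _ => Iff.rfl⟩

theorem FOPred.le_var (x y : Fin n) : FOPred 𝒞 fun _ (v : Fin n → ℕ) => v x ≤ v y := by
  -- `x ≤ y + m` for all `m`, in particular for `m = 0`
  refine (FOPred.all (P := fun _ v m => v x ≤ v y + m)
    (.le_add_var y.castSucc (Fin.last n) x.castSucc)).congr fun S _ v _ => ?_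
  exact ⟨fun h => h 0 (Nat.zero_le _), fun h m _ => by omega⟩

theorem FOPred.eq_var (x y : Fin n) : FOPred 𝒞 fun _ (v : Fin n → ℕ) => v x = v y :=
  ((FOPred.le_var x y).and (.le_var y x)).congr fun _ _ _ _ => by omega

theorem FOFun.var (x : Fin n) : FOFun 𝒞 fun _ (v : Fin n → ℕ) => v x :=
  ⟨fun _ _ _ hv => hv x, .eq_var x.castSucc (Fin.last n)⟩

theorem FOFun.zero : FOFun 𝒞 fun _ (_ : Fin n → ℕ) => 0 := by
  refine ⟨fun _ _ _ _ => Nat.zero_le _, ?_⟩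
  refine (FOPred.all (P := fun _ v m => v (Fin.last n) ≤ m)
    (.le_var (Fin.last n).castSucc (Fin.last (n + 1)))).congr fun S _ v _ => ?_
  exact ⟨fun h => (Nat.le_zero.1 (h 0 (Nat.zero_le _))).symm,
    fun h m _ => h.symm.le.trans (Nat.zero_le m)⟩

variable {g h k : FOStr A r → (Fin n → ℕ) → ℕ}

theorem FOPred.le_add (hg : FOFun 𝒞 g) (hh : FOFun 𝒞 h) (hk : FOFun 𝒞 k) :
    FOPred 𝒞 fun S v => g S v ≤ h S v + k S v := by
  refine .ex_eq (P := fun S v m => m ≤ h S v + k S v) hg ?_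
  refine .ex_eq (P := fun S v m => v (Fin.last n) ≤ m + k S (Fin.init v)) hh.weaken ?_
  refine .ex_eq (P := fun S v m => v (Fin.last n).castSucc ≤ v (Fin.last (n + 1)) +
    m) hk.weaken.weaken ?_
  exact .le_add_var _ _ _

theorem FOPred.le (hg : FOFun 𝒞 g) (hh : FOFun 𝒞 h) : FOPred 𝒞 fun S v => g S v ≤ h S v :=
  (FOPred.le_add hg hh .zero).congr fun _ _ _ _ => by simp

theorem FOPred.lt (hg : FOFun 𝒞 g) (hh : FOFun 𝒞 h) : FOPred 𝒞 fun S v => g S v < h S v :=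
  (FOPred.le hh hg).not.congr fun _ _ _ _ => by simp

theorem FOPred.eq (hg : FOFun 𝒞 g) (hh : FOFun 𝒞 h) : FOPred 𝒞 fun S v => g S v = h S v :=
  ((FOPred.le hg hh).and (.le hh hg)).congr fun _ _ _ _ => by omega

theorem FOPred.allLt {P : FOStr A r → (Fin n → ℕ) → ℕ → Prop} (hg : FOFun 𝒞 g)
    (hP : FOPred 𝒞 fun S (v : Fin (n + 1) → ℕ) => P S (Fin.init v) (v (Fin.last n))) :
    FOPred 𝒞 fun S v => ∀ m < g S v, P S v m := by
  refine (FOPred.all (P := fun S v m => m < g S v → P S v m)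
    ((FOPred.lt (.var _) hg.weaken).imp hP)).congr fun S hS v hv => ?_
  exact ⟨fun h m hm => h m (hm.le.trans (hg.1 S hS v hv)) hm, fun h m _ hm => h m hm⟩

theorem FOPred.exLt {P : FOStr A r → (Fin n → ℕ) → ℕ → Prop} (hg : FOFun 𝒞 g)
    (hP : FOPred 𝒞 fun S (v : Fin (n + 1) → ℕ) => P S (Fin.init v) (v (Fin.last n))) :
    FOPred 𝒞 fun S v => ∃ m < g S v, P S v m :=
  (FOPred.allLt (P := fun S v m => ¬ P S v m) hg hP.not).not.congr fun S _ v _ => by simp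

theorem FOPred.allLe {P : FOStr A r → (Fin n → ℕ) → ℕ → Prop} (hg : FOFun 𝒞 g)
    (hP : FOPred 𝒞 fun S (v : Fin (n + 1) → ℕ) => P S (Fin.init v) (v (Fin.last n))) :
    FOPred 𝒞 fun S v => ∀ m ≤ g S v, P S v m := by
  refine (FOPred.all (P := fun S v m => m ≤ g S v → P S v m)
    ((FOPred.le (.var _) hg.weaken).imp hP)).congr fun S hS v hv => ?_
  exact ⟨fun h m hm => h m (hm.trans (hg.1 S hS v hv)) hm, fun h m _ hm => h m hm⟩

theorem FOPred.exLe {P : FOStr A r → (Fin n → ℕ) → ℕ → Prop} (hg : FOFun 𝒞 g)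
    (hP : FOPred 𝒞 fun S (v : Fin (n + 1) → ℕ) => P S (Fin.init v) (v (Fin.last n))) :
    FOPred 𝒞 fun S v => ∃ m ≤ g S v, P S v m :=
  (FOPred.allLe (P := fun S v m => ¬ P S v m) hg hP.not).not.congr fun S _ v _ => by simp

/-- The sum `h + k` may be larger than `N`; the inequality says that `g ≤ m + k` for some `m < h`, or
`g < k`. -/
theorem FOPred.lt_add (hg : FOFun 𝒞 g) (hh : FOFun 𝒞 h) (hk : FOFun 𝒞 k) :
    FOPred 𝒞 fun S v => g S v < h S v + k S v := by
  refine ((FOPred.exLt (P := fun S v m => g S v ≤ m + k S v) hh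
    (.le_add hg.weaken (.var _) hk.weaken)).or (.lt hg hk)).congr fun S _ v _ => ?_
  constructor
  · rintro (⟨m, hm, h⟩ | h) <;> omega
  · intro h'
    rcases Nat.eq_zero_or_pos (h S v) with h0 | h0
    · right; omega
    · exact .inl ⟨h S v - 1, by omega, by omega⟩

theorem FOPred.eq_add (hg : FOFun 𝒞 g) (hh : FOFun 𝒞 h) (hk : FOFun 𝒞 k) :
    FOPred 𝒞 fun S v => g S v = h S v + k S v :=
  ((FOPred.le_add hg hh hk).and (FOPred.lt_add hg hh hk).not).congr fun _ _ _ _ => by omega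

theorem FOPred.eq_succ (hg : FOFun 𝒞 g) (hh : FOFun 𝒞 h) :
    FOPred 𝒞 fun S v => g S v = h S v + 1 := by
  refine ((FOPred.lt hh hg).and (FOPred.allLt (P := fun S v m => m ≤ h S v) hg
    (.le (.var _) hh.weaken))).congr fun S _ v _ => ?_
  constructor
  · rintro ⟨h1, h2⟩
    by_contra h3
    have := h2 (h S v + 1) (by omega)
    omega
  · intro h'
    exact ⟨by omega, fun m hm => by omega⟩

theorem FOPred.eq_const (hg : FOFun 𝒞 g) (c : ℕ) : FOPred 𝒞 fun S v => g S v = c := by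
  induction c generalizing n with
  | zero => exact .eq hg .zero
  | succ c ih =>
    refine (FOPred.exLt (P := fun S v m => m = c ∧ g S v = m + 1) hg
      ((ih (.var _)).and (.eq_succ hg.weaken (.var _)))).congr fun S _ v _ => ?_
    constructor
    · rintro ⟨m, _, rfl, h⟩; exact h
    · intro h; exact ⟨c, by omega, rfl, h⟩

theorem FOPred.letter (P : Option A → Prop) (hg : FOFun 𝒞 g) :
    FOPred 𝒞 fun S v => P S.w[g S v]? := by
  classical
  refine .ex_eq (P := fun S v m => P S.w[m]?) hg ⟨.letter (fun o => decide (P o)) (Fin.last n), ?_⟩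
  intro S _ v _
  simp [Fml.Sat]

/-- Positions `h + k` beyond `N` do no harm, because the word ends before `N`. -/
theorem FOPred.letter_add (h𝒞 : ∀ S, 𝒞 S → S.Fits) (P : Option A → Prop) (hh : FOFun 𝒞 h)
    (hk : FOFun 𝒞 k) : FOPred 𝒞 fun S v => P S.w[h S v + k S v]? := by
  refine ((FOPred.ex (P := fun S v m => m = h S v + k S v ∧ P S.w[m]?)
    ((FOPred.eq_add (.var _) hh.weaken hk.weaken).and (.letter P (.var _)))).or
    ((FOPred.ex (P := fun S v m => m = h S v + k S v)
      (.eq_add (.var _) hh.weaken hk.weaken)).not.and (.prop (P none)))).congr fun S hS v hv => ?_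
  constructor
  · rintro (⟨m, hm, rfl, h⟩ | ⟨h1, h2⟩)
    · exact h
    · have : S.w.length ≤ h S v + k S v := by
        by_contra h3
        exact h1 ⟨_, (not_le.1 h3).le.trans (h𝒞 S hS), rfl⟩
      rwa [List.getElem?_eq_none this]
  · intro hP
    by_cases hle : h S v + k S v ≤ S.N
    · exact .inl ⟨_, hle, rfl, hP⟩
    · refine .inr ⟨?_, ?_⟩
      · rintro ⟨m, hm, rfl⟩
        exact hle hm
      · have : S.w.length ≤ h S v + k S v := (h𝒞 S hS).trans (not_le.1 hle).le
        rwa [List.getElem?_eq_none this] at hP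

theorem FOFun.app (s : Fin r) {g h : FOStr A r → (Fin n → ℕ) → ℕ}
    (hg : FOFun FOStr.IsFunctional g) (hh : FOFun FOStr.IsFunctional h) :
    FOFun FOStr.IsFunctional fun S v => S.f s (g S v) (h S v) := by
  refine ⟨fun S _ v _ => S.f_le _ _ _, ?_⟩
  refine .ex_eq (P := fun S v m => S.f s m (h S (Fin.init v)) = v (Fin.last n)) hg.weaken ?_
  refine .ex_eq (P := fun S v m => S.f s (v (Fin.last (n + 1))) m = v (Fin.last n).castSucc)
    hh.weaken.weaken ?_
  exact ⟨.rel s (Fin.last (n + 1)).castSucc (Fin.last (n + 2)) (Fin.last n).castSucc.castSucc,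
    fun S hS v hv => (hS.f_eq_iff s (hv _) (hv _) (hv _)).symm⟩

/-- That the relations are graphs of functions is expressible, so that functions can be guessed as
relations. -/
theorem foPred_isFunctional :
    FOPred FOStr.Fits fun (S : FOStr A r) (_ : Fin 0 → ℕ) => S.IsFunctional := by
  refine FOPred.congr (P := fun S _ => ∀ s, ∀ x ≤ S.N, ∀ y ≤ S.N, ∃ z ≤ S.N, S.X s x y z ∧
    ∀ z' ≤ S.N, S.X s x y z' → z' = z) ?_ fun S hS v _ => (and_iff_right hS).symm
  refine .forall_finite fun s => .all (.all (.ex (.and ?_ (.all (.imp ?_ ?_)))))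
  · exact ⟨.rel s 0 1 2, fun _ _ _ _ => Iff.rfl⟩
  · exact ⟨.rel s 0 1 3, fun _ _ _ _ => Iff.rfl⟩
  · exact .eq_var (n := 4) 3 2

end Definability

/-- A language is in `NEXPTIME` if its words are those for which, for some `N` not smaller than the
length of the word, a fixed first-order sentence holds in `{0, …, N}` for some choice of binary
functions on `{0, …, N}`, where `N` may be chosen exponential. -/
theorem mem_NEXPTIME_of_foPred [Finite A] {Φ : List A → ℕ → (Fin r → ℕ → ℕ → ℕ) → Prop}
    (hΦ : FOPred FOStr.IsFunctional fun S (_ : Fin 0 → ℕ) => Φ S.w S.N S.f) (L : Set (List A))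
    (q : Polynomial ℕ)
    (h₁ : ∀ w ∈ L, ∃ N ≤ 2 ^ q.eval w.length, w.length ≤ N ∧
      ∃ f : Fin r → ℕ → ℕ → ℕ, (∀ s x y, f s x y ≤ N) ∧ Φ w N f)
    (h₂ : ∀ w N f, w.length ≤ N → (∀ s x y, f s x y ≤ N) → Φ w N f → w ∈ L) : L ∈ NEXPTIME := by
  obtain ⟨φ, hφ⟩ := hΦ
  obtain ⟨ψ, hψ⟩ := foPred_isFunctional (A := A) (r := r)
  refine mem_NEXPTIME_of_sat (.and ψ φ) L q (fun w hw => ?_) fun w N X hN hs => ?_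
  · obtain ⟨N, hNq, hwN, f, hf, hΦ⟩ := h₁ w hw
    let S : FOStr A r := ⟨w, N, fun s x y z => f s x y = z⟩
    have hS : S.IsFunctional :=
      ⟨hwN, fun s x _ y _ => ⟨f s x y, hf s x y, rfl, fun z' _ h => h.symm⟩⟩
    have hSf : S.f = f := by
      funext s x y
      have hex : ∃ z ≤ N, f s x y = z := ⟨_, hf s x y, rfl⟩
      rw [FOStr.f, dif_pos (show ∃ z ≤ S.N, S.X s x y z from hex)]
      exact hex.choose_spec.2.symm
    refine ⟨N, hNq, hwN, S.X, (hψ S hwN _ fun i => i.elim0).2 hS,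
      (hφ S hS _ fun i => i.elim0).2 ?_⟩
    change Φ w N S.f
    rwa [hSf]
  · let S : FOStr A r := ⟨w, N, X⟩
    have hS : S.IsFunctional := (hψ S hN _ fun i => i.elim0).1 hs.1
    exact h₂ w N S.f hN S.f_le ((hφ S hS _ fun i => i.elim0).1 hs.2)

/-! ### Pairs of runs of add-free transducers -/

/-- The data of an add-free transducer with `k` registers and the transitions `0`, …, `T - 1`, whose
states and labels are natural numbers. -/
structure TransducerData where
  k : ℕ
  T : ℕ
  src : ℕ → ℕ
  lab : ℕ → ℕ
  out : ℕ → ℕ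
  olab : ℕ → ℕ
  tgt : ℕ → ℕ
  guard : ℕ → ℕ → Ordering
  /-- transition `t` stores the input value in register `i` -/
  new : ℕ → ℕ → Prop

/-- A configuration of two copies of a transducer that read the same input: the states, whether the
outputs have been different so far, and the registers of the first copy (with the indices
`0`, …, `k - 1`) and of the second copy (with the indices `k`, …, `2 k - 1`). -/
structure PairConf (α : Type*) where
  q₁ : ℕ
  q₂ : ℕ
  diff : Prop
  R : ℕ → α

/-- Apply a function to the values of all registers. -/
def PairConf.map {α β : Type*} (f : α → β) (c : PairConf α) : PairConf β :=
  ⟨c.q₁, c.q₂, c.diff, fun i => f (c.R i)⟩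

/-- The initial configuration with initial state `q₀` and the value `z` in all `K` registers. -/
def PairConf.IsInit {α : Type*} (K q₀ : ℕ) (z : α) (c : PairConf α) : Prop :=
  c.q₁ = q₀ ∧ c.q₂ = q₀ ∧ ¬ c.diff ∧ ∀ i < K, c.R i = z

namespace TransducerData

variable (P : TransducerData) {α β : Type*}

/-- The two copies can execute the transitions `t₁` and `t₂` on the data value `d`. -/
def Enabled [LinearOrder α] (c : PairConf α) (t₁ t₂ : ℕ) (d : α) : Prop :=
  P.src t₁ = c.q₁ ∧ P.src t₂ = c.q₂ ∧ P.lab t₁ = P.lab t₂ ∧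
    ∀ i < P.k, (P.guard t₁ i).Compares d (c.R i) ∧ (P.guard t₂ i).Compares d (c.R (P.k + i))

/-- Executing `t₁` and `t₂` on `d` leads from `c` to `c'`. -/
def Next (c : PairConf α) (t₁ t₂ : ℕ) (d : α) (c' : PairConf α) : Prop :=
  c'.q₁ = P.tgt t₁ ∧ c'.q₂ = P.tgt t₂ ∧
    (∀ i < P.k, ((P.new t₁ i → c'.R i = d) ∧ (¬ P.new t₁ i → c'.R i = c.R i)) ∧
      (P.new t₂ i → c'.R (P.k + i) = d) ∧ (¬ P.new t₂ i → c'.R (P.k + i) = c.R (P.k + i))) ∧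
    (c'.diff ↔ c.diff ∨ P.olab t₁ ≠ P.olab t₂ ∨ c'.R (P.out t₁) ≠ c'.R (P.k + P.out t₂))

/-- The configurations that are reachable on data values from the set `D`. -/
inductive Reach [LinearOrder α] (D : Set α) (q₀ : ℕ) (z : α) : PairConf α → Prop
  | init {c} (h : c.IsInit (P.k + P.k) q₀ z) : Reach D q₀ z c
  | step {c c' t₁ t₂ d} (hc : Reach D q₀ z c) (h₁ : t₁ < P.T) (h₂ : t₂ < P.T) (hd : d ∈ D)
      (he : P.Enabled c t₁ t₂ d) (hn : P.Next c t₁ t₂ d c') : Reach D q₀ z c'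

/-- Some input with data values from `D` has two outputs. -/
def Flagged [LinearOrder α] (D : Set α) (q₀ : ℕ) (z : α) : Prop :=
  ∃ c, P.Reach D q₀ z c ∧ c.diff

/-- All states are less than `n` and all output registers exist. -/
structure Bounded (n : ℕ) : Prop where
  tgt : ∀ t < P.T, P.tgt t < n
  out : ∀ t < P.T, P.out t < P.k

variable {P}

/-- A property of the registers that holds for the initial values and for all data values holds
for all reachable configurations. -/
theorem Next.forall {c c' : PairConf α} {t₁ t₂ : ℕ} {d : α} (h : P.Next c t₁ t₂ d c')
    {p : α → Prop} (hd : p d) (hc : ∀ i < P.k + P.k, p (c.R i)) :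
    ∀ i < P.k + P.k, p (c'.R i) := by
  intro i hi
  by_cases hik : i < P.k
  · have := (h.2.2.1 i hik).1
    by_cases hnew : P.new t₁ i
    · rw [this.1 hnew]; exact hd
    · rw [this.2 hnew]; exact hc i hi
  · obtain ⟨j, rfl⟩ := Nat.exists_eq_add_of_le (not_lt.1 hik)
    have := (h.2.2.1 j (by omega)).2
    by_cases hnew : P.new t₂ j
    · rw [this.1 hnew]; exact hd
    · rw [this.2 hnew]; exact hc _ hi

theorem Reach.forall [LinearOrder α] {D : Set α} {q₀ : ℕ} {z : α} {c : PairConf α}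
    (h : P.Reach D q₀ z c) {p : α → Prop} (hz : p z) (hD : ∀ d ∈ D, p d) :
    ∀ i < P.k + P.k, p (c.R i) := by
  induction h with
  | init h => exact fun i hi => by rw [h.2.2.2 i hi]; exact hz
  | step hc h₁ h₂ hd he hn ih => exact hn.forall (hD _ hd) ih

theorem Reach.lt [LinearOrder α] {D : Set α} {q₀ n : ℕ} {z : α} {c : PairConf α}
    (h : P.Reach D q₀ z c) (hP : P.Bounded n) (hq₀ : q₀ < n) : c.q₁ < n ∧ c.q₂ < n := by
  induction h with
  | init h => rw [h.1, h.2.1]; exact ⟨hq₀, hq₀⟩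
  | step hc h₁ h₂ hd he hn ih => rw [hn.1, hn.2.1]; exact ⟨hP.tgt _ h₁, hP.tgt _ h₂⟩

theorem Reach.mono [LinearOrder α] {D D' : Set α} {q₀ : ℕ} {z : α} {c : PairConf α}
    (h : P.Reach D q₀ z c) (hD : D ⊆ D') : P.Reach D' q₀ z c := by
  induction h with
  | init h => exact .init h
  | step hc h₁ h₂ hd he hn ih => exact .step ih h₁ h₂ (hD hd) he hn

theorem Reach.exists_finite [LinearOrder α] {D : Set α} {q₀ : ℕ} {z : α} {c : PairConf α}
    (h : P.Reach D q₀ z c) : ∃ F : Finset α, ↑F ⊆ D ∧ P.Reach (F : Set α) q₀ z c := by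
  induction h with
  | init h => exact ⟨∅, by simp, .init h⟩
  | @step c c' t₁ t₂ d hc h₁ h₂ hd he hn ih =>
    obtain ⟨F, hF, h⟩ := ih
    refine ⟨insert d F, ?_, .step (h.mono ?_) h₁ h₂ (by simp) he hn⟩
    · simp [Set.insert_subset_iff, hd, hF]
    · simp

theorem Reach.map [LinearOrder α] [LinearOrder β] {D : Set α} {q₀ n : ℕ} {z : α}
    {c : PairConf α} (h : P.Reach D q₀ z c) (hP : P.Bounded n) {f : α → β}
    (hf : StrictMonoOn f (insert z D)) : P.Reach (f '' D) q₀ (f z) (c.map f) := by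
  induction h with
  | init h => exact .init ⟨h.1, h.2.1, h.2.2.1, fun i hi => congrArg f (h.2.2.2 i hi)⟩
  | @step c c' t₁ t₂ d hc h₁ h₂ hd he hn ih =>
    have hD : ∀ {c}, P.Reach D q₀ z c → ∀ i < P.k + P.k, c.R i ∈ insert z D := fun hc =>
      hc.forall (Set.mem_insert _ _) fun d hd => Set.mem_insert_of_mem _ hd
    have hR := hD hc
    have hR' := hD (hc.step h₁ h₂ hd he hn)
    have hdD := Set.mem_insert_of_mem z hd
    refine .step ih h₁ h₂ (Set.mem_image_of_mem f hd) ⟨he.1, he.2.1, he.2.2.1, fun i hi => ?_⟩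
      ⟨hn.1, hn.2.1, fun i hi => ?_, ?_⟩
    · have := he.2.2.2 i hi
      exact ⟨(hf.compares hdD (hR _ (by omega))).2 this.1,
        (hf.compares hdD (hR _ (by omega))).2 this.2⟩
    · have := hn.2.2.1 i hi
      exact ⟨⟨fun h => congrArg f (this.1.1 h), fun h => congrArg f (this.1.2 h)⟩,
        fun h => congrArg f (this.2.1 h), fun h => congrArg f (this.2.2 h)⟩
    · have h1 := hP.out _ h₁
      have h2 := hP.out _ h₂
      refine hn.2.2.2.trans (or_congr Iff.rfl (or_congr Iff.rfl (not_congr ?_)))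
      exact (hf.injOn.eq_iff (hR' _ (by omega)) (hR' _ (by omega))).symm

/-- Whether an input with two outputs exists depends only on the finite suborders of the set of data
values together with the initial value. -/
theorem Flagged.transfer [LinearOrder α] [LinearOrder β] {D : Set α} {D' : Set β} {q₀ n : ℕ} {z : α}
    {z' : β} (hP : P.Bounded n) (hD : ∀ F : Finset α, ↑F ⊆ D → ∃ f : α → β,
      StrictMonoOn f (insert z (F : Set α)) ∧ f z = z' ∧ ∀ x ∈ F, f x ∈ D')
    (h : P.Flagged D q₀ z) : P.Flagged D' q₀ z' := by
  obtain ⟨c, hc, hdiff⟩ := h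
  obtain ⟨F, hF, hc⟩ := hc.exists_finite
  obtain ⟨f, hf, rfl, hfD⟩ := hD F hF
  refine ⟨c.map f, (hc.map hP hf).mono ?_, hdiff⟩
  rintro _ ⟨x, hx, rfl⟩
  exact hfD x hx

theorem exists_next (c : PairConf α) (t₁ t₂ : ℕ) (d : α) : ∃ c', P.Next c t₁ t₂ d c' := by
  classical
  let R : ℕ → α := fun i =>
    if i < P.k then if P.new t₁ i then d else c.R i
    else if P.new t₂ (i - P.k) then d else c.R i
  refine ⟨⟨P.tgt t₁, P.tgt t₂, c.diff ∨ P.olab t₁ ≠ P.olab t₂ ∨ R (P.out t₁) ≠ R (P.k + P.out t₂),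
    R⟩, rfl, rfl, fun i hi => ?_, Iff.rfl⟩
  have : ¬ P.k + i < P.k := by omega
  refine ⟨⟨fun h => ?_, fun h => ?_⟩, fun h => ?_, fun h => ?_⟩ <;> simp [R, hi, h]

end TransducerData

/-! ### Order types of register values -/

/-- The families `x` and `y` of length `K` have the same order type, relative to the constants: the
initial value `z` and, if `fin`, all smaller natural numbers. -/
def SameType {α β : Type*} [LE α] [NatCast α] [LE β] [NatCast β] (fin : Bool) (z K : ℕ)
    (x : ℕ → α) (y : ℕ → β) : Prop :=
  (∀ i < K, ∀ j < K, x i ≤ x j ↔ y i ≤ y j) ∧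
    ∀ i < K, ∀ c ≤ z, (fin = true ∨ c = z) →
      (x i ≤ (c : α) ↔ y i ≤ (c : β)) ∧ ((c : α) ≤ x i ↔ (c : β) ≤ y i)

/-- The element `a` has the same position relative to the family `x` and the constants as the element
`b` relative to `y`. -/
def SamePos {α β : Type*} [LE α] [NatCast α] [LE β] [NatCast β] (fin : Bool) (z K : ℕ)
    (x : ℕ → α) (a : α) (y : ℕ → β) (b : β) : Prop :=
  (∀ i < K, (x i ≤ a ↔ y i ≤ b) ∧ (a ≤ x i ↔ b ≤ y i)) ∧
    ∀ c ≤ z, (fin = true ∨ c = z) → (a ≤ (c : α) ↔ b ≤ (c : β)) ∧ ((c : α) ≤ a ↔ (c : β) ≤ b)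

theorem compares_congr {α β : Type*} [LinearOrder α] [LinearOrder β] {a x : α} {b y : β}
    (h₁ : x ≤ a ↔ y ≤ b) (h₂ : a ≤ x ↔ b ≤ y) (o : Ordering) : o.Compares a x ↔ o.Compares b y := by
  cases o
  · exact lt_iff_lt_of_le_iff_le h₁
  · rw [Ordering.compares_eq, Ordering.compares_eq, le_antisymm_iff, le_antisymm_iff, h₁, h₂]
  · exact lt_iff_lt_of_le_iff_le h₂

section OrderTypes

variable {α β γ : Type*} [LinearOrder α] [NatCast α] [LinearOrder β] [NatCast β] [LinearOrder γ]
  [NatCast γ] {fin : Bool} {z K : ℕ}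

theorem SameType.symm {x : ℕ → α} {y : ℕ → β} (h : SameType fin z K x y) :
    SameType fin z K y x :=
  ⟨fun i hi j hj => (h.1 i hi j hj).symm,
    fun i hi c hc hf => ⟨(h.2 i hi c hc hf).1.symm, (h.2 i hi c hc hf).2.symm⟩⟩

theorem SameType.trans {x : ℕ → α} {y : ℕ → β} {u : ℕ → γ} (h : SameType fin z K x y)
    (h' : SameType fin z K y u) : SameType fin z K x u :=
  ⟨fun i hi j hj => (h.1 i hi j hj).trans (h'.1 i hi j hj), fun i hi c hc hf =>
    ⟨(h.2 i hi c hc hf).1.trans (h'.2 i hi c hc hf).1,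
      (h.2 i hi c hc hf).2.trans (h'.2 i hi c hc hf).2⟩⟩

variable {P : TransducerData}

/-- Similar configurations: they differ in the register values only, and these have the same order
type. -/
def PairConf.Similar (fin : Bool) (z K : ℕ) (c : PairConf α) (c' : PairConf β) : Prop :=
  c.q₁ = c'.q₁ ∧ c.q₂ = c'.q₂ ∧ (c.diff ↔ c'.diff) ∧ SameType fin z K c.R c'.R

theorem PairConf.Similar.symm {c : PairConf α} {c' : PairConf β} (h : PairConf.Similar fin z K c c') :
    PairConf.Similar fin z K c' c := ⟨h.1.symm, h.2.1.symm, h.2.2.1.symm, h.2.2.2.symm⟩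

theorem PairConf.Similar.trans {c : PairConf α} {c' : PairConf β} {c'' : PairConf γ}
    (h : PairConf.Similar fin z K c c') (h' : PairConf.Similar fin z K c' c'') :
    PairConf.Similar fin z K c c'' :=
  ⟨h.1.trans h'.1, h.2.1.trans h'.2.1, h.2.2.1.trans h'.2.2.1, h.2.2.2.trans h'.2.2.2⟩

theorem PairConf.Similar.enabled {c : PairConf α} {c' : PairConf β}
    (h : PairConf.Similar fin z (P.k + P.k) c c') {t₁ t₂ : ℕ} {a : α} {b : β}
    (hab : SamePos fin z (P.k + P.k) c.R a c'.R b) (he : P.Enabled c t₁ t₂ a) :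
    P.Enabled c' t₁ t₂ b := by
  refine ⟨h.1 ▸ he.1, h.2.1 ▸ he.2.1, he.2.2.1, fun i hi => ?_⟩
  have := he.2.2.2 i hi
  have h1 := hab.1 i (by omega)
  have h2 := hab.1 (P.k + i) (by omega)
  exact ⟨(compares_congr h1.1 h1.2 _).1 this.1, (compares_congr h2.1 h2.2 _).1 this.2⟩

/-- Similar configurations remain similar after the same transitions on data values in the same
position. -/
theorem PairConf.Similar.next {n : ℕ} (hP : P.Bounded n) {c c₁ : PairConf α} {c' c₁' : PairConf β}
    (h : PairConf.Similar fin z (P.k + P.k) c c') {t₁ t₂ : ℕ} (h₁ : t₁ < P.T) (h₂ : t₂ < P.T)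
    {a : α} {b : β}
    (hab : SamePos fin z (P.k + P.k) c.R a c'.R b) (hn : P.Next c t₁ t₂ a c₁)
    (hn' : P.Next c' t₁ t₂ b c₁') : PairConf.Similar fin z (P.k + P.k) c₁ c₁' := by
  have key : ∀ i < P.k + P.k, (c₁.R i = a ∧ c₁'.R i = b) ∨
      ∃ j < P.k + P.k, c₁.R i = c.R j ∧ c₁'.R i = c'.R j := by
    intro i hi
    by_cases hik : i < P.k
    · have e := (hn.2.2.1 i hik).1
      have e' := (hn'.2.2.1 i hik).1
      by_cases hnew : P.new t₁ i
      · exact .inl ⟨e.1 hnew, e'.1 hnew⟩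
      · exact .inr ⟨i, hi, e.2 hnew, e'.2 hnew⟩
    · obtain ⟨j, rfl⟩ := Nat.exists_eq_add_of_le (not_lt.1 hik)
      have e := (hn.2.2.1 j (by omega)).2
      have e' := (hn'.2.2.1 j (by omega)).2
      by_cases hnew : P.new t₂ j
      · exact .inl ⟨e.1 hnew, e'.1 hnew⟩
      · exact .inr ⟨_, hi, e.2 hnew, e'.2 hnew⟩
  have hT : SameType fin z (P.k + P.k) c₁.R c₁'.R := by
    refine ⟨fun i hi j hj => ?_, fun i hi l hl hf => ?_⟩
    · rcases key i hi with ⟨e1, e2⟩ | ⟨i', hi', e1, e2⟩ <;>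
        rcases key j hj with ⟨e3, e4⟩ | ⟨j', hj', e3, e4⟩ <;> rw [e1, e2, e3, e4]
      · simp
      · exact (hab.1 j' hj').2
      · exact (hab.1 i' hi').1
      · exact h.2.2.2.1 i' hi' j' hj'
    · rcases key i hi with ⟨e1, e2⟩ | ⟨i', hi', e1, e2⟩ <;> rw [e1, e2]
      · exact hab.2 l hl hf
      · exact h.2.2.2.2 i' hi' l hl hf
  refine ⟨hn.1.trans hn'.1.symm, hn.2.1.trans hn'.2.1.symm, ?_, hT⟩
  have o1 := hP.out _ h₁
  have o2 := hP.out _ h₂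
  rw [hn.2.2.2, hn'.2.2.2, h.2.2.1, Ne.eq_def (c₁.R _), Ne.eq_def (c₁'.R _),
    le_antisymm_iff (a := c₁.R _), le_antisymm_iff (a := c₁'.R _),
    hT.1 _ (by omega) _ (by omega), hT.1 _ (by omega) _ (by omega)]

end OrderTypes

/-- The order-theoretic core of the extension of similarities: an element `a` above `X i₀` that is
different from all members of the finite family `X` has a counterpart for an order-isomorphic
family `Y`, provided that there is room immediately above every member of `Y` from `Y i₀` on. -/
theorem exists_samePos_core {α β ι : Type*} [LinearOrder α] [LinearOrder β] (s : Finset ι)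
    {X : ι → α} {Y : ι → β} (hXY : ∀ i ∈ s, ∀ j ∈ s, X i ≤ X j ↔ Y i ≤ Y j) {i₀ : ι} (hi₀ : i₀ ∈ s)
    {a : α} (ha₀ : X i₀ < a) (ha : ∀ i ∈ s, X i ≠ a) (U : Set β)
    (hU : ∀ i ∈ s, Y i₀ ≤ Y i → ∃ u ∈ U, Y i < u ∧ ∀ j ∈ s, Y i < Y j → u < Y j) :
    ∃ u ∈ U, ∀ j ∈ s, (X j ≤ a ↔ Y j ≤ u) ∧ (a ≤ X j ↔ u ≤ Y j) := by
  classical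
  obtain ⟨i, hi, hmax⟩ := (s.filter fun i => X i < a).exists_max_image X ⟨i₀, by simp [hi₀, ha₀]⟩
  simp only [Finset.mem_filter, and_imp] at hi hmax
  obtain ⟨u, huU, hu, hu'⟩ := hU i hi.1 ((hXY _ hi₀ _ hi.1).1 (hmax _ hi₀ ha₀))
  refine ⟨u, huU, fun j hj => ?_⟩
  rcases lt_or_gt_of_ne (ha j hj) with h | h
  · have h1 : Y j < u := ((hXY _ hj _ hi.1).1 (hmax j hj h)).trans_lt hu
    simp [h.le, h1.le, h.not_ge, h1.not_ge]
  · have h1 : u < Y j := by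
      refine hu' j hj (not_le.1 fun h2 => ?_)
      exact absurd ((hXY _ hj _ hi.1).2 h2) (not_le.2 (hi.2.trans h))
    simp [h.le, h1.le, h.not_ge, h1.not_ge]

/-- The data values of the dense model: all rational numbers or, if `fin`, those that are at least
`z` or natural numbers. -/
def Admissible (fin : Bool) (z : ℕ) : Set ℚ := {q | fin = true → q < z → ∃ c : ℕ, q = c}

theorem natCast_mem_admissible (fin : Bool) (z c : ℕ) : (c : ℚ) ∈ Admissible fin z :=
  fun _ _ => ⟨c, rfl⟩

/-- There is room for a data value from `U` immediately above every register value that is at least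
`z` and, unless `fin`, immediately below every register value that is at most `z`. (If `fin`, the
data values below `z` are constants, and no room is needed there.) -/
def Room {α : Type*} [LT α] [LE α] [NatCast α] (fin : Bool) (z K : ℕ) (U : α → Prop) (y : ℕ → α) :
    Prop :=
  ((∃ u, U u ∧ (z : α) < u ∧ ∀ j < K, (z : α) < y j → u < y j) ∧
    ∀ i < K, (z : α) ≤ y i → ∃ u, U u ∧ y i < u ∧ ∀ j < K, y i < y j → u < y j) ∧
  (fin = false → (∃ u, U u ∧ u < (z : α) ∧ ∀ j < K, y j < (z : α) → y j < u) ∧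
    ∀ i < K, y i ≤ (z : α) → ∃ u, U u ∧ u < y i ∧ ∀ j < K, y j < y i → y j < u)

/-- A data value on the one side has a counterpart on the other side, if there is room. -/
theorem exists_samePos {α β : Type*} [Semiring α] [LinearOrder α] [IsStrictOrderedRing α]
    [Semiring β] [LinearOrder β] [IsStrictOrderedRing β] {fin : Bool} {z K : ℕ} {x : ℕ → α}
    {y : ℕ → β} (h : SameType fin z K x y) {U : β → Prop} (hroom : Room fin z K U y)
    (hy : ∀ i < K, U (y i)) (hU : ∀ c ≤ z, U (c : β)) {a : α}
    (ha : fin = true → a < z → ∃ c : ℕ, a = c) : ∃ b, U b ∧ SamePos fin z K x a y b := by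
  classical
  -- the trivial cases: `a` is a register value or a constant
  by_cases hx : ∃ i < K, x i = a
  · obtain ⟨i, hi, rfl⟩ := hx
    exact ⟨y i, hy i hi, fun j hj => ⟨h.1 j hj i hi, h.1 i hi j hj⟩, fun c hc hf => h.2 i hi c hc hf⟩
  by_cases hcon : ∃ c ≤ z, (fin = true ∨ c = z) ∧ (c : α) = a
  · obtain ⟨c, hc, hf, rfl⟩ := hcon
    exact ⟨c, hU c hc, fun j hj => h.2 j hj c hc hf, fun c' _ _ => by simp [Nat.cast_le]⟩
  push Not at hx
  let X : Option ℕ → α := fun o => o.elim (z : α) x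
  let Y : Option ℕ → β := fun o => o.elim (z : β) y
  let s : Finset (Option ℕ) := insert none ((Finset.range K).image some)
  have hs : ∀ {p : Option ℕ → Prop}, (∀ o ∈ s, p o) ↔ p none ∧ ∀ i < K, p (some i) := by
    intro p
    simp [s]
  have hz := fun i hi => h.2 i hi z le_rfl (.inr rfl)
  have hXY : ∀ i ∈ s, ∀ j ∈ s, X i ≤ X j ↔ Y i ≤ Y j := by
    simp only [hs]
    exact ⟨⟨by simp [X, Y], fun i hi => (hz i hi).2⟩, fun i hi => ⟨(hz i hi).1, h.1 i hi⟩⟩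
  have hne : ∀ i ∈ s, X i ≠ a := by
    rw [hs]
    exact ⟨fun h => hcon ⟨z, le_rfl, .inr rfl, h⟩, hx⟩
  have hnone : none ∈ s := by simp [s]
  rcases lt_or_gt_of_ne (hne none hnone) with hza | hza
  · obtain ⟨u, huU, hu⟩ := exists_samePos_core s hXY hnone hza hne {u | U u} (by
      rw [hs]
      refine ⟨fun _ => ?_, fun i hi hle => ?_⟩
      · obtain ⟨u, hu, h1, h2⟩ := hroom.1.1
        exact ⟨u, hu, h1, hs.2 ⟨fun h => absurd h (lt_irrefl _), h2⟩⟩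
      · obtain ⟨u, hu, h1, h2⟩ := hroom.1.2 i hi hle
        exact ⟨u, hu, h1, hs.2 ⟨fun h => absurd h (not_lt.2 hle), h2⟩⟩)
    rw [hs] at hu
    have hzu : (z : β) < u := not_le.1 fun h => absurd (hu.1.2.2 h) (not_le.2 hza)
    refine ⟨u, huU, hu.2, fun c hc _ => ?_⟩
    have h1 : (c : α) < a := lt_of_le_of_lt (Nat.cast_le.2 hc) hza
    have h2 : (c : β) < u := lt_of_le_of_lt (Nat.cast_le.2 hc) hzu
    simp [h1.le, h2.le, h1.not_ge, h2.not_ge]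
  · have hfin : fin = false := by
      by_contra hfin
      have hfin : fin = true := by simpa using hfin
      obtain ⟨c, rfl⟩ := ha hfin hza
      exact hcon ⟨c, by exact_mod_cast (show (c : α) < z from hza).le, .inl hfin, rfl⟩
    obtain ⟨u, huU, hu⟩ := exists_samePos_core (α := αᵒᵈ) (β := βᵒᵈ) s (X := X) (Y := Y)
      (fun i hi j hj => hXY j hj i hi) hnone hza hne {u | U u} (by
      rw [hs]
      refine ⟨fun _ => ?_, fun i hi hle => ?_⟩
      · obtain ⟨u, hu, h1, h2⟩ := (hroom.2 hfin).1
        exact ⟨u, hu, h1, hs.2 ⟨fun h => absurd h (lt_irrefl _), h2⟩⟩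
      · obtain ⟨u, hu, h1, h2⟩ := (hroom.2 hfin).2 i hi hle
        exact ⟨u, hu, h1, hs.2 ⟨fun h => absurd h (not_lt.2 hle), h2⟩⟩)
    rw [hs] at hu
    refine ⟨u, huU, fun i hi => ⟨(hu.2 i hi).2, (hu.2 i hi).1⟩, fun c hc hf => ?_⟩
    obtain rfl : c = z := by simpa [hfin] using hf
    exact ⟨hu.1.1, hu.1.2⟩

/-- The dense model has room for further data values everywhere. -/
theorem room_admissible (fin : Bool) (z K : ℕ) (y : ℕ → ℚ) :
    Room fin z K (· ∈ Admissible fin z) y := by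
  classical
  have up : ∀ p : ℚ, (z : ℚ) ≤ p →
      ∃ u, u ∈ Admissible fin z ∧ p < u ∧ ∀ j < K, p < y j → u < y j := by
    intro p hp
    obtain ⟨u, h1, h2⟩ := Order.exists_between_finsets {p}
      (((Finset.range K).image y).filter fun q => p < q) (by simp)
    simp only [Finset.mem_singleton, forall_eq, Finset.mem_filter, Finset.mem_image,
      Finset.mem_range, and_imp, forall_exists_index, forall_apply_eq_imp_iff₂] at h1 h2
    exact ⟨u, fun _ h => absurd h (not_lt.2 (hp.trans h1.le)), h1, h2⟩
  have down : fin = false → ∀ p : ℚ,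
      ∃ u, u ∈ Admissible fin z ∧ u < p ∧ ∀ j < K, y j < p → y j < u := by
    intro hfin p
    obtain ⟨u, h1, h2⟩ := Order.exists_between_finsets
      (((Finset.range K).image y).filter fun q => q < p) {p} (by simp)
    simp only [Finset.mem_singleton, forall_eq, Finset.mem_filter, Finset.mem_image,
      Finset.mem_range, and_imp, forall_exists_index, forall_apply_eq_imp_iff₂] at h1 h2
    exact ⟨u, fun h => by simp [hfin] at h, h2, h1⟩
  exact ⟨⟨up _ le_rfl, fun i _ h => up _ h⟩, fun hfin => ⟨down hfin _, fun i _ _ => down hfin _⟩⟩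


/-- A family of natural numbers has room for further values if its distances from `z` are even. -/
theorem room_of_even {fin : Bool} {z K : ℕ} {r : ℕ → ℕ}
    (h₁ : ∀ j < K, z ≤ r j → ∃ e ≤ K, r j = z + 2 * e)
    (h₂ : fin = false → 2 * K < z ∧ ∀ j < K, r j ≤ z → ∃ e ≤ K, r j + 2 * e = z) :
    Room fin z K (· ≤ z + 2 * K + 1) r := by
  simp only [Room, Nat.cast_id]
  refine ⟨⟨⟨z + 1, by omega, by omega, fun j hj h => ?_⟩, fun i hi h =>
    ⟨r i + 1, ?_, by omega, fun j hj h' => ?_⟩⟩, fun hfin => ?_⟩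
  · obtain ⟨e, _, he⟩ := h₁ j hj h.le
    omega
  · obtain ⟨e, _, he⟩ := h₁ i hi h
    omega
  · obtain ⟨e, _, he⟩ := h₁ i hi h
    obtain ⟨e', _, he'⟩ := h₁ j hj (h.trans h'.le)
    omega
  · obtain ⟨hz, h₂⟩ := h₂ hfin
    refine ⟨⟨z - 1, by omega, by omega, fun j hj h => ?_⟩, fun i hi h =>
      ⟨r i - 1, by omega, ?_, fun j hj h' => ?_⟩⟩
    · obtain ⟨e, _, he⟩ := h₂ j hj h.le
      omega
    · obtain ⟨e, _, he⟩ := h₂ i hi h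
      omega
    · obtain ⟨e, _, he⟩ := h₂ i hi h
      obtain ⟨e', _, he'⟩ := h₂ j hj (h'.le.trans h)
      omega

/-- Register values can be replaced by small natural numbers that have room. A value is replaced by its
rank above or below `z`, doubled. -/
theorem exists_sameType_room {fin : Bool} {z K : ℕ} {x : ℕ → ℚ}
    (hx : ∀ i < K, x i ∈ Admissible fin z) (hz : fin = false → 2 * K < z) :
    ∃ r : ℕ → ℕ, SameType fin z K x r ∧ Room fin z K (· ≤ z + 2 * K + 1) r ∧
      ∀ i < K, r i ≤ z + 2 * K + 1 := by
  classical
  -- the registers with values between `z` and `x i`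
  let A : ℕ → Finset ℕ := fun i => (Finset.range K).filter fun j => (z : ℚ) < x j ∧ x j ≤ x i
  let B : ℕ → Finset ℕ := fun i => (Finset.range K).filter fun j => x j < (z : ℚ) ∧ x i ≤ x j
  have hAK : ∀ i, (A i).card ≤ K := fun i =>
    (Finset.card_filter_le _ _).trans (Finset.card_range K).le
  have hBK : ∀ i, (B i).card ≤ K := fun i =>
    (Finset.card_filter_le _ _).trans (Finset.card_range K).le
  have hA : ∀ i j, x i ≤ x j → (A i).card ≤ (A j).card := fun i j h =>
    Finset.card_le_card fun l hl => by
      simp only [A, Finset.mem_filter] at hl ⊢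
      exact ⟨hl.1, hl.2.1, hl.2.2.trans h⟩
  have hB : ∀ i j, x i ≤ x j → (B j).card ≤ (B i).card := fun i j h =>
    Finset.card_le_card fun l hl => by
      simp only [B, Finset.mem_filter] at hl ⊢
      exact ⟨hl.1, hl.2.1, h.trans hl.2.2⟩
  have hA' : ∀ i, ∀ j < K, x i < x j → (z : ℚ) < x j → (A i).card < (A j).card := by
    intro i j hj h h'
    refine Finset.card_lt_card ⟨fun l hl => ?_, fun hs => ?_⟩
    · simp only [A, Finset.mem_filter] at hl ⊢
      exact ⟨hl.1, hl.2.1, hl.2.2.trans h.le⟩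
    · have := @hs j (by simp [A, hj, h'])
      simp only [A, Finset.mem_filter] at this
      exact absurd this.2.2 (not_le.2 h)
  have hB' : ∀ i < K, ∀ j, x i < x j → x i < (z : ℚ) → (B j).card < (B i).card := by
    intro i hi j h h'
    refine Finset.card_lt_card ⟨fun l hl => ?_, fun hs => ?_⟩
    · simp only [B, Finset.mem_filter] at hl ⊢
      exact ⟨hl.1, hl.2.1, h.le.trans hl.2.2⟩
    · have := @hs i (by simp [B, hi, h'])
      simp only [B, Finset.mem_filter] at this
      exact absurd this.2.2 (not_le.2 h)
  have hA0 : ∀ i, x i ≤ z → (A i).card = 0 := fun i h =>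
    Finset.card_eq_zero.2 (Finset.filter_eq_empty_iff.2 fun j _ h' =>
      absurd (h'.1.trans_le h'.2) (not_lt.2 h))
  have hB0 : ∀ i, z ≤ x i → (B i).card = 0 := fun i h =>
    Finset.card_eq_zero.2 (Finset.filter_eq_empty_iff.2 fun j _ h' =>
      absurd (h'.2.trans_lt h'.1) (not_lt.2 h))
  have hA1 : ∀ i < K, (z : ℚ) < x i → 0 < (A i).card := fun i hi h =>
    Finset.card_pos.2 ⟨i, by simp [A, hi, h]⟩
  have hB1 : ∀ i < K, x i < (z : ℚ) → 0 < (B i).card := fun i hi h =>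
    Finset.card_pos.2 ⟨i, by simp [B, hi, h]⟩
  cases fin
  · have hz := hz rfl
    let r : ℕ → ℕ := fun i => z + 2 * (A i).card - 2 * (B i).card
    have hr : ∀ i, r i + 2 * (B i).card = z + 2 * (A i).card := fun i => by
      have := hBK i
      simp only [r]
      omega
    have hlt : ∀ i < K, ∀ j < K, x i < x j → r i < r j := by
      intro i hi j hj h
      have h1 := hr i
      have h2 := hr j
      have h3 := hA i j h.le
      have h4 := hB i j h.le
      rcases lt_or_ge (z : ℚ) (x j) with h' | h'
      · have := hA' i j hj h h'
        omega
      · have := hB' i hi j h (h.trans_le h')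
        omega
    have hle : ∀ i j, x i ≤ x j → r i ≤ r j := by
      intro i j h
      have h1 := hr i
      have h2 := hr j
      have h3 := hA i j h
      have h4 := hB i j h
      omega
    have hzr : ∀ i < K, (x i ≤ z ↔ r i ≤ z) ∧ (z ≤ x i ↔ z ≤ r i) := by
      intro i hi
      have h1 := hr i
      rcases lt_trichotomy (x i) z with h | h | h
      · have h2 := hA0 i h.le
        have h3 := hB1 i hi h
        exact ⟨iff_of_true h.le (by omega), iff_of_false h.not_ge (by omega)⟩
      · have h2 := hA0 i h.le
        have h3 := hB0 i h.ge
        exact ⟨iff_of_true h.le (by omega), iff_of_true h.ge (by omega)⟩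
      · have h2 := hA1 i hi h
        have h3 := hB0 i h.le
        exact ⟨iff_of_false h.not_ge (by omega), iff_of_true h.le (by omega)⟩
    refine ⟨r, ⟨fun i hi j hj => ⟨hle i j, fun h => ?_⟩, fun i hi c _ hf => ?_⟩,
      room_of_even (fun j hj h => ?_) fun _ => ⟨hz, fun j hj h => ?_⟩, fun i hi => ?_⟩
    · by_contra h'
      exact absurd (hlt j hj i hi (not_le.1 h')) (not_lt.2 h)
    · obtain rfl : c = z := by simpa using hf
      exact hzr i hi
    · have h1 := hr j
      have h2 := hB0 j ((hzr j hj).2.2 h)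
      exact ⟨_, hAK j, by omega⟩
    · have h1 := hr j
      have h2 := hA0 j ((hzr j hj).1.2 h)
      exact ⟨_, hBK j, by omega⟩
    · have h1 := hr i
      have h2 := hAK i
      omega
  · let r : ℕ → ℕ := fun i => if x i < z then ⌊x i⌋₊ else z + 2 * (A i).card
    have hr₁ : ∀ i < K, x i < z → (r i : ℚ) = x i := by
      intro i hi h
      obtain ⟨c, hc⟩ := hx i hi rfl h
      simp only [r, if_pos h]
      rw [hc, Nat.floor_natCast]
    have hr₂ : ∀ i, z ≤ x i → r i = z + 2 * (A i).card := fun i h => if_neg (not_lt.2 h)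
    have hc : ∀ i < K, ∀ c ≤ z, (x i ≤ c ↔ r i ≤ c) ∧ (c ≤ x i ↔ c ≤ r i) := by
      intro i hi c hc
      rcases lt_or_ge (x i) z with h | h
      · rw [← hr₁ i hi h]
        exact ⟨Nat.cast_le, Nat.cast_le⟩
      · have h1 := hr₂ i h
        refine ⟨?_, iff_of_true (le_trans (by exact_mod_cast hc) h) (by omega)⟩
        rcases hc.lt_or_eq with hc | rfl
        · exact iff_of_false (not_le.2 (lt_of_lt_of_le (by exact_mod_cast hc) h)) (by omega)
        · rcases h.lt_or_eq with h | h
          · have := hA1 i hi h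
            exact iff_of_false (not_le.2 h) (by omega)
          · have := hA0 i h.ge
            exact iff_of_true h.ge (by omega)
    have hlt : ∀ i < K, ∀ j < K, x i < x j → r i < r j := by
      intro i hi j hj h
      rcases lt_or_ge (x j) z with h1 | h1
      · have : (r i : ℚ) < r j := by rwa [hr₁ i hi (h.trans h1), hr₁ j hj h1]
        exact_mod_cast this
      · rcases lt_or_ge (x i) z with h2 | h2
        · have h3 := not_le.1 (mt (hc i hi z le_rfl).2.2 (not_le.2 h2))
          have := hr₂ j h1
          omega
        · have := hA' i j hj h (h2.trans_lt h)
          have := hr₂ j h1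
          have := hr₂ i h2
          omega
    have heq : ∀ i j, x i = x j → r i = r j := by
      intro i j h
      simp only [r, A, h]
    refine ⟨r, ⟨fun i hi j hj => ⟨fun h => ?_, fun h => ?_⟩, fun i hi c h _ => hc i hi c h⟩,
      room_of_even (fun j hj h => ⟨_, hAK j, hr₂ j ((hc j hj z le_rfl).2.2 h)⟩) (by simp),
      fun i hi => ?_⟩
    · rcases h.lt_or_eq with h | h
      · exact (hlt i hi j hj h).le
      · exact (heq i j h).le
    · by_contra h'
      exact absurd (hlt j hj i hi (not_le.1 h')) (not_lt.2 h)
    · rcases le_total (x i) z with h | h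
      · have := (hc i hi z le_rfl).1.1 h
        omega
      · have := hr₂ i h
        have := hAK i
        omega

/-! ### Certificates -/

theorem PairConf.IsInit.similar {α β : Type*} [LinearOrder α] [NatCast α] [LinearOrder β] [NatCast β]
    (hα : ∀ a b : ℕ, (a : α) ≤ b ↔ a ≤ b) (hβ : ∀ a b : ℕ, (a : β) ≤ b ↔ a ≤ b) {fin : Bool}
    {K q₀ z : ℕ} {c : PairConf α} {c' : PairConf β} (h : c.IsInit K q₀ (z : α))
    (h' : c'.IsInit K q₀ (z : β)) : c.Similar fin z K c' := by
  refine ⟨h.1.trans h'.1.symm, h.2.1.trans h'.2.1.symm, iff_of_false h.2.2.1 h'.2.2.1,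
    fun i hi j hj => ?_, fun i hi l _ _ => ?_⟩
  · simp [h.2.2.2, h'.2.2.2, hi, hj]
  · simp [h.2.2.2, h'.2.2.2, hi, hα, hβ]

/-- The configurations with states less than `n` and register values up to `H`. -/
abbrev SmallConf (n K H : ℕ) : Type := Fin n × Fin n × Bool × (Fin K → Fin (H + 1))

/-- Registers with an index from `K` on do not matter and get the value `0`. -/
def SmallConf.toConf {n K H : ℕ} (a : SmallConf n K H) : PairConf ℕ :=
  ⟨a.1, a.2.1, a.2.2.1 = true, fun i => if h : i < K then a.2.2.2 ⟨i, h⟩ else 0⟩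

theorem SmallConf.toConf_lt {n K H : ℕ} (a : SmallConf n K H) :
    a.toConf.q₁ < n ∧ a.toConf.q₂ < n ∧ ∀ i, a.toConf.R i ≤ H := by
  refine ⟨a.1.2, a.2.1.2, fun i => ?_⟩
  simp only [toConf]
  split_ifs with h
  · exact Nat.le_of_lt_succ (a.2.2.2 _).2
  · exact Nat.zero_le _

theorem exists_toConf {n K H : ℕ} {c : PairConf ℕ} (h₁ : c.q₁ < n) (h₂ : c.q₂ < n)
    (hR : ∀ i < K, c.R i ≤ H) : ∃ a : SmallConf n K H, a.toConf.q₁ = c.q₁ ∧ a.toConf.q₂ = c.q₂ ∧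
      (a.toConf.diff ↔ c.diff) ∧ ∀ i < K, a.toConf.R i = c.R i := by
  classical
  refine ⟨⟨⟨_, h₁⟩, ⟨_, h₂⟩, decide c.diff, fun i => ⟨c.R i, Nat.lt_succ_of_le (hR i i.2)⟩⟩,
    rfl, rfl, by simp [SmallConf.toConf], fun i hi => by simp [SmallConf.toConf, hi]⟩

namespace TransducerData

variable (P : TransducerData)

/-- A certificate for the absence of inputs with two outputs: the configurations `C 0`, …, `C N` with
register values up to `H` include an initial one, are closed under transitions on data values up
to `H`, and each of them is similar to one that has room. -/
structure ClosedFamily (fin : Bool) (q₀ z H N K : ℕ) (C : ℕ → PairConf ℕ) : Prop where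
  z_le : z ≤ H
  init : ∃ j ≤ N, (C j).IsInit K q₀ z
  le : ∀ j ≤ N, ∀ i < K, (C j).R i ≤ H
  not_diff : ∀ j ≤ N, ¬ (C j).diff
  step : ∀ j ≤ N, ∀ t₁ < P.T, ∀ t₂ < P.T, ∀ d ≤ H, P.Enabled (C j) t₁ t₂ d →
    ∃ j' ≤ N, P.Next (C j) t₁ t₂ d (C j')
  room : ∀ j ≤ N, ∃ j' ≤ N, (C j).Similar fin z K (C j') ∧
    Room fin z K (· ≤ H) (C j').R

/-- A certificate for the existence of an input with two outputs: each of the configurations `C 0`, …,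
`C N` is initial, or is similar to an earlier one, or is obtained from an earlier one by
transitions. -/
structure Derivation (fin : Bool) (q₀ z N K : ℕ) (C : ℕ → PairConf ℕ) : Prop where
  derived : ∀ j ≤ N, (C j).IsInit K q₀ z ∨ ∃ j' < j, (C j').Similar fin z K (C j) ∨
    ∃ t₁ < P.T, ∃ t₂ < P.T, ∃ d ≤ N, P.Enabled (C j') t₁ t₂ d ∧ P.Next (C j') t₁ t₂ d (C j)
  diff : ∃ j ≤ N, (C j).diff

variable {P}

/-- Every reachable configuration over the dense model is similar to a member of the family. -/
theorem ClosedFamily.not_flagged {fin : Bool} {q₀ n z H N : ℕ} {C : ℕ → PairConf ℕ}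
    (h : P.ClosedFamily fin q₀ z H N (P.k + P.k) C) (hP : P.Bounded n) :
    ¬ P.Flagged (Admissible fin z) q₀ (z : ℚ) := by
  have key : ∀ c, P.Reach (Admissible fin z) q₀ (z : ℚ) c → ∃ j ≤ N,
      c.Similar fin z (P.k + P.k) (C j) ∧ Room fin z (P.k + P.k) (· ≤ H) (C j).R := by
    intro c hc
    induction hc with
    | init hc =>
      obtain ⟨j, hj, hinit⟩ := h.init
      obtain ⟨j', hj', hs, hr⟩ := h.room j hj
      exact ⟨j', hj', (hc.similar (by simp) (by simp) hinit).trans hs, hr⟩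
    | step hc h₁ h₂ hd he hn ih =>
      obtain ⟨j, hj, hs, hr⟩ := ih
      obtain ⟨b, hb, hab⟩ := exists_samePos hs.2.2.2 hr (h.le j hj)
        (fun c hc => (show c ≤ H from hc.trans h.z_le)) hd
      obtain ⟨j', hj', hn'⟩ := h.step j hj _ h₁ _ h₂ b hb (hs.enabled hab he)
      obtain ⟨j'', hj'', hs', hr'⟩ := h.room j' hj'
      exact ⟨j'', hj'', (hs.next hP h₁ h₂ hab hn hn').trans hs', hr'⟩
  rintro ⟨c, hc, hdiff⟩
  obtain ⟨j, hj, hs, _⟩ := key c hc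
  exact h.not_diff j hj (hs.2.2.1.1 hdiff)

/-- Every derived configuration is similar to a reachable one over the dense model. -/
theorem Derivation.flagged {fin : Bool} {q₀ n z N : ℕ} {C : ℕ → PairConf ℕ}
    (h : P.Derivation fin q₀ z N (P.k + P.k) C) (hP : P.Bounded n) :
    P.Flagged (Admissible fin z) q₀ (z : ℚ) := by
  have key : ∀ j ≤ N, ∃ c, P.Reach (Admissible fin z) q₀ (z : ℚ) c ∧
      (C j).Similar fin z (P.k + P.k) c := by
    intro j
    induction j using Nat.strong_induction_on with
    | _ j ih =>
      intro hj
      rcases h.derived j hj with hinit | ⟨j', hj', hs | ⟨t₁, h₁, t₂, h₂, d, -, he, hn⟩⟩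
      · let c : PairConf ℚ := ⟨q₀, q₀, False, fun _ => z⟩
        have hc : c.IsInit (P.k + P.k) q₀ (z : ℚ) := ⟨rfl, rfl, not_false, fun _ _ => rfl⟩
        exact ⟨c, .init hc, hinit.similar (by simp) (by simp) hc⟩
      · obtain ⟨c, hc, hs'⟩ := ih j' hj' (hj'.le.trans hj)
        exact ⟨c, hc, hs.symm.trans hs'⟩
      · obtain ⟨c, hc, hs⟩ := ih j' hj' (hj'.le.trans hj)
        obtain ⟨b, hb, hab⟩ := exists_samePos hs.2.2.2 (room_admissible fin z _ c.R)
          (hc.forall (natCast_mem_admissible fin z z) fun _ h => h)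
          (fun l _ => natCast_mem_admissible fin z l) (a := d) fun _ _ => ⟨d, rfl⟩
        obtain ⟨c', hn'⟩ := P.exists_next c t₁ t₂ b
        exact ⟨c', hc.step h₁ h₂ hb (hs.enabled hab he) hn', hs.next hP h₁ h₂ hab hn hn'⟩
  obtain ⟨j, hj, hdiff⟩ := h.diff
  obtain ⟨c, hc, hs⟩ := key j hj
  exact ⟨c, hc, hs.2.2.1.1 hdiff⟩

/-- Up to similarity, small configurations with room suffice. -/
theorem exists_similar_small {fin : Bool} {q₀ n z : ℕ} (hP : P.Bounded n) (hq₀ : q₀ < n)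
    (hz : fin = false → 2 * (P.k + P.k) < z) {c : PairConf ℚ}
    (hc : P.Reach (Admissible fin z) q₀ (z : ℚ) c) :
    ∃ a : SmallConf n (P.k + P.k) (z + 2 * (P.k + P.k) + 1),
      c.Similar fin z (P.k + P.k) a.toConf ∧
        Room fin z (P.k + P.k) (· ≤ z + 2 * (P.k + P.k) + 1) a.toConf.R := by
  obtain ⟨r, hT, hroom, hle⟩ := exists_sameType_room
    (hc.forall (natCast_mem_admissible fin z z) fun _ h => h) hz
  obtain ⟨h₁, h₂⟩ := hc.lt hP hq₀
  obtain ⟨a, e₁, e₂, e₃, e₄⟩ := exists_toConf (c := ⟨c.q₁, c.q₂, c.diff, r⟩) h₁ h₂ hle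
  refine ⟨a, ⟨e₁.symm, e₂.symm, e₃.symm, ?_⟩, ?_⟩
  · refine ⟨fun i hi j hj => ?_, fun i hi l hl hf => ?_⟩
    · rw [e₄ i hi, e₄ j hj]; exact hT.1 i hi j hj
    · rw [e₄ i hi]; exact hT.2 i hi l hl hf
  · refine ⟨⟨?_, fun i hi h => ?_⟩, fun hf => ⟨?_, fun i hi h => ?_⟩⟩
    · obtain ⟨u, hu, h1, h2⟩ := hroom.1.1
      exact ⟨u, hu, h1, fun j hj => by rw [e₄ j hj]; exact h2 j hj⟩
    · rw [e₄ i hi] at h ⊢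
      obtain ⟨u, hu, h1, h2⟩ := hroom.1.2 i hi h
      exact ⟨u, hu, h1, fun j hj => by rw [e₄ j hj]; exact h2 j hj⟩
    · obtain ⟨u, hu, h1, h2⟩ := (hroom.2 hf).1
      exact ⟨u, hu, h1, fun j hj => by rw [e₄ j hj]; exact h2 j hj⟩
    · rw [e₄ i hi] at h ⊢
      obtain ⟨u, hu, h1, h2⟩ := (hroom.2 hf).2 i hi h
      exact ⟨u, hu, h1, fun j hj => by rw [e₄ j hj]; exact h2 j hj⟩

theorem exists_small_next {n H : ℕ} (hP : P.Bounded n)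
    {a : SmallConf n (P.k + P.k) H} {t₁ t₂ d : ℕ} (h₁ : t₁ < P.T) (h₂ : t₂ < P.T) (hd : d ≤ H) :
    ∃ a' : SmallConf n (P.k + P.k) H, P.Next a.toConf t₁ t₂ d a'.toConf := by
  obtain ⟨c, hc⟩ := P.exists_next a.toConf t₁ t₂ d
  obtain ⟨a', e₁, e₂, e₃, e₄⟩ := exists_toConf (c := c) (hc.1 ▸ hP.tgt _ h₁) (hc.2.1 ▸ hP.tgt _ h₂)
    (hc.forall (p := (· ≤ H)) hd fun i _ => a.toConf_lt.2.2 i)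
  have o1 := hP.out _ h₁
  have o2 := hP.out _ h₂
  refine ⟨a', e₁.trans hc.1, e₂.trans hc.2.1, fun i hi => ?_, ?_⟩
  · rw [e₄ i (by omega), e₄ (P.k + i) (by omega)]
    exact hc.2.2.1 i hi
  · rw [e₃, e₄ _ (by omega), e₄ _ (by omega)]
    exact hc.2.2.2

theorem exists_small_init {q₀ n K z H : ℕ} (hq₀ : q₀ < n) (hz : z ≤ H) :
    ∃ a : SmallConf n K H, a.toConf.IsInit K q₀ z := by
  obtain ⟨a, e₁, e₂, e₃, e₄⟩ := exists_toConf (n := n) (K := K) (H := H)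
    (c := ⟨q₀, q₀, False, fun _ => z⟩) hq₀ hq₀ fun _ _ => hz
  exact ⟨a, e₁, e₂, e₃.not.2 not_false, e₄⟩

/-- A subset of a finite type can be enumerated. -/
theorem exists_enumeration {V : Type*} [Finite V] {N : ℕ} (hN : Nat.card V ≤ N + 1) {S : Set V}
    (hS : S.Nonempty) : ∃ g : ℕ → V, (∀ j, g j ∈ S) ∧ ∀ a ∈ S, ∃ j ≤ N, g j = a := by
  classical
  obtain ⟨a₀, ha₀⟩ := hS
  let e := Finite.equivFin V
  let g : ℕ → V := fun j => if h : ∃ a ∈ S, (e a : ℕ) = j then h.choose else a₀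
  refine ⟨g, fun j => ?_, fun a ha => ⟨e a, by have := (e a).2; omega, ?_⟩⟩
  · by_cases h : ∃ a ∈ S, (e a : ℕ) = j
    · simp only [g, dif_pos h]
      exact h.choose_spec.1
    · simp only [g, dif_neg h]
      exact ha₀
  · have h : ∃ a' ∈ S, (e a' : ℕ) = e a := ⟨a, ha, rfl⟩
    simp only [g, dif_pos h]
    exact e.injective (Fin.ext h.choose_spec.2)

/-- In a finite directed graph, paths can be shortened until their vertices are distinct. -/
theorem exists_short_path {V : Type*} [Finite V] {E : V → V → Prop} {a b : V}
    (h : Relation.ReflTransGen E a b) :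
    ∃ l < Nat.card V, ∃ p : ℕ → V, p 0 = a ∧ p l = b ∧ ∀ i < l, E (p i) (p (i + 1)) := by
  classical
  have hex : ∃ l, ∃ p : ℕ → V, p 0 = a ∧ p l = b ∧ ∀ i < l, E (p i) (p (i + 1)) := by
    induction h with
    | refl => exact ⟨0, fun _ => a, rfl, rfl, by simp⟩
    | @tail b c _ hbc ih =>
      obtain ⟨l, p, h0, hl, hp⟩ := ih
      refine ⟨l + 1, fun i => if i ≤ l then p i else c, by simp [h0], by simp, fun i hi => ?_⟩
      rcases (Nat.lt_succ_iff.1 hi).lt_or_eq with hi | rfl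
      · simpa [hi.le, hi] using hp i hi
      · simpa [hl] using hbc
  obtain ⟨p, h0, hl, hp⟩ := Nat.find_spec hex
  refine ⟨Nat.find hex, ?_, p, h0, hl, hp⟩
  by_contra! hlt
  set l := Nat.find hex with hl_def
  have : ¬ Function.Injective fun i : Fin (l + 1) => p i := fun hinj => by
    have := Nat.card_le_card_of_injective _ hinj
    rw [Nat.card_fin] at this
    omega
  simp only [Function.Injective, not_forall] at this
  obtain ⟨i, j, hij, hne⟩ := this
  wlog hlt' : i < j generalizing i j
  · exact this j i hij.symm (Ne.symm hne) (lt_of_le_of_ne (not_lt.1 hlt') (Ne.symm hne))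
  have h1 : (i : ℕ) < j := hlt'
  have h2 := j.2
  refine Nat.find_min hex (m := l - (j - i)) (by omega)
    ⟨fun m => if m ≤ i then p m else p (m + (j - i)), by simp [h0], ?_, fun m hm => ?_⟩
  · dsimp only
    split_ifs with h
    · have e1 : l - (j - i) = (i : ℕ) := by omega
      have e2 : (j : ℕ) = l := by omega
      rw [e1, hij, e2, hl]
    · rw [show l - (j - i) + (j - i) = l by omega, hl]
  · dsimp only
    rcases lt_trichotomy m i with h | h | h
    · rw [if_pos h.le, if_pos (by omega)]
      exact hp m (by omega)
    · rw [if_pos h.le, if_neg (by omega), h, hij, show (i : ℕ) + 1 + (j - i) = j + 1 by omega]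
      exact hp j (by omega)
    · rw [if_neg (by omega), if_neg (by omega), show m + 1 + (j - i) = m + (j - i) + 1 by omega]
      exact hp _ (by omega)

/-- The small configurations that are similar to reachable ones form a closed family. -/
theorem exists_closedFamily {fin : Bool} {q₀ n z N : ℕ} (hP : P.Bounded n) (hq₀ : q₀ < n)
    (hz : fin = false → 2 * (P.k + P.k) < z)
    (hN : Nat.card (SmallConf n (P.k + P.k) (z + 2 * (P.k + P.k) + 1)) ≤ N + 1)
    (h : ¬ P.Flagged (Admissible fin z) q₀ (z : ℚ)) :
    ∃ g : ℕ → SmallConf n (P.k + P.k) (z + 2 * (P.k + P.k) + 1),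
      P.ClosedFamily fin q₀ z (z + 2 * (P.k + P.k) + 1) N (P.k + P.k) fun j => (g j).toConf := by
  let S : Set (SmallConf n (P.k + P.k) (z + 2 * (P.k + P.k) + 1)) :=
    {a | ∃ c, P.Reach (Admissible fin z) q₀ (z : ℚ) c ∧ c.Similar fin z (P.k + P.k) a.toConf}
  obtain ⟨a₀, ha₀⟩ := exists_small_init (K := P.k + P.k) (z := z)
    (H := z + 2 * (P.k + P.k) + 1) hq₀ (by omega)
  have hS : a₀ ∈ S := by
    let c : PairConf ℚ := ⟨q₀, q₀, False, fun _ => z⟩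
    have hc : c.IsInit (P.k + P.k) q₀ (z : ℚ) := ⟨rfl, rfl, not_false, fun _ _ => rfl⟩
    exact ⟨c, .init hc, hc.similar (by simp) (by simp) ha₀⟩
  obtain ⟨g, hg, hgS⟩ := exists_enumeration hN ⟨a₀, hS⟩
  refine ⟨g, by omega, ?_, fun j _ i _ => (g j).toConf_lt.2.2 i,
    fun j _ hd => ?_, fun j _ t₁ h₁ t₂ h₂ d hd he => ?_, fun j _ => ?_⟩
  · obtain ⟨j, hj, e⟩ := hgS a₀ hS
    exact ⟨j, hj, by simpa only [e] using ha₀⟩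
  · obtain ⟨c, hc, hs⟩ := hg j
    exact h ⟨c, hc, hs.2.2.1.2 hd⟩
  · obtain ⟨c, hc, hs⟩ := hg j
    obtain ⟨b, hb, hab⟩ := exists_samePos hs.symm.2.2.2 (room_admissible fin z _ c.R)
      (hc.forall (natCast_mem_admissible fin z z) fun _ h => h)
      (fun l _ => natCast_mem_admissible fin z l) (a := d) fun _ _ => ⟨d, rfl⟩
    obtain ⟨c', hn⟩ := P.exists_next c t₁ t₂ b
    obtain ⟨a', hn'⟩ := exists_small_next (a := g j) hP h₁ h₂ hd
    obtain ⟨j', hj', e⟩ := hgS a' ⟨c', hc.step h₁ h₂ hb (hs.symm.enabled hab he) hn,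
      (hs.symm.next hP h₁ h₂ hab hn' hn).symm⟩
    exact ⟨j', hj', by simpa only [e] using hn'⟩
  · obtain ⟨c, hc, hs⟩ := hg j
    obtain ⟨a, hs', hr⟩ := exists_similar_small hP hq₀ hz hc
    obtain ⟨j', hj', e⟩ := hgS a ⟨c, hc, hs'⟩
    exact ⟨j', hj', by simpa only [e] using hs.symm.trans hs', by simpa only [e] using hr⟩

/-- A shortest path in the graph of small configurations is a derivation. The remaining members of the
family are initial configurations. -/
theorem exists_derivation {fin : Bool} {q₀ n z N : ℕ} (hP : P.Bounded n) (hq₀ : q₀ < n)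
    (hz : fin = false → 2 * (P.k + P.k) < z) (hzN : z + 2 * (P.k + P.k) + 1 ≤ N)
    (hN : Nat.card (SmallConf n (P.k + P.k) (z + 2 * (P.k + P.k) + 1)) ≤ N + 1)
    (h : P.Flagged (Admissible fin z) q₀ (z : ℚ)) :
    ∃ g : ℕ → SmallConf n (P.k + P.k) (z + 2 * (P.k + P.k) + 1),
      P.Derivation fin q₀ z N (P.k + P.k) fun j => (g j).toConf := by
  let E (a a' : SmallConf n (P.k + P.k) (z + 2 * (P.k + P.k) + 1)) : Prop :=
    a.toConf.Similar fin z (P.k + P.k) a'.toConf ∨ ∃ t₁ < P.T, ∃ t₂ < P.T, ∃ d ≤ N,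
      P.Enabled a.toConf t₁ t₂ d ∧ P.Next a.toConf t₁ t₂ d a'.toConf
  obtain ⟨a₀, ha₀⟩ := exists_small_init (K := P.k + P.k) (z := z)
    (H := z + 2 * (P.k + P.k) + 1) hq₀ (by omega)
  have key : ∀ c, P.Reach (Admissible fin z) q₀ (z : ℚ) c → ∃ a, Relation.ReflTransGen E a₀ a ∧
      c.Similar fin z (P.k + P.k) a.toConf ∧
        Room fin z (P.k + P.k) (· ≤ z + 2 * (P.k + P.k) + 1) a.toConf.R := by
    intro c hc
    induction hc with
    | init hc =>
      obtain ⟨a, hs, hr⟩ := exists_similar_small hP hq₀ hz (.init hc)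
      exact ⟨a, .single (.inl ((hc.similar (by simp) (by simp) ha₀).symm.trans hs)), hs, hr⟩
    | step hc h₁ h₂ hd he hn ih =>
      obtain ⟨a, ha, hs, hr⟩ := ih
      obtain ⟨b, hb, hab⟩ := exists_samePos hs.2.2.2 hr (fun i _ => a.toConf_lt.2.2 i)
        (fun c hc => show c ≤ z + 2 * (P.k + P.k) + 1 by omega) hd
      obtain ⟨a', hn'⟩ := exists_small_next (a := a) hP h₁ h₂ hb
      obtain ⟨a'', hs', hr'⟩ := exists_similar_small hP hq₀ hz (hc.step h₁ h₂ hd he hn)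
      refine ⟨a'', (ha.tail (.inr ⟨_, h₁, _, h₂, b, hb.trans hzN, hs.enabled hab he, hn'⟩)).tail
        (.inl ((hs.next hP h₁ h₂ hab hn hn').symm.trans hs')), hs', hr'⟩
  obtain ⟨c, hc, hdiff⟩ := h
  obtain ⟨a, ha, hs, -⟩ := key c hc
  obtain ⟨l, hl, p, hp0, hpl, hp⟩ := exists_short_path ha
  refine ⟨fun j => if j ≤ l then p j else a₀, fun j _ => ?_, l, by omega, ?_⟩
  · by_cases hj : j ≤ l
    · rcases Nat.eq_zero_or_pos j with rfl | hj0
      · exact .inl (by simpa [hp0] using ha₀)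
      · refine .inr ⟨j - 1, by omega, ?_⟩
        have := hp (j - 1) (by omega)
        rw [Nat.sub_add_cancel hj0] at this
        simpa only [if_pos hj, if_pos (show j - 1 ≤ l by omega)] using this
    · exact .inl (by simpa only [if_neg hj] using ha₀)
  · simp only [le_refl, if_true, hpl]
    exact hs.2.2.1.1 hdiff
end TransducerData

/-! ### Change of the data domain -/

open Set in
/-- A finite set of elements of `D` embeds in `D'` if there are enough elements of `D'` on both sides of
the distinguished element. -/
theorem exists_strictMonoOn {α β : Type*} [LinearOrder α] [LinearOrder β] {D : Set α} {D' : Set β}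
    {a : α} {b : β} (hb : b ∈ D') (h₁ : (D ∩ Iio a).encard ≤ (D' ∩ Iio b).encard)
    (h₂ : (D ∩ Ioi a).encard ≤ (D' ∩ Ioi b).encard) (F : Finset α) (hF : ↑F ⊆ D) :
    ∃ f : α → β, StrictMonoOn f (insert a (F : Set α)) ∧ f a = b ∧ ∀ x ∈ F, f x ∈ D' := by
  classical
  have side : ∀ (E : Finset α) (A : Set β), (E : Set α).encard ≤ A.encard →
      ∃ f : α → β, StrictMonoOn f E ∧ ∀ x ∈ E, f x ∈ A := by
    intro E A hE
    obtain ⟨B, hBA, hB⟩ := exists_subset_encard_eq hE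
    have hfin : B.Finite := finite_of_encard_eq_coe (hB.trans (encard_coe_eq_coe_finsetCard E))
    lift B to Finset β using hfin
    rw [encard_coe_eq_coe_finsetCard, encard_coe_eq_coe_finsetCard] at hB
    have hB : B.card = E.card := by exact_mod_cast hB
    let e : E ≃o B := (E.orderIsoOfFin rfl).symm.trans (B.orderIsoOfFin hB)
    refine ⟨fun x => if h : x ∈ E then e ⟨x, h⟩ else b, fun x hx y hy hxy => ?_, fun x hx => ?_⟩
    · have hx' : x ∈ E := hx
      have hy' : y ∈ E := hy
      simp only [dif_pos hx', dif_pos hy']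
      exact e.strictMono hxy
    · simp only [dif_pos hx]
      exact hBA (e ⟨x, hx⟩).2
  obtain ⟨f₁, hf₁, hA₁⟩ := side (F.filter (· < a)) _ ((encard_le_encard fun x hx => by
    simp only [Finset.coe_filter, mem_ofPred_eq] at hx
    exact ⟨hF hx.1, hx.2⟩).trans h₁)
  obtain ⟨f₂, hf₂, hA₂⟩ := side (F.filter (a < ·)) _ ((encard_le_encard fun x hx => by
    simp only [Finset.coe_filter, mem_ofPred_eq] at hx
    exact ⟨hF hx.1, hx.2⟩).trans h₂)
  simp only [Finset.mem_filter, and_imp] at hA₁ hA₂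
  refine ⟨fun x => if x < a then f₁ x else if a < x then f₂ x else b, ?_, by simp, fun x hx => ?_⟩
  · have hlow : ∀ x ∈ insert a (F : Set α), x < a → x ∈ F := fun x hx h =>
      hx.resolve_left h.ne
    have hup : ∀ x ∈ insert a (F : Set α), a < x → x ∈ F := fun x hx h =>
      hx.resolve_left h.ne'
    intro x hx y hy hxy
    dsimp only
    rcases lt_trichotomy x a with h | h | h <;> rcases lt_trichotomy y a with h' | h' | h'
    · rw [if_pos h, if_pos h']
      exact hf₁ (by simp [hlow x hx h, h]) (by simp [hlow y hy h', h']) hxy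
    · rw [if_pos h, if_neg h'.not_lt, if_neg h'.not_gt]
      exact (hA₁ x (hlow x hx h) h).2
    · rw [if_pos h, if_neg h'.not_gt, if_pos h']
      exact (hA₁ x (hlow x hx h) h).2.trans (hA₂ y (hup y hy h') h').2
    · exact absurd (h ▸ hxy) h'.not_gt
    · exact absurd (h.trans h'.symm) hxy.ne
    · rw [if_neg h.not_lt, if_neg h.not_gt, if_neg h'.not_gt, if_pos h']
      exact (hA₂ y (hup y hy h') h').2
    · exact absurd (h.trans hxy) h'.not_gt
    · exact absurd (h' ▸ hxy) h.not_gt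
    · rw [if_neg h.not_gt, if_pos h, if_neg h'.not_gt, if_pos h']
      exact hf₂ (by simp [hup x hx h, h]) (by simp [hup y hy h', h']) hxy
  · dsimp only
    split_ifs with h h'
    · exact (hA₁ x hx h).1
    · exact (hA₂ x hx h').1
    · exact hb

namespace TransducerData

variable {P : TransducerData} {α β : Type*} [LinearOrder α] [LinearOrder β]

open Set in
/-- Of the set of data values, only the numbers of elements on the two sides of the initial value
matter. -/
theorem flagged_iff {D : Set α} {D' : Set β} {q₀ n : ℕ} {a : α} {b : β} (hP : P.Bounded n)
    (ha : a ∈ D) (hb : b ∈ D') (h₁ : (D ∩ Iio a).encard = (D' ∩ Iio b).encard)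
    (h₂ : (D ∩ Ioi a).encard = (D' ∩ Ioi b).encard) :
    P.Flagged D q₀ a ↔ P.Flagged D' q₀ b :=
  ⟨Flagged.transfer hP (exists_strictMonoOn hb h₁.le h₂.le),
    Flagged.transfer hP (exists_strictMonoOn ha h₁.ge h₂.ge)⟩

/-- The transducer for the dual order. -/
def rev (P : TransducerData) : TransducerData := { P with guard := fun t i => (P.guard t i).swap }

open OrderDual in
theorem flagged_rev_iff {D : Set α} {q₀ : ℕ} {a : α} :
    P.rev.Flagged (ofDual ⁻¹' D) q₀ (toDual a) ↔ P.Flagged D q₀ a := by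
  have h : ∀ c t₁ t₂ d, P.rev.Enabled (α := αᵒᵈ) c t₁ t₂ (toDual d) ↔
      P.Enabled (α := α) ⟨c.q₁, c.q₂, c.diff, fun i => ofDual (c.R i)⟩ t₁ t₂ d := by
    intro c t₁ t₂ d
    have hc : ∀ (o : Ordering) (x : αᵒᵈ), o.swap.Compares (toDual d) x ↔
        o.Compares d (ofDual x) := by
      intro o x
      rw [Ordering.compares_swap]
      exact toDual_compares_toDual (a := ofDual x) (b := d)
    exact and_congr Iff.rfl (and_congr Iff.rfl (and_congr Iff.rfl (forall₂_congr fun i _ =>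
      and_congr (hc _ _) (hc _ _))))
  constructor
  · rintro ⟨c, hc, hd⟩
    refine ⟨⟨c.q₁, c.q₂, c.diff, fun i => ofDual (c.R i)⟩, ?_, hd⟩
    clear hd
    induction hc with
    | init hc => exact .init hc
    | step hc h₁ h₂ hd he hn ih => exact .step ih h₁ h₂ hd ((h _ _ _ _).1 he) hn
  · rintro ⟨c, hc, hd⟩
    refine ⟨⟨c.q₁, c.q₂, c.diff, fun i => toDual (c.R i)⟩, ?_, hd⟩
    clear hd
    induction hc with
    | init hc => exact .init hc
    | step hc h₁ h₂ hd he hn ih => exact .step ih h₁ h₂ hd ((h ⟨_, _, _, _⟩ _ _ _).2 he) hn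

end TransducerData

open Set in
theorem encard_admissible_Ioi (fin : Bool) (z : ℕ) :
    (Admissible fin z ∩ Ioi (z : ℚ)).encard = ⊤ := by
  rw [encard_eq_top_iff]
  exact (Ioi_infinite (z : ℚ)).mono fun x hx => ⟨fun _ h => absurd h hx.not_gt, hx⟩

open Set in
theorem encard_admissible_false_Iio (z : ℕ) :
    (Admissible false z ∩ Iio (z : ℚ)).encard = ⊤ := by
  rw [encard_eq_top_iff]
  exact (Iio_infinite (z : ℚ)).mono fun x hx => ⟨fun h => by simp at h, hx⟩

open Set in
theorem encard_admissible_true_Iio (z : ℕ) :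
    (Admissible true z ∩ Iio (z : ℚ)).encard = z := by
  have : Admissible true z ∩ Iio (z : ℚ) = Nat.cast '' ((Finset.range z : Finset ℕ) : Set ℕ) := by
    ext q
    simp only [Admissible, mem_inter_iff, mem_ofPred_eq, mem_Iio, mem_image, Finset.coe_range,
      forall_const]
    constructor
    · rintro ⟨h, hq⟩
      obtain ⟨c, rfl⟩ := h hq
      exact ⟨c, by exact_mod_cast hq, rfl⟩
    · rintro ⟨c, hc, rfl⟩
      exact ⟨fun _ => ⟨c, rfl⟩, by exact_mod_cast hc⟩
  rw [this, Nat.cast_injective.injOn.encard_image, encard_coe_eq_coe_finsetCard, Finset.card_range]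

/-! ### Transducers and their data -/

/-- The numbers in `P` describe the transitions in the list `l`. -/
structure TransducerData.Describes (P : TransducerData) {a b n k : ℕ}
    (l : List (SRTTransition (Fin a) (Fin b) (Fin n) k)) : Prop where
  k_eq : P.k = k
  T_eq : P.T = l.length
  src : ∀ (t : ℕ) (h : t < l.length), P.src t = l[t].source
  lab : ∀ (t : ℕ) (h : t < l.length), P.lab t = l[t].inLabel
  out : ∀ (t : ℕ) (h : t < l.length), P.out t = l[t].outReg
  olab : ∀ (t : ℕ) (h : t < l.length), P.olab t = l[t].outLabel
  tgt : ∀ (t : ℕ) (h : t < l.length), P.tgt t = l[t].target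
  guard : ∀ (t : ℕ) (h : t < l.length) (i : Fin k), P.guard t i = l[t].guard i
  new : ∀ (t : ℕ) (h : t < l.length) (i : Fin k), P.new t i ↔ l[t].update i = RegUpdate.new

section Describes

variable {a b n k : ℕ} {D : Type*} [LinearOrder D] [AddGroup D]
  {S : SRT (Fin a) (Fin b) D (Fin n) k} {l : List (SRTTransition (Fin a) (Fin b) (Fin n) k)}
  {P : TransducerData}

theorem TransducerData.Describes.bounded (hP : P.Describes l) : P.Bounded n :=
  ⟨fun t ht => by rw [hP.tgt t (hP.T_eq ▸ ht)]; exact (l[t]'(hP.T_eq ▸ ht)).target.2,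
    fun t ht => by rw [hP.out t (hP.T_eq ▸ ht), hP.k_eq]; exact (l[t]'(hP.T_eq ▸ ht)).outReg.2⟩

theorem SRT.Run.snoc {c c₁ c' : Fin n × (Fin k → D)} {x : Fin a × D} {y : Fin b × D}
    {V : List ((Fin a × D) × (Fin b × D))} (h : S.Run c V c₁) (h' : S.Step c₁ x y c') :
    S.Run c (V ++ [(x, y)]) c' := by
  induction h with
  | nil c => exact .cons h' (.nil _)
  | cons hs _ ih => exact .cons hs (ih h')

/-- A step of an add-free transducer in terms of the data. -/
theorem SRT.step_iff (hl : ∀ t, t ∈ l ↔ t ∈ S.trans) (hP : P.Describes l) (hS : S.AddFree)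
    {c c' : Fin n × (Fin k → D)} {x : Fin a × D} {y : Fin b × D} :
    S.Step c x y c' ↔ ∃ t < P.T, P.src t = c.1 ∧ P.lab t = x.1 ∧
      (∀ i : Fin k, (P.guard t i).Compares x.2 (c.2 i)) ∧
      (∀ i : Fin k, (P.new t i → c'.2 i = x.2) ∧ (¬ P.new t i → c'.2 i = c.2 i)) ∧
      (P.olab t = y.1 ∧ ∃ h : P.out t < k, y.2 = c'.2 ⟨P.out t, h⟩) ∧ P.tgt t = c'.1 := by
  constructor
  · rintro ⟨s, hs, h1, h2, h3, h4, h5, h6⟩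
    obtain ⟨t, ht, rfl⟩ := List.getElem_of_mem ((hl s).2 hs)
    refine ⟨t, hP.T_eq ▸ ht, ?_, ?_, fun i => ?_, fun i => ?_, ⟨?_, ?_⟩, ?_⟩
    · rw [hP.src t ht, h1]
    · rw [hP.lab t ht, h2]
    · rw [hP.guard t ht]; exact h3 i
    · rw [hP.new t ht, h4 i]
      refine ⟨fun h => by rw [h]; rfl, fun h => ?_⟩
      have := hS _ hs i
      generalize (l[t].update i) = m at h this
      cases m
      · rfl
      · exact absurd rfl h
      · exact absurd rfl this
    · rw [hP.olab t ht, h5]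
    · refine ⟨by rw [hP.out t ht]; exact l[t].outReg.2, ?_⟩
      rw [h5]
      exact congrArg c'.2 (Fin.ext (hP.out t ht).symm)
    · rw [hP.tgt t ht, h6]
  · rintro ⟨t, ht, h1, h2, h3, h4, ⟨h5, h6, h7⟩, h8⟩
    have ht := hP.T_eq ▸ ht
    have hs := (hl _).1 (List.getElem_mem ht)
    refine ⟨l[t], hs, Fin.ext ?_, Fin.ext ?_, fun i => ?_, fun i => ?_, Prod.ext (Fin.ext ?_) ?_,
      Fin.ext ?_⟩
    · rw [← hP.src t ht, h1]
    · rw [← hP.lab t ht, h2]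
    · rw [← hP.guard t ht]; exact h3 i
    · have h := h4 i
      rw [hP.new t ht] at h
      have h' := hS _ hs i
      generalize (l[t].update i) = m at h h'
      cases m
      · exact h.2 (by simp)
      · exact h.1 rfl
      · exact absurd rfl h'
    · rw [← hP.olab t ht, h5]
    · rw [h7]
      exact congrArg c'.2 (Fin.ext (hP.out t ht))
    · rw [← hP.tgt t ht, h8]

/-- The configurations of the two copies that make up `c`. -/
def PairConf.Splits {α : Type*} (c : PairConf α) (c₁ c₂ : Fin n × (Fin k → α)) : Prop :=
  c.q₁ = c₁.1 ∧ c.q₂ = c₂.1 ∧ ∀ i : Fin k, c.R i = c₁.2 i ∧ c.R (k + i) = c₂.2 i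

/-- Steps of the two copies on the same letter make up a step of the pair. -/
theorem exists_next_of_step (hl : ∀ t, t ∈ l ↔ t ∈ S.trans) (hP : P.Describes l) (hS : S.AddFree)
    {c : PairConf D} {c₁ c₂ c₁' c₂' : Fin n × (Fin k → D)} (hc : c.Splits c₁ c₂) {x : Fin a × D}
    {y₁ y₂ : Fin b × D} (h₁ : S.Step c₁ x y₁ c₁') (h₂ : S.Step c₂ x y₂ c₂') :
    ∃ t₁ < P.T, ∃ t₂ < P.T, P.Enabled c t₁ t₂ x.2 ∧ ∃ c', P.Next c t₁ t₂ x.2 c' ∧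
      c'.Splits c₁' c₂' ∧ (c'.diff ↔ c.diff ∨ y₁ ≠ y₂) := by
  obtain ⟨t₁, ht₁, a1, a2, a3, a4, ⟨a5, a6, a7⟩, a8⟩ := (SRT.step_iff hl hP hS).1 h₁
  obtain ⟨t₂, ht₂, b1, b2, b3, b4, ⟨b5, b6, b7⟩, b8⟩ := (SRT.step_iff hl hP hS).1 h₂
  have hk := hP.k_eq
  refine ⟨t₁, ht₁, t₂, ht₂, ⟨a1.trans hc.1.symm, b1.trans hc.2.1.symm, a2.trans b2.symm,
    fun i hi => ?_⟩, ?_⟩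
  · have hi : i < k := hk ▸ hi
    rw [hk, (hc.2.2 ⟨i, hi⟩).1, (hc.2.2 ⟨i, hi⟩).2]
    exact ⟨a3 ⟨i, hi⟩, b3 ⟨i, hi⟩⟩
  · obtain ⟨c', hn⟩ := P.exists_next c t₁ t₂ x.2
    have hR : ∀ i : Fin k, c'.R i = c₁'.2 i ∧ c'.R (k + i) = c₂'.2 i := by
      intro i
      have := hn.2.2.1 i (hk ▸ i.2)
      rw [hk] at this
      refine ⟨?_, ?_⟩
      · by_cases h : P.new t₁ i
        · rw [this.1.1 h, (a4 i).1 h]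
        · rw [this.1.2 h, (a4 i).2 h, (hc.2.2 i).1]
      · by_cases h : P.new t₂ i
        · rw [this.2.1 h, (b4 i).1 h]
        · rw [this.2.2 h, (b4 i).2 h, (hc.2.2 i).2]
    refine ⟨c', hn, ⟨hn.1.trans a8, hn.2.1.trans b8, hR⟩, ?_⟩
    rw [hn.2.2.2, (hR ⟨_, a6⟩).1, hk, (hR ⟨_, b6⟩).2, ← a7, ← b7, a5, b5]
    simp only [ne_eq, Prod.ext_iff, Fin.ext_iff]
    tauto

/-- A step of the pair consists of steps of the two copies on the same letter. -/
theorem exists_step_of_next (hl : ∀ t, t ∈ l ↔ t ∈ S.trans) (hP : P.Describes l) (hS : S.AddFree)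
    {c c' : PairConf D} {c₁ c₂ : Fin n × (Fin k → D)} (hc : c.Splits c₁ c₂) {t₁ t₂ : ℕ} {d : D}
    (h₁ : t₁ < P.T) (h₂ : t₂ < P.T) (he : P.Enabled c t₁ t₂ d) (hn : P.Next c t₁ t₂ d c') :
    ∃ (c₁' c₂' : Fin n × (Fin k → D)) (x : Fin a × D) (y₁ y₂ : Fin b × D),
      S.Step c₁ x y₁ c₁' ∧ S.Step c₂ x y₂ c₂' ∧ c'.Splits c₁' c₂' ∧
      (c'.diff ↔ c.diff ∨ y₁ ≠ y₂) := by
  have hk := hP.k_eq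
  have l1 := hP.T_eq ▸ h₁
  have l2 := hP.T_eq ▸ h₂
  refine ⟨(l[t₁].target, fun i => c'.R i), (l[t₂].target, fun i => c'.R (k + i)),
    (l[t₁].inLabel, d), (l[t₁].outLabel, c'.R (P.out t₁)), (l[t₂].outLabel, c'.R (k + P.out t₂)),
    (SRT.step_iff hl hP hS).2 ⟨t₁, h₁, he.1.trans hc.1, hP.lab t₁ l1, fun i => ?_, fun i => ?_,
      ⟨hP.olab t₁ l1, ?_, rfl⟩, hP.tgt t₁ l1⟩,
    (SRT.step_iff hl hP hS).2 ⟨t₂, h₂, he.2.1.trans hc.2.1, ?_, fun i => ?_, fun i => ?_,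
      ⟨hP.olab t₂ l2, ?_, rfl⟩, hP.tgt t₂ l2⟩,
    ⟨hn.1.trans (hP.tgt t₁ l1), hn.2.1.trans (hP.tgt t₂ l2), fun i => ⟨rfl, rfl⟩⟩, ?_⟩
  · rw [← (hc.2.2 i).1]
    exact (he.2.2.2 i (hk ▸ i.2)).1
  · rw [← (hc.2.2 i).1]
    exact (hn.2.2.1 i (hk ▸ i.2)).1
  · rw [hP.out t₁ l1]; exact l[t₁].outReg.2
  · rw [← he.2.2.1]; exact hP.lab t₁ l1
  · have := (he.2.2.2 i (hk ▸ i.2)).2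
    rwa [hk, (hc.2.2 i).2] at this
  · have := (hn.2.2.1 i (hk ▸ i.2)).2
    rwa [hk, (hc.2.2 i).2] at this
  · rw [hP.out t₂ l2]; exact l[t₂].outReg.2
  · rw [hn.2.2.2, hP.olab t₁ l1, hP.olab t₂ l2, hk]
    simp only [ne_eq, Prod.ext_iff, Fin.ext_iff]
    tauto

/-- A transducer is not functional exactly if two copies of it can produce different outputs on the
same input. -/
theorem not_functional_iff (hl : ∀ t, t ∈ l ↔ t ∈ S.trans) (hP : P.Describes l) (hS : S.AddFree)
    (hS₀ : S.Uninitialized) : ¬ S.Functional ↔ P.Flagged Set.univ S.start (0 : D) := by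
  have hk := hP.k_eq
  constructor
  · -- two runs on the same input yield a run of the pair
    have key : ∀ {c₁ c₁' : Fin n × (Fin k → D)} {V₁ : List ((Fin a × D) × (Fin b × D))},
        S.Run c₁ V₁ c₁' → ∀ {c₂ c₂' : Fin n × (Fin k → D)} {V₂ : List ((Fin a × D) × (Fin b × D))},
        S.Run c₂ V₂ c₂' → V₁.map Prod.fst = V₂.map Prod.fst → ∀ c : PairConf D, c.Splits c₁ c₂ →
        P.Reach Set.univ S.start (0 : D) c → (c.diff ∨ V₁ ≠ V₂) →
        P.Flagged Set.univ S.start (0 : D) := by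
      intro c₁ c₁' V₁ h
      induction h with
      | nil c₁ =>
        intro c₂ c₂' V₂ h₂ hV c _ hr hd
        refine ⟨c, hr, hd.resolve_right fun h => h ?_⟩
        exact (List.map_eq_nil_iff.1 hV.symm).symm
      | @cons c₁ d₁ c₁' x y V₁ hs _ ih =>
        intro c₂ c₂' V₂ h₂ hV c hc hr hd
        cases h₂ with
        | nil => simp at hV
        | @cons _ d₂ _ x₂ y₂ V₂ hs₂ h₂ =>
          simp only [List.map_cons, List.cons.injEq] at hV
          obtain ⟨rfl, hV⟩ := hV
          obtain ⟨t₁, h1, t₂, h2, he, c', hn, hc', hd'⟩ := exists_next_of_step hl hP hS hc hs hs₂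
          refine ih h₂ hV c' hc' (hr.step h1 h2 (Set.mem_univ _) he hn) ?_
          rw [hd']
          simp only [ne_eq, List.cons.injEq, Prod.mk.injEq, true_and] at hd ⊢
          tauto
    intro hF
    simp only [SRT.Functional, Set.Subsingleton, not_forall] at hF
    obtain ⟨s, t₁, ⟨hl₁, c₁, hr₁⟩, t₂, ⟨hl₂, c₂, hr₂⟩, hne⟩ := hF
    refine key hr₁ hr₂ ?_ ⟨S.start, S.start, False, fun _ => 0⟩ ⟨rfl, rfl, fun i =>
      ⟨(hS₀ i).symm, (hS₀ i).symm⟩⟩ (.init ⟨rfl, rfl, not_false, fun _ _ => rfl⟩) (.inr fun h => ?_)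
    · rw [List.map_fst_zip hl₁.le, List.map_fst_zip hl₂.le]
    · refine hne ?_
      rw [← List.map_snd_zip (l₁ := s) (l₂ := t₁) hl₁.ge, h, List.map_snd_zip hl₂.ge]
  · -- a run of the pair consists of two runs on the same input
    rintro ⟨c, hc, hd⟩ hF
    have key : ∀ c, P.Reach Set.univ S.start (0 : D) c →
        ∃ (c₁ c₂ : Fin n × (Fin k → D)) (V₁ V₂ : List ((Fin a × D) × (Fin b × D))),
        S.Run (S.start, S.initReg) V₁ c₁ ∧ S.Run (S.start, S.initReg) V₂ c₂ ∧
        V₁.map Prod.fst = V₂.map Prod.fst ∧ c.Splits c₁ c₂ ∧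
        (c.diff → V₁.map Prod.snd ≠ V₂.map Prod.snd) := by
      intro c hc
      induction hc with
      | init hc =>
        refine ⟨_, _, [], [], .nil _, .nil _, rfl, ⟨hc.1, hc.2.1, fun i => ?_⟩,
          fun h => absurd h hc.2.2.1⟩
        have := i.2
        rw [hc.2.2.2 i (by omega), hc.2.2.2 (k + i) (by omega)]
        exact ⟨(hS₀ i).symm, (hS₀ i).symm⟩
      | step hc h₁ h₂ hd he hn ih =>
        obtain ⟨c₁, c₂, V₁, V₂, r₁, r₂, hV, hs, hd'⟩ := ih
        obtain ⟨c₁', c₂', x, y₁, y₂, s₁, s₂, hs', hd''⟩ := exists_step_of_next hl hP hS hs h₁ h₂ he hn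
        refine ⟨c₁', c₂', _, _, r₁.snoc s₁, r₂.snoc s₂, by simp [hV], hs', fun h h' => ?_⟩
        rw [List.map_append, List.map_append] at h'
        obtain ⟨h1, h2⟩ := List.append_inj' h' (by simp)
        rcases hd''.1 h with h | h
        · exact hd' h h1
        · exact h (by simpa using h2)
    obtain ⟨c₁, c₂, V₁, V₂, r₁, r₂, hV, -, hd'⟩ := key c hc
    have hz : ∀ V : List ((Fin a × D) × (Fin b × D)), (V.map Prod.fst).zip (V.map Prod.snd) = V :=
      fun V => by induction V <;> simp_all
    refine hd' hd (hF (V₁.map Prod.fst) ⟨by simp, c₁, by rwa [hz]⟩ ⟨?_, c₂, by rwa [hV, hz]⟩)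
    rw [hV]
    simp

end Describes

/-! ### Parsing codes -/

instance : Finite SRTSymbol := by
  have : Finite RegUpdate :=
    .of_surjective (fun i : Fin 3 => ![RegUpdate.old, .new, .add] i) fun m => by
      cases m
      exacts [⟨0, rfl⟩, ⟨1, rfl⟩, ⟨2, rfl⟩]
  have : Finite Ordering := .of_surjective (fun i : Fin 3 => ![Ordering.lt, .eq, .gt] i) fun o => by
    cases o
    exacts [⟨0, rfl⟩, ⟨1, rfl⟩, ⟨2, rfl⟩]
  refine .of_surjective (fun s : Bool ⊕ Ordering ⊕ RegUpdate =>
    s.elim (fun b => if b then .tick else .sep) fun s => s.elim .cmp .upd) fun s => ?_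
  cases s with
  | tick => exact ⟨.inl true, rfl⟩
  | sep => exact ⟨.inl false, rfl⟩
  | cmp o => exact ⟨.inr (.inl o), rfl⟩
  | upd m => exact ⟨.inr (.inr m), rfl⟩

theorem drop_eq_ofFn_append {A : Type*} {w : List A} {p k : ℕ} {F : Fin k → A}
    (h : ∀ i : Fin k, w[p + i]? = some (F i)) : w.drop p = List.ofFn F ++ w.drop (p + k) := by
  refine List.ext_getElem? fun i => ?_
  rw [List.getElem?_drop, List.getElem?_append, List.length_ofFn]
  split_ifs with hi
  · rw [h ⟨i, hi⟩, List.getElem?_ofFn, dif_pos hi]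
  · rw [List.getElem?_drop]
    congr 1
    omega

theorem of_drop_eq_ofFn_append {A : Type*} {w r : List A} {p k : ℕ} {F : Fin k → A}
    (h : w.drop p = List.ofFn F ++ r) :
    (∀ i : Fin k, w[p + i]? = some (F i)) ∧ w.drop (p + k) = r := by
  constructor
  · intro i
    rw [← List.getElem?_drop, h, List.getElem?_append_left (by simp), List.getElem?_ofFn,
      dif_pos i.2]
  · rw [← List.drop_drop, h, List.drop_left' (by simp)]

/-- In the word `w`, the code of the number `c` begins at the position `p` and ends before the position
`q`. -/
def Block (w : List SRTSymbol) (p c q : ℕ) : Prop :=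
  (∀ i < c, w[p + i]? = some .tick) ∧ w[p + c]? = some .sep ∧ q = p + c + 1

theorem unaryCode_eq_ofFn (c : ℕ) : unaryCode c =
    List.ofFn (fun i : Fin (c + 1) => if (i : ℕ) < c then SRTSymbol.tick else .sep) := by
  rw [List.ofFn_succ', unaryCode, List.concat_eq_append]
  congr 1
  · simp
  · simp

theorem Block.drop {w : List SRTSymbol} {p c q : ℕ} (h : Block w p c q) :
    w.drop p = unaryCode c ++ w.drop q := by
  obtain ⟨h₁, h₂, rfl⟩ := h
  rw [unaryCode_eq_ofFn]
  refine drop_eq_ofFn_append fun i => ?_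
  split_ifs with hi
  · exact h₁ i hi
  · rw [show (i : ℕ) = c by omega]
    exact h₂

theorem block_of_drop {w r : List SRTSymbol} {p c : ℕ} (h : w.drop p = unaryCode c ++ r) :
    Block w p c (p + c + 1) ∧ w.drop (p + c + 1) = r := by
  rw [unaryCode_eq_ofFn] at h
  obtain ⟨h₁, h₂⟩ := of_drop_eq_ofFn_append h
  refine ⟨⟨fun i hi => ?_, ?_, rfl⟩, h₂⟩
  · simpa [hi] using h₁ ⟨i, by omega⟩
  · simpa using h₁ ⟨c, by omega⟩

theorem Block.le_length {w : List SRTSymbol} {p c q : ℕ} (h : Block w p c q) :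
    p < w.length ∧ c < w.length ∧ q ≤ w.length := by
  obtain ⟨-, h₂, rfl⟩ := h
  obtain ⟨h, -⟩ := List.getElem?_eq_some_iff.1 h₂
  omega

/-- In the word `w`, the code of an add-free transition begins at `p` and ends before `q`, with the
guards from `g` on and the updates from `u` on. -/
def TransitionAt (w : List SRTSymbol) (N k p g u q src lab out olab tgt : ℕ) : Prop :=
  ∃ p₁ ≤ N, ∃ p₂ ≤ N, ∃ p₃ ≤ N, ∃ p₄ ≤ N, Block w p src p₁ ∧ Block w p₁ lab g ∧
    (∀ i < k, ∃ o, w[g + i]? = some (.cmp o)) ∧ u = g + k ∧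
    (∀ i < k, w[u + i]? = some (.upd .old) ∨ w[u + i]? = some (.upd .new)) ∧ p₂ = u + k ∧
    Block w p₂ out p₃ ∧ Block w p₃ olab p₄ ∧ Block w p₄ tgt q

/-- Positions in a code, and the numbers that occur in it: the transition `t` is the part of the code
from `pos t` up to `pos (t + 1)`, with the guards from `guards t` on and the updates from
`updates t` on. -/
structure CodeTable where
  pos : ℕ → ℕ
  src : ℕ → ℕ
  lab : ℕ → ℕ
  guards : ℕ → ℕ
  updates : ℕ → ℕ
  out : ℕ → ℕ
  olab : ℕ → ℕ
  tgt : ℕ → ℕ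

/-- The guard that a letter stands for. -/
def letterGuard : Option SRTSymbol → Ordering
  | some (.cmp o) => o
  | _ => .eq

/-- The update that a letter stands for; `add` does not occur. -/
def letterUpdate : Option SRTSymbol → RegUpdate
  | some (.upd .new) => .new
  | _ => .old

/-- The data of the transducer with the code `w`; if `rev`, for the dual order. -/
def CodeTable.data (G : CodeTable) (rev : Bool) (w : List SRTSymbol) (k T : ℕ) :
    TransducerData where
  k := k
  T := T
  src := G.src
  lab := G.lab
  out := G.out
  olab := G.olab
  tgt := G.tgt
  guard t i := bif rev then (letterGuard w[G.guards t + i]?).swap else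
    letterGuard w[G.guards t + i]?
  new t i := letterUpdate w[G.updates t + i]? = .new

/-- The table describes the code `w` of an add-free transducer with `a` input labels, `b` output
labels, `n` states, `k` registers, the initial state `q₀` and `T` transitions. -/
def CodeTable.Parses (G : CodeTable) (w : List SRTSymbol) (N a b n k q₀ T : ℕ) : Prop :=
  (∃ p₁ ≤ N, ∃ p₂ ≤ N, ∃ p₃ ≤ N, ∃ p₄ ≤ N, Block w 0 a p₁ ∧ Block w p₁ b p₂ ∧ Block w p₂ n p₃ ∧
    Block w p₃ k p₄ ∧ Block w p₄ q₀ (G.pos 0)) ∧ q₀ < n ∧ w[G.pos T]? = none ∧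
  ∀ t < T, (∃ t' ≤ N, t' = t + 1 ∧ TransitionAt w N k (G.pos t) (G.guards t) (G.updates t)
    (G.pos t') (G.src t) (G.lab t) (G.out t) (G.olab t) (G.tgt t)) ∧
    G.src t < n ∧ G.lab t < a ∧ G.out t < k ∧ G.olab t < b ∧ G.tgt t < n

theorem TransitionAt.drop {a b n k : ℕ} {w : List SRTSymbol} {N p g u q : ℕ}
    {s : SRTTransition (Fin a) (Fin b) (Fin n) k}
    (h : TransitionAt w N k p g u q s.source s.inLabel s.outReg s.outLabel s.target)
    (hg : ∀ i : Fin k, s.guard i = letterGuard w[g + i]?)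
    (hu : ∀ i : Fin k, s.update i = letterUpdate w[u + i]?) :
    w.drop p = s.code ++ w.drop q := by
  obtain ⟨p₁, -, p₂, -, p₃, -, p₄, -, h1, h2, h3, rfl, h5, rfl, h7, h8, h9⟩ := h
  have hG : ∀ i : Fin k, w[g + i]? = some (.cmp (s.guard i)) := by
    intro i
    obtain ⟨o, ho⟩ := h3 i i.2
    rw [hg, ho]
    rfl
  have hU : ∀ i : Fin k, w[g + k + i]? = some (.upd (s.update i)) := by
    intro i
    rw [hu]
    rcases h5 i i.2 with h | h <;> rw [h] <;> rfl
  rw [SRTTransition.code, h1.drop, h2.drop, drop_eq_ofFn_append hG, drop_eq_ofFn_append hU, h7.drop,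
    h8.drop, h9.drop]
  simp only [List.append_assoc]

theorem exists_transitionAt {a b n k : ℕ} {w r : List SRTSymbol} {N p : ℕ}
    {s : SRTTransition (Fin a) (Fin b) (Fin n) k} (hN : w.length ≤ N)
    (hs : ∀ i, s.update i ≠ .add) (h : w.drop p = s.code ++ r) :
    ∃ g ≤ N, ∃ u ≤ N, TransitionAt w N k p g u (p + s.code.length) s.source s.inLabel s.outReg
      s.outLabel s.target ∧ (∀ i : Fin k, w[g + i]? = some (.cmp (s.guard i))) ∧
      ∀ i : Fin k, w[u + i]? = some (.upd (s.update i)) := by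
  have hlen : s.code.length = s.source + 1 + (s.inLabel + 1) + k + k + (s.outReg + 1) +
      (s.outLabel + 1) + (s.target + 1) := by
    simp [SRTTransition.code, unaryCode]
    omega
  rw [SRTTransition.code] at h
  simp only [List.append_assoc] at h
  obtain ⟨h1, h⟩ := block_of_drop h
  obtain ⟨h2, h⟩ := block_of_drop h
  obtain ⟨h3, h⟩ := of_drop_eq_ofFn_append h
  obtain ⟨h4, h⟩ := of_drop_eq_ofFn_append h
  obtain ⟨h5, h⟩ := block_of_drop h
  obtain ⟨h6, h⟩ := block_of_drop h
  obtain ⟨h7, h⟩ := block_of_drop h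
  have := h1.le_length
  have := h5.le_length
  have := h6.le_length
  refine ⟨_, ?_, _, ?_, ⟨_, ?_, _, ?_, _, ?_, _, ?_, h1, h2, fun i hi => ⟨_, h3 ⟨i, hi⟩⟩, rfl,
    fun i hi => ?_, rfl, h5, h6, ?_⟩, h3, h4⟩
  any_goals omega
  · have h' := h4 ⟨i, hi⟩
    have hs := hs ⟨i, hi⟩
    generalize s.update ⟨i, hi⟩ = m at h' hs
    cases m
    · exact .inl h'
    · exact .inr h'
    · exact absurd rfl hs
  · rw [hlen]
    convert h7 using 1
    omega

/-- A word splits at the positions `pos 0`, …, `pos T` into the codes of `s 0`, …, `s (T - 1)`. -/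
theorem drop_eq_flatMap {α A : Type*} (code : α → List A) (w : List A) {T : ℕ} (pos : ℕ → ℕ)
    (s : Fin T → α) (h : ∀ t : Fin T, w.drop (pos t) = code (s t) ++ w.drop (pos (t + 1))) :
    w.drop (pos 0) = (List.ofFn s).flatMap code ++ w.drop (pos T) := by
  induction T generalizing pos with
  | zero => simp
  | succ T ih =>
    have h0 := h 0
    have := ih (fun t => pos (t + 1)) (fun t => s t.succ) fun t => by simpa using h t.succ
    rw [Fin.val_zero, Nat.zero_add] at h0
    rw [Nat.zero_add] at this
    rw [List.ofFn_succ, List.flatMap_cons, h0, this, List.append_assoc]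

/-- A word that is described by a table is a code. -/
theorem CodeTable.Parses.exists_list {G : CodeTable} {w : List SRTSymbol} {N a b n k q₀ T : ℕ}
    (h : G.Parses w N a b n k q₀ T) :
    ∃ l : List (SRTTransition (Fin a) (Fin b) (Fin n) k),
      w = unaryCode a ++ unaryCode b ++ unaryCode n ++ unaryCode k ++ unaryCode q₀ ++
        l.flatMap SRTTransition.code ∧
      (G.data false w k T).Describes l ∧ ∀ s ∈ l, ∀ i, s.update i ≠ .add := by
  obtain ⟨⟨p₁, -, p₂, -, p₃, -, p₄, -, h1, h2, h3, h4, h5⟩, -, hT, h⟩ := h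
  let s : Fin T → SRTTransition (Fin a) (Fin b) (Fin n) k := fun t =>
    { source := ⟨G.src t, (h t t.2).2.1⟩
      inLabel := ⟨G.lab t, (h t t.2).2.2.1⟩
      guard := fun i => letterGuard w[G.guards t + i]?
      update := fun i => letterUpdate w[G.updates t + i]?
      outReg := ⟨G.out t, (h t t.2).2.2.2.1⟩
      outLabel := ⟨G.olab t, (h t t.2).2.2.2.2.1⟩
      target := ⟨G.tgt t, (h t t.2).2.2.2.2.2⟩ }
  have hs := drop_eq_flatMap SRTTransition.code w G.pos s fun t => by
    obtain ⟨t', -, rfl, ht⟩ := (h t t.2).1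
    exact TransitionAt.drop ht (fun i => rfl) fun i => rfl
  rw [List.getElem?_eq_none_iff] at hT
  rw [List.drop_eq_nil_of_le hT, List.append_nil] at hs
  have hlen : (List.ofFn s).length = T := List.length_ofFn
  refine ⟨List.ofFn s, ?_, ⟨rfl, hlen.symm, ?_, ?_, ?_, ?_, ?_, ?_, ?_⟩, fun x hx i => ?_⟩
  · conv_lhs => rw [← List.drop_zero (l := w), h1.drop, h2.drop, h3.drop, h4.drop, h5.drop, hs]
    simp only [List.append_assoc]
  · intro t ht; rw [List.getElem_ofFn]; rfl
  · intro t ht; rw [List.getElem_ofFn]; rfl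
  · intro t ht; rw [List.getElem_ofFn]; rfl
  · intro t ht; rw [List.getElem_ofFn]; rfl
  · intro t ht; rw [List.getElem_ofFn]; rfl
  · intro t ht i; rw [List.getElem_ofFn]; rfl
  · intro t ht i; rw [List.getElem_ofFn]; rfl
  · obtain ⟨t, rfl⟩ := (List.mem_ofFn' _ _).1 hx
    change letterUpdate w[G.updates t + i]? ≠ .add
    unfold letterUpdate
    split <;> simp

/-- A code is described by a table of numbers not larger than its length. -/
theorem exists_parses {a b n k q₀ N : ℕ} {w : List SRTSymbol} (hN : w.length ≤ N)
    {l : List (SRTTransition (Fin a) (Fin b) (Fin n) k)} (hq₀ : q₀ < n)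
    (hw : w = unaryCode a ++ unaryCode b ++ unaryCode n ++ unaryCode k ++ unaryCode q₀ ++
      l.flatMap SRTTransition.code) (hl : ∀ s ∈ l, ∀ i, s.update i ≠ .add) :
    ∃ G : CodeTable, G.Parses w N a b n k q₀ l.length ∧
      (G.data false w k l.length).Describes l ∧ l.length ≤ N ∧
      ∀ t, G.pos t ≤ N ∧ G.src t ≤ N ∧ G.lab t ≤ N ∧ G.guards t ≤ N ∧ G.updates t ≤ N ∧
        G.out t ≤ N ∧ G.olab t ≤ N ∧ G.tgt t ≤ N := by
  classical
  have hw' := hw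
  rw [← List.drop_zero (l := w)] at hw'
  simp only [List.append_assoc] at hw'
  obtain ⟨h1, h⟩ := block_of_drop hw'
  obtain ⟨h2, h⟩ := block_of_drop h
  obtain ⟨h3, h⟩ := block_of_drop h
  obtain ⟨h4, h⟩ := block_of_drop h
  obtain ⟨h5, h⟩ := block_of_drop h
  set p₀ := 0 + a + 1 + b + 1 + n + 1 + k + 1 + q₀ + 1 with hp₀
  let pos : ℕ → ℕ := fun t => p₀ + ((l.take t).flatMap SRTTransition.code).length
  have hpos0 : pos 0 = p₀ := by simp [pos]
  have hpos : ∀ t (ht : t < l.length), pos (t + 1) = pos t + (l[t]).code.length := by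
    intro t ht
    simp only [pos]
    rw [List.take_succ_eq_append_getElem ht, List.flatMap_append, List.length_append]
    simp [add_assoc]
  have hdrop : ∀ t, w.drop (pos t) = (l.drop t).flatMap SRTTransition.code := by
    intro t
    simp only [pos]
    rw [← List.drop_drop, h]
    conv_lhs => rw [← List.take_append_drop t l, List.flatMap_append]
    rw [List.drop_left' (by simp)]
  have hposw : ∀ t, pos t ≤ w.length := by
    intro t
    have h' := congrArg List.length h
    rw [List.length_drop, ← List.take_append_drop t l, List.flatMap_append, List.length_append] at h'
    have := h5.le_length
    simp only [pos]
    omega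
  have key : ∀ t (ht : t < l.length), ∃ g ≤ N, ∃ u ≤ N, TransitionAt w N k (pos t) g u (pos (t + 1))
      l[t].source l[t].inLabel l[t].outReg l[t].outLabel l[t].target ∧
      (∀ i : Fin k, w[g + i]? = some (.cmp (l[t].guard i))) ∧
      ∀ i : Fin k, w[u + i]? = some (.upd (l[t].update i)) := by
    intro t ht
    rw [hpos t ht]
    refine exists_transitionAt hN (hl _ (List.getElem_mem ht))
      (r := (l.drop (t + 1)).flatMap SRTTransition.code) ?_
    rw [hdrop, List.drop_eq_getElem_cons ht, List.flatMap_cons]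
  choose g hg u hu htr hguard hupd using key
  have ha := h1.le_length
  have hb := h2.le_length
  have hn := h3.le_length
  have hk := h4.le_length
  have hlenw : 0 < w.length := by omega
  let G : CodeTable :=
    { pos := pos
      src := fun t => if h : t < l.length then l[t].source else 0
      lab := fun t => if h : t < l.length then l[t].inLabel else 0
      guards := fun t => if h : t < l.length then g t h else 0
      updates := fun t => if h : t < l.length then u t h else 0
      out := fun t => if h : t < l.length then l[t].outReg else 0
      olab := fun t => if h : t < l.length then l[t].outLabel else 0
      tgt := fun t => if h : t < l.length then l[t].target else 0 }
  have hlN : l.length ≤ w.length := by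
    have : ∀ t ≤ l.length, t ≤ pos t := by
      intro t
      induction t with
      | zero => simp
      | succ t ih =>
        intro ht
        have h1 := hpos t ht
        have h2 : 0 < (l[t]'ht).code.length := by simp [SRTTransition.code, unaryCode]
        have := ih (by omega)
        omega
    exact (this _ le_rfl).trans (hposw _)
  refine ⟨G, ⟨⟨_, ?_, _, ?_, _, ?_, _, ?_, h1, h2, h3, h4, ?_⟩, hq₀, ?_, fun t ht => ⟨⟨t + 1, ?_, rfl, ?_⟩,
    ?_⟩⟩, ⟨rfl, rfl, ?_, ?_, ?_, ?_, ?_, ?_, ?_⟩, hlN.trans hN, fun t => ?_⟩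
  any_goals omega
  · simpa only [G, hpos0] using h5
  · rw [List.getElem?_eq_none_iff]
    have := hdrop l.length
    rw [List.drop_length, List.flatMap_nil, List.drop_eq_nil_iff] at this
    exact this
  · simpa only [G, dif_pos ht] using htr t ht
  · simp only [G, dif_pos ht]
    exact ⟨l[t].source.2, l[t].inLabel.2, l[t].outReg.2, l[t].outLabel.2, l[t].target.2⟩
  · intro t ht; simp [CodeTable.data, G, ht]
  · intro t ht; simp [CodeTable.data, G, ht]
  · intro t ht; simp [CodeTable.data, G, ht]
  · intro t ht; simp [CodeTable.data, G, ht]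
  · intro t ht; simp [CodeTable.data, G, ht]
  · intro t ht i
    simp only [CodeTable.data, G, dif_pos ht, hguard, cond_false]
    rfl
  · intro t ht i
    simp only [CodeTable.data, G, dif_pos ht, hupd]
    generalize l[t].update i = m
    cases m <;> simp [letterUpdate]
  · refine ⟨(hposw t).trans hN, ?_⟩
    simp only [G]
    split_ifs with ht
    · have := hg t ht
      have := hu t ht
      have := l[t].source.2
      have := l[t].inLabel.2
      have := l[t].outReg.2
      have := l[t].outLabel.2
      have := l[t].target.2
      omega
    · simp

/-! ### Definability of certificates -/

/-- Eight of the functions, on the diagonal, make up a table. -/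
def tableOf (f : Fin 12 → ℕ → ℕ → ℕ) : CodeTable where
  pos t := f 0 t t
  src t := f 1 t t
  lab t := f 2 t t
  guards t := f 3 t t
  updates t := f 11 t t
  out t := f 4 t t
  olab t := f 5 t t
  tgt t := f 6 t t

/-- The other four functions make up a family of configurations. Register indices are truncated at `N`,
so that sums of indices are definable. -/
def confOf (N : ℕ) (f : Fin 12 → ℕ → ℕ → ℕ) (j : ℕ) : PairConf ℕ where
  q₁ := f 7 j j
  q₂ := f 8 j j
  diff := f 9 j j = 1
  R i := f 10 j (min i N)

section Definability

variable {A : Type} {r n : ℕ} {𝒞 : FOStr A r → Prop}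

theorem FOFun.congr {g h : FOStr A r → (Fin n → ℕ) → ℕ} (hg : FOFun 𝒞 g)
    (e : ∀ S v, (∀ i, v i ≤ S.N) → g S v = h S v) : FOFun 𝒞 h :=
  ⟨fun S hS v hv => e S v hv ▸ hg.1 S hS v hv, hg.2.congr fun S _ v hv => by
    rw [e S (Fin.init v) fun i => hv _]⟩

/-- Truncated addition has a definable graph. -/
theorem FOFun.min_add {g h : FOStr A r → (Fin n → ℕ) → ℕ} (hg : FOFun 𝒞 g) (hh : FOFun 𝒞 h) :
    FOFun 𝒞 fun S v => min (g S v + h S v) S.N := by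
  refine ⟨fun S _ v _ => min_le_right _ _, ?_⟩
  refine ((FOPred.eq_add (.var (Fin.last n)) hg.weaken hh.weaken).or
    ((FOPred.lt_add (.var (Fin.last n)) hg.weaken hh.weaken).and
      (FOPred.all (P := fun _ v m => m ≤ v (Fin.last n)) (.le (.var _) (.var _))))).congr
    fun S _ v hv => ?_
  have := hv (Fin.last n)
  dsimp only
  constructor
  · rintro (h | ⟨h, h'⟩)
    · omega
    · have := h' S.N le_rfl
      omega
  · intro h'
    by_cases hle : g S (Fin.init v) + h S (Fin.init v) ≤ S.N
    · left; omega
    · exact .inr ⟨by omega, fun m hm => by omega⟩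

theorem FOPred.ite_bool {P Q : FOStr A r → (Fin n → ℕ) → Prop} (b : Bool) (hP : FOPred 𝒞 P)
    (hQ : FOPred 𝒞 Q) : FOPred 𝒞 fun S v => bif b then P S v else Q S v := by
  cases b
  exacts [hQ, hP]

end Definability

section Sentence

variable {n : ℕ} {a b k K H N z T t t₁ t₂ d p c q g u x i j j' e e' q₀ :
  FOStr SRTSymbol 12 → (Fin n → ℕ) → ℕ}

local notation "Def" => FOPred (FOStr.IsFunctional (A := SRTSymbol) (r := 12))

local notation "Fun" => FOFun (FOStr.IsFunctional (A := SRTSymbol) (r := 12))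

theorem foPred_block (hp : Fun p) (hc : Fun c) (hq : Fun q) :
    Def fun S v => Block S.w (p S v) (c S v) (q S v) := by
  have h : Def fun S v => ∃ m ≤ S.N, m = p S v + c S v ∧ q S v = m + 1 :=
    .ex (.and (.eq_add (.var _) hp.weaken hc.weaken) (.eq_succ hq.weaken (.var _)))
  refine .and (.allLt hc (.letter_add (fun _ h => h.1) (fun o => o = some .tick) hp.weaken
    (.var _))) (.and (.letter_add (fun _ h => h.1) (fun o => o = some .sep) hp hc)
    (h.congr fun S hS v hv => ?_))
  constructor
  · rintro ⟨m, -, rfl, h⟩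
    exact h
  · intro h
    have := hq.1 S hS v hv
    exact ⟨_, by omega, rfl, h⟩

theorem foPred_transitionAt (hk : Fun k) (hp : Fun p) (hg : Fun g) (hu : Fun u) (hq : Fun q)
    {src lab out olab tgt : FOStr SRTSymbol 12 → (Fin n → ℕ) → ℕ} (h₁ : Fun src) (h₂ : Fun lab)
    (h₃ : Fun out) (h₄ : Fun olab) (h₅ : Fun tgt) :
    Def fun S v => TransitionAt S.w S.N (k S v) (p S v) (g S v) (u S v) (q S v) (src S v) (lab S v)
      (out S v) (olab S v) (tgt S v) := by
  have w4 : ∀ {g : FOStr SRTSymbol 12 → (Fin n → ℕ) → ℕ}, Fun g →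
      Fun fun S (v : Fin (n + 4) → ℕ) => g S (Fin.init (Fin.init (Fin.init (Fin.init v)))) :=
    fun h => h.weaken.weaken.weaken.weaken
  unfold TransitionAt
  refine .ex (.ex (.ex (.ex ?_)))
  refine .and (foPred_block (w4 hp) (w4 h₁) (.var _)) <|
    .and (foPred_block (.var _) (w4 h₂) (w4 hg)) <| .and (.allLt (w4 hk) ?_) <|
    .and (.eq_add (w4 hu) (w4 hg) (w4 hk)) <| .and (.allLt (w4 hk) ?_) <|
    .and (.eq_add (.var _) (w4 hu) (w4 hk)) <| .and (foPred_block (.var _) (w4 h₃) (.var _)) <|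
    .and (foPred_block (.var _) (w4 h₄) (.var _)) (foPred_block (.var _) (w4 h₅) (w4 hq))
  · exact .letter_add (fun _ h => h.1) (fun o => ∃ x, o = some (.cmp x)) (w4 hg).weaken (.var _)
  · exact .letter_add (fun _ h => h.1) (fun o => o = some (.upd .old) ∨ o = some (.upd .new))
      (w4 hu).weaken (.var _)

theorem foFun_app (s : Fin 12) (hx : Fun x) : Fun fun S v => S.f s (x S v) (x S v) :=
  .app s hx hx

theorem foPred_parses (ha : Fun a) (hb : Fun b) {m : FOStr SRTSymbol 12 → (Fin n → ℕ) → ℕ}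
    (hm : Fun m) (hk : Fun k) (hq₀ : Fun q₀) (hT : Fun T) :
    Def fun S v => (tableOf S.f).Parses S.w S.N (a S v) (b S v) (m S v) (k S v) (q₀ S v)
      (T S v) := by
  have w4 : ∀ {g : FOStr SRTSymbol 12 → (Fin n → ℕ) → ℕ}, Fun g →
      Fun fun S (v : Fin (n + 4) → ℕ) => g S (Fin.init (Fin.init (Fin.init (Fin.init v)))) :=
    fun h => h.weaken.weaken.weaken.weaken
  have app : ∀ s : Fin 12, Fun fun S (v : Fin (n + 1) → ℕ) =>
    S.f s (v (Fin.last n)) (v (Fin.last n)) := fun s => foFun_app s (.var _)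
  unfold CodeTable.Parses
  refine .and (.ex (.ex (.ex (.ex ?_)))) <| .and (.lt hq₀ hm) <|
    .and (.letter (fun o => o = none) (foFun_app 0 hT)) <|
    .allLt hT <| .and (.ex (.and (.eq_succ (.var _) (.var _)) ?_)) <|
    .and (.lt (app 1) hm.weaken) <| .and (.lt (app 2) ha.weaken) <|
    .and (.lt (app 4) hk.weaken) <| .and (.lt (app 5) hb.weaken) (.lt (app 6) hm.weaken)
  · exact .and (foPred_block .zero (w4 ha) (.var _)) <|
      .and (foPred_block (.var _) (w4 hb) (.var _)) <|
      .and (foPred_block (.var _) (w4 hm) (.var _)) <|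
      .and (foPred_block (.var _) (w4 hk) (.var _)) (foPred_block (.var _) (w4 hq₀)
        (foFun_app 0 .zero))
  · exact foPred_transitionAt hk.weaken.weaken (app 0).weaken (app 3).weaken (app 11).weaken
      (foFun_app 0 (.var _)) (app 1).weaken (app 2).weaken (app 4).weaken (app 5).weaken
      (app 6).weaken

theorem foFun_reg (hj : Fun j) (hi : Fun i) :
    Fun fun S v => (confOf S.N S.f (j S v)).R (i S v) := by
  refine (FOFun.app 10 hj (.min_add hi .zero)).congr fun S v _ => ?_
  simp [confOf]

theorem foFun_reg_add (hj : Fun j) (hk : Fun k) (hi : Fun i) :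
    Fun fun S v => (confOf S.N S.f (j S v)).R (k S v + i S v) :=
  .app 10 hj (.min_add hk hi)

theorem foPred_diff (hj : Fun j) : Def fun S v => (confOf S.N S.f (j S v)).diff :=
  .eq_const (foFun_app 9 hj) 1

theorem foPred_sameType (fin : Bool) (hz : Fun z) (hK : Fun K) (hj : Fun j) (hj' : Fun j') :
    Def fun S v => SameType fin (z S v) (K S v) (confOf S.N S.f (j S v)).R
      (confOf S.N S.f (j' S v)).R := by
  unfold SameType
  simp only [Nat.cast_id]
  have hw := hj.weaken.weaken
  have hw' := hj'.weaken.weaken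
  refine .and (.allLt hK (.allLt hK.weaken (.iff (.le (foFun_reg hw (.var _)) (foFun_reg hw (.var _)))
    (.le (foFun_reg hw' (.var _)) (foFun_reg hw' (.var _)))))) (.allLt hK (.allLe hz.weaken
    (.imp (.or (.prop _) (.eq (.var _) hz.weaken.weaken)) (.and (.iff ?_ ?_) (.iff ?_ ?_)))))
  · exact .le (foFun_reg hw (.var _)) (.var _)
  · exact .le (foFun_reg hw' (.var _)) (.var _)
  · exact .le (.var _) (foFun_reg hw (.var _))
  · exact .le (.var _) (foFun_reg hw' (.var _))

theorem foPred_similar (fin : Bool) (hz : Fun z) (hK : Fun K) (hj : Fun j) (hj' : Fun j') :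
    Def fun S v => (confOf S.N S.f (j S v)).Similar fin (z S v) (K S v)
      (confOf S.N S.f (j' S v)) :=
  .and (.eq (foFun_app 7 hj) (foFun_app 7 hj')) <|
    .and (.eq (foFun_app 8 hj) (foFun_app 8 hj')) <|
    .and (.iff (foPred_diff hj) (foPred_diff hj')) (foPred_sameType fin hz hK hj hj')

theorem foPred_isInit (hK : Fun K) (hq₀ : Fun q₀) (hz : Fun z) (hj : Fun j) :
    Def fun S v => (confOf S.N S.f (j S v)).IsInit (K S v) (q₀ S v) (z S v) :=
  .and (.eq (foFun_app 7 hj) hq₀) <| .and (.eq (foFun_app 8 hj) hq₀) <|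
    .and (foPred_diff hj).not (.allLt hK (.eq (foFun_reg hj.weaken (.var _)) hz.weaken))

theorem foPred_room (fin : Bool) (hz : Fun z) (hK : Fun K) (hH : Fun H) (hj : Fun j) :
    Def fun S v => Room fin (z S v) (K S v) (fun m => m ≤ H S v) (confOf S.N S.f (j S v)).R := by
  unfold Room
  simp only [Nat.cast_id]
  -- room immediately above or below a value
  have up : ∀ {m : ℕ} {K H j e : FOStr SRTSymbol 12 → (Fin m → ℕ) → ℕ}, Fun K → Fun H → Fun j →
      Fun e → Def fun S v => ∃ u ≤ H S v, e S v < u ∧ ∀ i < K S v,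
        e S v < (confOf S.N S.f (j S v)).R i → u < (confOf S.N S.f (j S v)).R i := by
    intro m K H j e hK hH hj he
    have hr := foFun_reg hj.weaken.weaken (.var (Fin.last (m + 1)))
    exact .exLe hH (.and (.lt he.weaken (.var _)) (.allLt hK.weaken (.imp
      (.lt he.weaken.weaken hr) (.lt (.var _) hr))))
  have down : ∀ {m : ℕ} {K H j e : FOStr SRTSymbol 12 → (Fin m → ℕ) → ℕ}, Fun K → Fun H → Fun j →
      Fun e → Def fun S v => ∃ u ≤ H S v, u < e S v ∧ ∀ i < K S v,
        (confOf S.N S.f (j S v)).R i < e S v → (confOf S.N S.f (j S v)).R i < u := by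
    intro m K H j e hK hH hj he
    have hr := foFun_reg hj.weaken.weaken (.var (Fin.last (m + 1)))
    exact .exLe hH (.and (.lt (.var _) he.weaken) (.allLt hK.weaken (.imp
      (.lt hr he.weaken.weaken) (.lt hr (.var _)))))
  have hr := foFun_reg hj.weaken (.var (Fin.last n))
  exact .and (.and (up hK hH hj hz) (.allLt hK (.imp (.le hz.weaken hr)
    (up hK.weaken hH.weaken hj.weaken hr)))) (.imp (.prop _) (.and (down hK hH hj hz)
    (.allLt hK (.imp (.le hr hz.weaken) (down hK.weaken hH.weaken hj.weaken hr)))))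

theorem foPred_compares (rev : Bool) (hx : Fun x) (hi : Fun i) (hd : Fun d) (he : Fun e) :
    Def fun S v => (bif rev then (letterGuard S.w[x S v + i S v]?).swap else
      letterGuard S.w[x S v + i S v]?).Compares (d S v) (e S v) := by
  have hl := fun o' : Ordering => FOPred.letter_add (fun _ (h : FOStr.IsFunctional _) => h.1)
    (fun o => (bif rev then (letterGuard o).swap else letterGuard o) = o') hx hi
  refine FOPred.congr (.and (.imp (hl .lt) (.lt hd he)) (.and (.imp (hl .eq) (.eq hd he))
    (.imp (hl .gt) (.lt he hd)))) fun S _ v _ => ?_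
  generalize (bif rev then (letterGuard S.w[x S v + i S v]?).swap else
      letterGuard S.w[x S v + i S v]?) = o
  cases o <;> simp [Ordering.Compares]

theorem foPred_enabled (rev : Bool) (hk : Fun k) (hj : Fun j) (h₁ : Fun t₁) (h₂ : Fun t₂)
    (hd : Fun d) : Def fun S v => ((tableOf S.f).data rev S.w (k S v) (T S v)).Enabled
      (confOf S.N S.f (j S v)) (t₁ S v) (t₂ S v) (d S v) :=
  .and (.eq (foFun_app 1 h₁) (foFun_app 7 hj)) <| .and (.eq (foFun_app 1 h₂) (foFun_app 8 hj)) <|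
    .and (.eq (foFun_app 2 h₁) (foFun_app 2 h₂)) <| .allLt hk <| .and
    (foPred_compares rev (foFun_app 3 h₁.weaken) (.var _) hd.weaken (foFun_reg hj.weaken (.var _)))
    (foPred_compares rev (foFun_app 3 h₂.weaken) (.var _) hd.weaken
      (foFun_reg_add hj.weaken hk.weaken (.var _)))

theorem foPred_next (rev : Bool) (hk : Fun k) (hj : Fun j) (h₁ : Fun t₁) (h₂ : Fun t₂)
    (hd : Fun d) (hj' : Fun j') :
    Def fun S v => ((tableOf S.f).data rev S.w (k S v) (T S v)).Next
      (confOf S.N S.f (j S v)) (t₁ S v) (t₂ S v) (d S v) (confOf S.N S.f (j' S v)) := by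
  have hl : ∀ {t}, Fun t → Def fun S (v : Fin (n + 1) → ℕ) =>
      letterUpdate S.w[S.f 11 (t S (Fin.init v)) (t S (Fin.init v)) + v (Fin.last n)]? =
        RegUpdate.new := fun ht =>
    .letter_add (fun _ h => h.1) (fun o => letterUpdate o = .new) (foFun_app 11 ht.weaken) (.var _)
  refine .and (.eq (foFun_app 7 hj') (foFun_app 6 h₁)) <|
    .and (.eq (foFun_app 8 hj') (foFun_app 6 h₂)) <| .and (.allLt hk ?_) <|
    .iff (foPred_diff hj') <| .or (foPred_diff hj) <|
    .or (.not (.eq (foFun_app 5 h₁) (foFun_app 5 h₂))) (.not (.eq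
      (foFun_reg hj' (foFun_app 4 h₁)) (foFun_reg_add hj' hk (foFun_app 4 h₂))))
  have r1 := foFun_reg hj.weaken (.var (Fin.last n))
  have r1' := foFun_reg hj'.weaken (.var (Fin.last n))
  have r2 := foFun_reg_add hj.weaken hk.weaken (.var (Fin.last n))
  have r2' := foFun_reg_add hj'.weaken hk.weaken (.var (Fin.last n))
  exact .and (.and (.imp (hl h₁) (.eq r1' hd.weaken)) (.imp (hl h₁).not (.eq r1' r1)))
    (.and (.imp (hl h₂) (.eq r2' hd.weaken)) (.imp (hl h₂).not (.eq r2' r2)))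

theorem foPred_closedFamily (fin rev : Bool) (hk : Fun k) (hK : Fun K) (hq₀ : Fun q₀) (hT : Fun T)
    (hz : Fun z) (hH : Fun H) :
    Def fun S v => ((tableOf S.f).data rev S.w (k S v) (T S v)).ClosedFamily fin (q₀ S v) (z S v)
      (H S v) S.N (K S v) (confOf S.N S.f) := by
  have h1 : Def fun S v => ∃ j ≤ S.N, (confOf S.N S.f j).IsInit (K S v) (q₀ S v) (z S v) :=
    .ex (foPred_isInit hK.weaken hq₀.weaken hz.weaken (.var _))
  have h2 : Def fun S v => ∀ j ≤ S.N, ∀ i < K S v, (confOf S.N S.f j).R i ≤ H S v :=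
    .all (.allLt hK.weaken (.le (foFun_reg (.var _) (.var _)) hH.weaken.weaken))
  have h3 : Def fun S (_ : Fin n → ℕ) => ∀ j ≤ S.N, ¬ (confOf S.N S.f j).diff :=
    .all (.not (foPred_diff (.var _)))
  have h4 : Def fun S v => ∀ j ≤ S.N, ∀ t₁ < T S v, ∀ t₂ < T S v, ∀ d ≤ H S v,
      ((tableOf S.f).data rev S.w (k S v) (T S v)).Enabled (confOf S.N S.f j) t₁ t₂ d →
      ∃ j' ≤ S.N, ((tableOf S.f).data rev S.w (k S v) (T S v)).Next (confOf S.N S.f j) t₁ t₂ d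
        (confOf S.N S.f j') :=
    .all (.allLt hT.weaken (.allLt hT.weaken.weaken (.allLe hH.weaken.weaken.weaken (.imp
      (foPred_enabled rev hk.weaken.weaken.weaken.weaken (.var _) (.var _) (.var _) (.var _))
      (.ex (foPred_next rev hk.weaken.weaken.weaken.weaken.weaken (.var _) (.var _) (.var _)
        (.var _) (.var _)))))))
  have h5 : Def fun S v => ∀ j ≤ S.N, ∃ j' ≤ S.N,
      (confOf S.N S.f j).Similar fin (z S v) (K S v) (confOf S.N S.f j') ∧
      Room fin (z S v) (K S v) (fun m => m ≤ H S v) (confOf S.N S.f j').R :=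
    .all (.ex (.and
      (foPred_similar fin hz.weaken.weaken hK.weaken.weaken (.var _) (.var _))
      (foPred_room fin hz.weaken.weaken hK.weaken.weaken hH.weaken.weaken (.var _))))
  refine ((FOPred.le hz hH).and (h1.and (h2.and (h3.and (h4.and h5))))).congr fun S _ v _ => ?_
  exact ⟨fun ⟨h0, h1, h2, h3, h4, h5⟩ => ⟨h0, h1, h2, h3, h4, h5⟩,
    fun ⟨h0, h1, h2, h3, h4, h5⟩ => ⟨h0, h1, h2, h3, h4, h5⟩⟩

theorem foPred_derivation (fin rev : Bool) (hk : Fun k) (hK : Fun K) (hq₀ : Fun q₀) (hT : Fun T)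
    (hz : Fun z) :
    Def fun S v => ((tableOf S.f).data rev S.w (k S v) (T S v)).Derivation fin (q₀ S v) (z S v)
      S.N (K S v) (confOf S.N S.f) := by
  have h1 : Def fun S v => ∀ j ≤ S.N, (confOf S.N S.f j).IsInit (K S v) (q₀ S v) (z S v) ∨
      ∃ j' < j, (confOf S.N S.f j').Similar fin (z S v) (K S v) (confOf S.N S.f j) ∨
        ∃ t₁ < T S v, ∃ t₂ < T S v, ∃ d ≤ S.N,
          ((tableOf S.f).data rev S.w (k S v) (T S v)).Enabled (confOf S.N S.f j') t₁ t₂ d ∧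
          ((tableOf S.f).data rev S.w (k S v) (T S v)).Next (confOf S.N S.f j') t₁ t₂ d
            (confOf S.N S.f j) :=
    .all (.or (foPred_isInit hK.weaken hq₀.weaken hz.weaken (.var _)) (.exLt (.var _) (.or
      (foPred_similar fin hz.weaken.weaken hK.weaken.weaken (.var _) (.var _))
      (.exLt hT.weaken.weaken (.exLt hT.weaken.weaken.weaken (.ex (.and
        (foPred_enabled rev hk.weaken.weaken.weaken.weaken.weaken (.var _) (.var _) (.var _)
          (.var _))
        (foPred_next rev hk.weaken.weaken.weaken.weaken.weaken (.var _) (.var _) (.var _)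
          (.var _) (.var _)))))))))
  have h2 : Def fun S (_ : Fin n → ℕ) => ∃ j ≤ S.N, (confOf S.N S.f j).diff :=
    .ex (foPred_diff (.var _))
  exact (h1.and h2).congr fun S _ v _ => ⟨fun ⟨h1, h2⟩ => ⟨h1, h2⟩, fun ⟨h1, h2⟩ => ⟨h1, h2⟩⟩

end Sentence

/-! ### The two problems -/

/-- The functionality problem (for `F = true`) and the non-functionality problem (for `F = false`). -/
def problemAU (F : Bool) (D : Type*) [LinearOrder D] [AddGroup D] : Set (List SRTSymbol) :=
  {w | ∃ (a b n k : ℕ) (S : SRT (Fin a) (Fin b) D (Fin n) k),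
    S.AddFree ∧ S.Uninitialized ∧ S.IsCode w ∧ (S.Functional ↔ F = true)}

section

variable {F : Bool} {D : Type*} [LinearOrder D] [AddGroup D] {w : List SRTSymbol}

theorem mem_problemAU {a b n k : ℕ} {q₀ : Fin n}
    {l : List (SRTTransition (Fin a) (Fin b) (Fin n) k)} {P : TransducerData} (hP : P.Describes l)
    (hw : w = unaryCode a ++ unaryCode b ++ unaryCode n ++ unaryCode k ++ unaryCode q₀ ++
      l.flatMap SRTTransition.code) (hl : ∀ s ∈ l, ∀ i, s.update i ≠ .add)
    (hF : P.Flagged Set.univ q₀ (0 : D) ↔ F = false) : w ∈ problemAU F D := by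
  let S : SRT (Fin a) (Fin b) D (Fin n) k := ⟨q₀, fun _ => 0, {s | s ∈ l}⟩
  have hl' : ∀ s, s ∈ l ↔ s ∈ S.trans := fun _ => Iff.rfl
  refine ⟨a, b, n, k, S, hl, fun _ => rfl, ⟨l, hl', hw⟩, ?_⟩
  rw [← not_iff_not, not_functional_iff hl' hP hl fun _ => rfl, hF]
  simp

theorem exists_of_mem_problemAU (hw : w ∈ problemAU F D) : ∃ (a b n k : ℕ) (q₀ : Fin n)
      (l : List (SRTTransition (Fin a) (Fin b) (Fin n) k)),
      w = unaryCode a ++ unaryCode b ++ unaryCode n ++ unaryCode k ++ unaryCode q₀ ++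
        l.flatMap SRTTransition.code ∧ (∀ s ∈ l, ∀ i, s.update i ≠ .add) ∧
      ∀ P : TransducerData, P.Describes l → (P.Flagged Set.univ q₀ (0 : D) ↔ F = false) := by
  obtain ⟨a, b, n, k, S, hS, hS₀, ⟨l, hl, hw⟩, hF⟩ := hw
  refine ⟨a, b, n, k, S.start, l, hw, fun s hs => hS s ((hl s).1 hs), fun P hP => ?_⟩
  rw [← not_functional_iff hl hP hS hS₀, hF]
  simp

end

/-- The sentence about a word, a number `N` and functions on `{0, …, N}` that says that the word is a
code and that the functions are a certificate. The number `fin` of data values below zero is given,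
if it is finite. In this case zero is represented by this number, and otherwise by a number that
leaves enough room for the register values below zero. -/
def IsCertified (F : Bool) (fin : Option ℕ) (rev : Bool) (w : List SRTSymbol) (N : ℕ)
    (f : Fin 12 → ℕ → ℕ → ℕ) : Prop :=
  ∃ a ≤ N, ∃ b ≤ N, ∃ n ≤ N, ∃ k ≤ N, ∃ K ≤ N, ∃ q₀ ≤ N, ∃ T ≤ N, ∃ z ≤ N, ∃ H ≤ N, K = k + k ∧
    (tableOf f).Parses w N a b n k q₀ T ∧ z = fin.getD (K + K + 1) ∧
    bif F then ((tableOf f).data rev w k T).ClosedFamily fin.isSome q₀ z H N K (confOf N f)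
    else ((tableOf f).data rev w k T).Derivation fin.isSome q₀ z N K (confOf N f)

theorem foPred_isCertified (F : Bool) (fin : Option ℕ) (rev : Bool) :
    FOPred FOStr.IsFunctional fun S (_ : Fin 0 → ℕ) => IsCertified F fin rev S.w S.N S.f := by
  refine .ex (.ex (.ex (.ex (.ex (.ex (.ex (.ex (.ex (.and (.eq_add (.var _) (.var _) (.var _))
    (.and (foPred_parses (.var _) (.var _) (.var _) (.var _) (.var _) (.var _)) (.and ?_
    (.ite_bool F
      (foPred_closedFamily _ rev (.var _) (.var _) (.var _) (.var _) (.var _) (.var _))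
      (foPred_derivation _ rev (.var _) (.var _) (.var _) (.var _) (.var _))))))))))))))
  cases fin with
  | some m => exact .eq_const (.var _) m
  | none =>
    have : ∀ K z : Fin 9, FOPred (FOStr.IsFunctional (A := SRTSymbol) (r := 12))
        fun _ v => v z = v K + v K + 1 := fun K z => by
      refine (FOPred.ex (P := fun _ v m => m = v K + v K ∧ v z = m + 1) (.and
        (.eq_add (.var _) (.var K.castSucc) (.var K.castSucc))
        (.eq_succ (.var z.castSucc) (.var _)))).congr fun S _ v hv => ?_
      constructor
      · rintro ⟨m, -, rfl, h⟩
        exact h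
      · intro h
        have := hv z
        exact ⟨_, by omega, rfl, h⟩
    exact this 4 7

theorem card_smallConf_le {n k H L m : ℕ} (hn : n < L) (hk : k < L)
    (hH : H ≤ m + 8 * L + 2) :
    Nat.card (SmallConf n (k + k) H) ≤ 2 ^ (2 * L + 1 + (2 * L + 1) * (m + 8 * L + 3)) := by
  have hcard : Nat.card (SmallConf n (k + k) H) = n * (n * (2 * (H + 1) ^ (k + k))) := by
    simp
  have h1 : n ≤ 2 ^ L := (hn.trans Nat.lt_two_pow_self).le
  have h2 : H + 1 ≤ 2 ^ (m + 8 * L + 3) := by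
    have : m + 8 * L + 3 < 2 ^ (m + 8 * L + 3) := Nat.lt_two_pow_self
    omega
  have h3 : (H + 1) ^ (k + k) ≤ (2 ^ (m + 8 * L + 3)) ^ (2 * L + 1) :=
    (Nat.pow_le_pow_left h2 _).trans (Nat.pow_le_pow_right Nat.one_le_two_pow (by omega))
  rw [hcard]
  calc n * (n * (2 * (H + 1) ^ (k + k)))
      ≤ 2 ^ L * (2 ^ L * (2 * (2 ^ (m + 8 * L + 3)) ^ (2 * L + 1))) := by
        gcongr
    _ = 2 ^ (2 * L + 1 + (2 * L + 1) * (m + 8 * L + 3)) := by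
        rw [← pow_mul]
        ring

/-- A table and a family of configurations are given by functions on `{0, …, N}`. -/
theorem exists_functions {N n K H : ℕ} (G : CodeTable) (hN : 1 ≤ N) (hn : n ≤ N) (hK : K ≤ N)
    (hH : H ≤ N) (g : ℕ → SmallConf n K H)
    (hG : ∀ t, G.pos t ≤ N ∧ G.src t ≤ N ∧ G.lab t ≤ N ∧ G.guards t ≤ N ∧ G.updates t ≤ N ∧
        G.out t ≤ N ∧ G.olab t ≤ N ∧ G.tgt t ≤ N) :
    ∃ f : Fin 12 → ℕ → ℕ → ℕ, (∀ s x y, f s x y ≤ N) ∧ tableOf f = G ∧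
      confOf N f = fun j => (g j).toConf := by
  refine ⟨![fun t _ => G.pos t, fun t _ => G.src t, fun t _ => G.lab t, fun t _ => G.guards t,
    fun t _ => G.out t, fun t _ => G.olab t, fun t _ => G.tgt t, fun j _ => (g j).toConf.q₁,
    fun j _ => (g j).toConf.q₂, fun j _ => if (g j).2.2.1 then 1 else 0,
    fun j i => (g j).toConf.R i, fun t _ => G.updates t], fun s x y => ?_, rfl, funext fun j => ?_⟩
  · obtain ⟨h1, h2, h3, h4, h5, h6, h7, h8⟩ := hG x
    have h9 := (g x).toConf_lt
    have h10 := h9.2.2 y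
    fin_cases s <;> simp <;> try omega
    split_ifs <;> omega
  · have hR : ∀ i, (g j).toConf.R (min i N) = (g j).toConf.R i := by
      intro i
      rcases le_total i N with h | h
      · rw [min_eq_left h]
      · rw [min_eq_right h]
        simp [SmallConf.toConf, hK.not_gt, (hK.trans h).not_gt]
    have hd : ((if (g j).2.2.1 then 1 else 0) = 1) = (g j).toConf.diff := by
      simp [SmallConf.toConf]
    simp only [confOf]
    change PairConf.mk _ _ ((if (g j).2.2.1 then 1 else 0) = 1)
      (fun i => (g j).toConf.R (min i N)) = _
    rw [hd, funext hR]
    rfl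

/-- If finitely many data values in the order of `D` (or, if `rev`, in the dual order) are less than
zero, let `fin` be their number. Then the problems are in `NEXPTIME`. -/
theorem problemAU_mem_NEXPTIME_of_model (F : Bool) {D : Type*} [LinearOrder D] [AddGroup D]
    (fin : Option ℕ) (rev : Bool) (hD : ∀ (P : TransducerData) (n q₀ z : ℕ), P.Bounded n →
      (∀ m ∈ fin, z = m) → (P.Flagged Set.univ q₀ (0 : D) ↔
        (bif rev then P.rev else P).Flagged (Admissible fin.isSome z) q₀ (z : ℚ))) :
    problemAU F D ∈ NEXPTIME := by
  have hrev : ∀ (G : CodeTable) (w : List SRTSymbol) (k T : ℕ),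
      (bif rev then (G.data false w k T).rev else G.data false w k T) = G.data rev w k T := by
    intros
    cases rev <;> rfl
  have hz : ∀ K, ∀ m ∈ fin, fin.getD (K + K + 1) = m := fun K m hm => by
    rw [Option.mem_def.1 hm]
    rfl
  have hb : ∀ {G : CodeTable} {w : List SRTSymbol} {k T n : ℕ}, (G.data false w k T).Bounded n →
      (G.data rev w k T).Bounded n := fun h => ⟨h.tgt, h.out⟩
  -- the exponent of the bound on the number of small configurations, for an input of length `X`
  open Polynomial in
  refine mem_NEXPTIME_of_foPred (foPred_isCertified F fin rev) _
    (2 * X + 1 + (2 * X + 1) * (C (fin.getD 0) + 8 * X + 3)) (fun w hw => ?_)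
    fun w N f hwN hf h => ?_
  · obtain ⟨a, b, n, k, q₀, l, hwl, hl, hF⟩ := exists_of_mem_problemAU hw
    set L := w.length with hL
    set m := fin.getD 0 with hm
    set N := 2 ^ (2 * L + 1 + (2 * L + 1) * (m + 8 * L + 3)) with hN
    have hsmall : m + 8 * L + 3 < N := by
      refine Nat.lt_two_pow_self.trans_le (Nat.pow_le_pow_right (by norm_num) ?_)
      nlinarith
    have hwN : L ≤ N := by omega
    obtain ⟨G, hG, hd, hT, hbound⟩ := exists_parses hwN q₀.2 hwl hl
    obtain ⟨⟨p₁, _, p₂, _, p₃, _, p₄, _, b1, b2, b3, b4, b5⟩, _⟩ := id hG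
    have := b1.le_length
    have := b2.le_length
    have := b3.le_length
    have := b4.le_length
    have := b5.le_length
    set z := fin.getD (k + k + (k + k) + 1) with hz_def
    have hzm : z ≤ m + (k + k + (k + k) + 1) := by
      cases fin <;> simp [hz_def, hm]
    have hzk : fin.isSome = false → 2 * (k + k) < z := by
      cases fin <;> simp [hz_def]
      omega
    have hflag := (hD _ n q₀ z hd.bounded (hz (k + k))).symm.trans (hF _ hd)
    rw [hrev] at hflag
    have hcard : Nat.card (SmallConf n (k + k) (z + 2 * (k + k) + 1)) ≤ N + 1 :=
      (card_smallConf_le (L := L) (m := m) (by omega) (by omega) (by omega)).trans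
        (Nat.le_succ _)
    have hg : ∃ g : ℕ → SmallConf n (k + k) (z + 2 * (k + k) + 1),
        bif F then (G.data rev w k l.length).ClosedFamily fin.isSome q₀ z (z + 2 * (k + k) + 1) N
          (k + k) fun j => (g j).toConf
        else (G.data rev w k l.length).Derivation fin.isSome q₀ z N (k + k)
          fun j => (g j).toConf := by
      cases F
      · exact TransducerData.exists_derivation (P := G.data rev w k l.length) (hb hd.bounded) q₀.2 hzk
          (show z + 2 * (k + k) + 1 ≤ N by omega) hcard (hflag.2 rfl)
      · exact TransducerData.exists_closedFamily (P := G.data rev w k l.length) (hb hd.bounded) q₀.2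
          hzk hcard (by simp [hflag])
    obtain ⟨g, hg⟩ := hg
    obtain ⟨f, hf, rfl, hC⟩ := exists_functions G (N := N) (by omega) (by omega) (by omega)
      (by omega) g hbound
    rw [← hC] at hg
    exact ⟨N, by simp [hN, hm, hL], hwN, f, hf, a, by omega, b, by omega, n, by omega, k, by omega,
      k + k, by omega, q₀, by omega, l.length, hT, z, by omega, z + 2 * (k + k) + 1, by omega, rfl,
      hG, rfl, hg⟩
  · obtain ⟨a, -, b, -, n, -, k, -, K, -, q₀, -, T, -, z, -, H, -, rfl, hG, rfl, hC⟩ := h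
    obtain ⟨l, hw, hd, hl⟩ := hG.exists_list
    refine mem_problemAU (q₀ := ⟨q₀, hG.2.1⟩) hd hw hl ?_
    rw [hD _ n q₀ _ hd.bounded (hz (k + k)), hrev]
    cases F
    · exact iff_of_true (TransducerData.Derivation.flagged
        (P := (tableOf f).data rev w k T) hC (hb hd.bounded)) rfl
    · exact iff_of_false (TransducerData.ClosedFamily.not_flagged
        (P := (tableOf f).data rev w k T) hC (hb hd.bounded)) (by simp)

/-! ### The models of the data domains -/

section

variable {D : Type*} [LinearOrder D] [AddGroup D]

theorem problemAU_true : problemAU true D = functionalityProblemAU D := by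
  simp [problemAU, functionalityProblemAU]

theorem problemAU_false : problemAU false D = nonfunctionalityProblemAU D := by
  simp [problemAU, nonfunctionalityProblemAU]

open Set in
/-- The order of `D` or its dual order is infinite above zero. So the data values from `D` can be
replaced by rational numbers. -/
theorem exists_model (D : Type*) [LinearOrder D] [AddGroup D] [Infinite D] :
    ∃ (fin : Option ℕ) (rev : Bool), ∀ (P : TransducerData) (n q₀ z : ℕ), P.Bounded n →
      (∀ m ∈ fin, z = m) → (P.Flagged univ q₀ (0 : D) ↔
        (bif rev then P.rev else P).Flagged (Admissible fin.isSome z) q₀ (z : ℚ)) := by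
  by_cases h₂ : (Ioi (0 : D)).Finite
  · -- in the dual order, all but finitely many elements are greater than zero
    have h₁ : (Iio (0 : D)).encard = ⊤ := by
      rw [encard_eq_top_iff]
      intro h
      refine infinite_univ (α := D) (((h.union h₂).insert 0).subset fun x _ => ?_)
      rcases lt_trichotomy x 0 with h | h | h
      exacts [.inr (.inl h), .inl h, .inr (.inr h)]
    obtain ⟨m, hm⟩ := h₂.exists_encard_eq_coe
    refine ⟨some m, true, fun P n q₀ z hP hz => ?_⟩
    obtain rfl : z = m := hz m rfl
    rw [← TransducerData.flagged_rev_iff]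
    refine TransducerData.flagged_iff (n := n) ⟨hP.tgt, hP.out⟩ (mem_univ _)
      (natCast_mem_admissible _ _ _) ?_ ?_
    · refine Eq.trans ?_ (encard_admissible_true_Iio z).symm
      refine Eq.trans (congrArg encard ?_) hm
      exact univ_inter _
    · refine Eq.trans ?_ (encard_admissible_Ioi _ z).symm
      refine Eq.trans (congrArg encard ?_) h₁
      exact univ_inter _
  · have h₂ : (Ioi (0 : D)).encard = ⊤ := encard_eq_top_iff.2 h₂
    by_cases h₁ : (Iio (0 : D)).Finite
    · obtain ⟨m, hm⟩ := h₁.exists_encard_eq_coe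
      refine ⟨some m, false, fun P n q₀ z hP hz => ?_⟩
      obtain rfl : z = m := hz m rfl
      exact TransducerData.flagged_iff hP (mem_univ _) (natCast_mem_admissible _ _ _)
        (by rw [univ_inter, hm]; exact (encard_admissible_true_Iio z).symm)
        (by rw [univ_inter, h₂, encard_admissible_Ioi])
    · have h₁ : (Iio (0 : D)).encard = ⊤ := encard_eq_top_iff.2 h₁
      exact ⟨none, false, fun P n q₀ z hP _ =>
        TransducerData.flagged_iff hP (mem_univ _) (natCast_mem_admissible _ _ _)
          (by rw [univ_inter, h₁]; exact (encard_admissible_false_Iio z).symm)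
          (by rw [univ_inter, h₂, encard_admissible_Ioi])⟩

theorem problemAU_mem_NEXPTIME (F : Bool) (D : Type*) [LinearOrder D] [AddGroup D] [Infinite D] :
    problemAU F D ∈ NEXPTIME := by
  obtain ⟨fin, rev, hD⟩ := exists_model D
  exact problemAU_mem_NEXPTIME_of_model F fin rev hD

open Set in
/-- In an infinite bi-ordered group, negation exchanges the two sides of zero. -/
theorem encard_eq_top_of_ordered (D : Type*) [LinearOrder D] [AddGroup D] [Infinite D]
    [AddLeftMono D] [AddRightMono D] :
    (Iio (0 : D)).encard = ⊤ ∧ (Ioi (0 : D)).encard = ⊤ := by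
  have h : Neg.neg '' Ioi (0 : D) = Iio 0 := by
    ext x
    simp only [mem_image, mem_Ioi, mem_Iio]
    exact ⟨by rintro ⟨y, hy, rfl⟩; simpa using hy, fun hx => ⟨-x, by simpa using hx, neg_neg x⟩⟩
  have h' : (Iio (0 : D)).encard = (Ioi (0 : D)).encard := by
    rw [← h, neg_injective.injOn.encard_image]
  rw [h', and_self, encard_eq_top_iff]
  intro hfin
  have hfin' : (Iio (0 : D)).Finite := h ▸ hfin.image _
  refine infinite_univ (α := D) (((hfin'.union hfin).insert 0).subset fun x _ => ?_)
  rcases lt_trichotomy x 0 with h | h | h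
  exacts [.inr (.inl h), .inl h, .inr (.inr h)]

theorem problemAU_subset (F : Bool) (D D' : Type*) [LinearOrder D] [AddGroup D] [Infinite D]
    [AddLeftMono D] [AddRightMono D] [LinearOrder D'] [AddGroup D'] [Infinite D'] [AddLeftMono D']
    [AddRightMono D'] : problemAU F D ⊆ problemAU F D' := by
  intro w hw
  obtain ⟨a, b, n, k, q₀, l, hw, hl, hF⟩ := exists_of_mem_problemAU hw
  obtain ⟨G, -, hG, -⟩ := exists_parses le_rfl q₀.2 hw hl
  refine mem_problemAU hG hw hl ((TransducerData.flagged_iff hG.bounded (Set.mem_univ _)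
    (Set.mem_univ _) ?_ ?_).trans (hF _ hG))
  · rw [Set.univ_inter, Set.univ_inter, (encard_eq_top_of_ordered D).1,
      (encard_eq_top_of_ordered D').1]
  · rw [Set.univ_inter, Set.univ_inter, (encard_eq_top_of_ordered D).2,
      (encard_eq_top_of_ordered D').2]

end

theorem mainTheorem12 :
    (∀ (D : Type u) [LinearOrder D] [AddGroup D] [Infinite D],
      functionalityProblemAU D ∈ NEXPTIME ∧ nonfunctionalityProblemAU D ∈ NEXPTIME) ∧
    (∃ L₁ ∈ NEXPTIME, ∃ L₂ ∈ NEXPTIME,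
      ∀ (D : Type u) [LinearOrder D] [AddGroup D] [Infinite D] [AddLeftMono D] [AddRightMono D],
        functionalityProblemAU D = L₁ ∧ nonfunctionalityProblemAU D = L₂) := by
  simp only [← problemAU_true, ← problemAU_false]
  exact ⟨fun D _ _ _ => ⟨problemAU_mem_NEXPTIME _ D, problemAU_mem_NEXPTIME _ D⟩,
    problemAU true ℤ, problemAU_mem_NEXPTIME _ ℤ, problemAU false ℤ, problemAU_mem_NEXPTIME _ ℤ,
    fun D _ _ _ _ _ => ⟨(problemAU_subset _ D ℤ).antisymm (problemAU_subset _ ℤ D),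
      (problemAU_subset _ D ℤ).antisymm (problemAU_subset _ ℤ D)⟩⟩
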